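/- **Setting.** Let $d\in\{2,3\}$, $T>0$, let $\Omega\subset\mathbb R^d$ be a domain and $\mathbf w=\mathbf w(x,t)$ a smooth velocity field on $\Omega\times[0,T]$. Let $\Gamma(t)\subset\Omega$, $t\in[0,T]$, be smooth, closed, connected, oriented hypersurfaces with unit normal $\mathbf n$, passively advected by $\mathbf w$, i.e. $\Gamma(t)=\Phi_t(\Gamma(0))$, where $\Phi_t$ is the smooth flow of $\mathbf w$ ($\partial_t\Phi_t=\mathbf w(\Phi_t,t)$, $\Phi_0=\mathrm{id}$), defined for $t\in[0,T]$ in a neighbourhood of $\Gamma(0)$. Put $\mathcal S=\bigcup_{t\in(0,T)}\Gamma(t)\times\{t\}$, $(v,w)_0=\int_0^T\int_{\Gamma(t)}vw\,ds\,dt$, $\nabla_\Gamma=(I-\mathbf n\mathbf n^T)\nabla$, $\operatorname{div}_\Gamma\mathbf w=\operatorname{tr}((I-\mathbf n\mathbf n^T)\nabla\mathbf w)$ and $\dot\varphi=\partial_t\varphi+\mathbf w\cdot\nabla\varphi$ for smooth $\varphi$. Let $H$ be the Hilbert space of all $v\in L^2(\mathcal S)$ with (generalized) tangential gradient $\nabla_\Gamma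 v\in L^2(\mathcal S)$, i.e. the closure of $C_0^1(\mathcal S)$ in the norm $\|v\|_H^2=\|v\|_0^2+\|\nabla_\Gamma v\|_0^2$. For $N\ge 1$ let $t_n=nT/N$, $I_n=(t_{n-1},t_n]$, $\mathcal S^n=\bigcup_{t\in I_n}\Gamma(t)\times\{t\}$ and $H_n=\{v\in H: v=0\text{ on }\mathcal S\setminus\mathcal S^n\}$. For $v\in H_n$ we write $\dot v\in H_n'$ if the functional $$\varphi\mapsto-\int_0^T\int_{\Gamma(t)}v\,(\dot\varphi+\varphi\operatorname{div}_\Gamma\mathbf w)\,ds\,dt,$$ defined for $C^1$ functions $\varphi$ with compact support in $\bigcup_{t\in(t_{n-1},t_n)}\Gamma(t)\times\{t\}$, extends to a bounded linear functional on $H_n$, denoted $\langle\dot v,\cdot\rangle$. Let $W_n=\{v\in H_n:\dot v\in H_n'\}$ and let $W^b=\bigoplus_{n=1}^N W_n$, with $$\|v\|_{W^b}^2=\sum_{n=1}^N\big(\|v_n\|_H^2+\|\dot v_n\|_{H_n'}^2\big),$$ where $v=(v_1,\dots,v_N)$ is identified with $\sum_n v_n\in H$. For $v\in W^b$ let $v_\pm^n\in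 L^2(\Gamma(t_n))$ be the one-sided limits of $v(\cdot,t)$ for $t\to t_n$, $\pm(t-t_n)>0$ (essential limits in $L^2$, functions on different $\Gamma(t)$ being compared along the flow). Let $[v]^0=v_+^0$ and $[v]^n=v_+^n-v_-^n$ for $1\le n\le N-1$, and let $(\cdot,\cdot)_{t_n}$, $\|\cdot\|_{t_n}$ be the inner product and norm of $L^2(\Gamma(t_n))$; we write $\|v\|_T=\|v_-^N\|_{t_N}$. Put $$|||v|||_h^2=\max_{1\le n\le N}\|v_-^n\|_{t_n}^2+\sum_{n=1}^N\|[v]^{n-1}\|_{t_{n-1}}^2+\|v\|_H^2 .$$ For $\nu_d>0$, $\sigma\ge0$ and $u,v\in W^b$ let $\bar u(t)=\int_{\Gamma(t)}u\,ds$ and $$\langle\dot u,v\rangle_b=\sum_{n=1}^N\langle\dot u_n,v_n\rangle,\qquad d(u,v)=\sum_{n=1}^N([u]^{n-1},v_+^{n-1})_{t_{n-1}},$$ $$a_\sigma(u,v)=\nu_d(\nabla_\Gamma u,\nabla_\Gamma v)_0+(\operatorname{div}_\Gamma\mathbf w\,u,v)_0+\sigma\int_0^T\bar u(t)\,\bar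 v(t)\,dt .$$ **Lemma.** There is a constant $c$, which may depend on the evolving surface $(\Gamma(t))_{t\in[0,T]}$, on $\mathbf w$, $\nu_d$ and $\sigma$, but not on $N$, $e$, $v$, such that for all $N\ge1$ and all $e,v\in W^b$ $$|\langle\dot e,v\rangle_b+a_\sigma(e,v)+d(e,v)|\le c\,|||v|||_h\Big(\|e\|_{W^b}+\sum_{n=0}^{N-1}\|[e]^n\|_{t_n}\Big),$$ $$|\langle\dot e,v\rangle_b+a_\sigma(e,v)+d(e,v)|\le c\,|||e|||_h\Big(\|v\|_{W^b}+\sum_{n=1}^{N-1}\|[v]^n\|_{t_n}+\|v\|_T\Big).$$ -/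

import Mathlib

open MeasureTheory Set Filter Topology
open scoped ContDiff ENNReal

noncomputable section

/-- `Γ ⊆ ℝ^d` is a smooth embedded hypersurface without boundary: near each of its points it is the
zero set of a smooth function with nowhere vanishing differential. -/
def IsSmoothHypersurface {d : ℕ} (Γ : Set (EuclideanSpace ℝ (Fin d))) : Prop :=
  ∀ x ∈ Γ, ∃ U : Set (EuclideanSpace ℝ (Fin d)), IsOpen U ∧ x ∈ U ∧
    ∃ f : EuclideanSpace ℝ (Fin d) → ℝ, ContDiffOn ℝ ∞ f U ∧
      (∀ y ∈ U, fderiv ℝ f y ≠ 0) ∧ Γ ∩ U = {y ∈ U | f y = 0}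

/-- A closed, connected, oriented smooth hypersurface `Γ(t) ⊂ Ω ⊂ ℝ^d`, `t ∈ [0, T]`, passively
advected by a smooth velocity field `w`: `Γ(t)` is the image of `Γ₀ = Γ(0)` under the flow `Φ`
of `w`. Points of space-time are written `p = (x, t)`. -/
structure EvolvingSurface (d : ℕ) where
  /-- final time -/
  T : ℝ
  T_pos : 0 < T
  /-- the fixed spatial domain -/
  Ω : Set (EuclideanSpace ℝ (Fin d))
  isOpen_Ω : IsOpen Ω
  isConnected_Ω : IsConnected Ω
  /-- the velocity field, `w (x, t)` -/
  w : EuclideanSpace ℝ (Fin d) × ℝ → EuclideanSpace ℝ (Fin d)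
  contDiffOn_w : ContDiffOn ℝ ∞ w (Ω ×ˢ Icc 0 T)
  /-- the initial surface -/
  Γ₀ : Set (EuclideanSpace ℝ (Fin d))
  isCompact_Γ₀ : IsCompact Γ₀
  isConnected_Γ₀ : IsConnected Γ₀
  isSmoothHypersurface_Γ₀ : IsSmoothHypersurface Γ₀
  /-- the flow of `w`: `Φ t y` is the position at time `t` of the particle that starts in `y` -/
  Φ : ℝ → EuclideanSpace ℝ (Fin d) → EuclideanSpace ℝ (Fin d)
  /-- a neighbourhood of the initial surface on which the flow exists up to time `T` -/
  V : Set (EuclideanSpace ℝ (Fin d))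
  isOpen_V : IsOpen V
  Γ₀_subset_V : Γ₀ ⊆ V
  contDiffOn_Φ : ContDiffOn ℝ ∞
    (fun q : EuclideanSpace ℝ (Fin d) × ℝ => Φ q.2 q.1) (V ×ˢ Icc 0 T)
  Φ_zero : ∀ y ∈ V, Φ 0 y = y
  Φ_mem : ∀ y ∈ V, ∀ t ∈ Icc 0 T, Φ t y ∈ Ω
  hasDerivWithinAt_Φ : ∀ y ∈ V, ∀ t ∈ Icc 0 T,
    HasDerivWithinAt (fun s => Φ s y) (w (Φ t y, t)) (Icc 0 T) t
  /-- the unit normal (the orientation), `normal (x, t)` being normal to `Γ(t)` at `x ∈ Γ(t)` -/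
  normal : EuclideanSpace ℝ (Fin d) × ℝ → EuclideanSpace ℝ (Fin d)
  continuousOn_normal : ContinuousOn normal {p | p.2 ∈ Icc 0 T ∧ p.1 ∈ Φ p.2 '' Γ₀}
  norm_normal : ∀ t ∈ Icc 0 T, ∀ x ∈ Φ t '' Γ₀, ‖normal (x, t)‖ = 1
  inner_normal : ∀ t ∈ Icc 0 T, ∀ x ∈ Φ t '' Γ₀, ∀ τ ∈ tangentConeAt ℝ (Φ t '' Γ₀) x,
    inner ℝ (normal (x, t)) τ = 0

namespace EvolvingSurface

variable {d : ℕ} (M : EvolvingSurface d)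

/-! ### Geometry -/

/-- The surface `Γ(t)`. -/
def Γ (t : ℝ) : Set (EuclideanSpace ℝ (Fin d)) := M.Φ t '' M.Γ₀

/-- The part of the space-time surface with `a < t < b`; for `a = 0`, `b = T` this is the
space-time manifold `𝒮`. -/
def slab (a b : ℝ) : Set (EuclideanSpace ℝ (Fin d) × ℝ) := {p | p.2 ∈ Ioo a b ∧ p.1 ∈ M.Γ p.2}

/-- The surface measure `ds` of `Γ(t)`: the `(d-1)`-dimensional Hausdorff measure, normalized to
agree with Lebesgue measure on `(d-1)`-planes. -/
def surfaceMeasure (t : ℝ) : Measure (EuclideanSpace ℝ (Fin d)) := μHE[d - 1].restrict (M.Γ t)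

/-- The measure `ds dt` on the space-time manifold: `∫ f = ∫_0^T ∫_{Γ(t)} f(x,t) ds dt`. -/
def stMeasure : Measure (EuclideanSpace ℝ (Fin d) × ℝ) :=
  (volume.restrict (Ioo 0 M.T)).bind fun t => (M.surfaceMeasure t).map fun x => (x, t)

/-- The tangential projection `I - n nᵀ` at `p = (x, t)`. -/
def tangProj (p : EuclideanSpace ℝ (Fin d) × ℝ) :
    EuclideanSpace ℝ (Fin d) →L[ℝ] EuclideanSpace ℝ (Fin d) :=
  ContinuousLinearMap.id ℝ _ - (innerSL ℝ (M.normal p)).smulRight (M.normal p)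

/-- The tangential gradient `∇_Γ φ = (I - n nᵀ) ∇ₓ φ` of a differentiable function. -/
def tangGrad (φ : EuclideanSpace ℝ (Fin d) × ℝ → ℝ) (p : EuclideanSpace ℝ (Fin d) × ℝ) :
    EuclideanSpace ℝ (Fin d) :=
  M.tangProj p (gradient (fun x => φ (x, p.2)) p.1)

/-- The material derivative `∂φ/∂t + w · ∇φ` of a differentiable function. -/
def matDeriv (φ : EuclideanSpace ℝ (Fin d) × ℝ → ℝ) (p : EuclideanSpace ℝ (Fin d) × ℝ) : ℝ :=
  fderiv ℝ φ p (M.w p, 1)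

/-- The surface divergence `div_Γ w = tr ((I - n nᵀ) ∇w)`. -/
def divw (p : EuclideanSpace ℝ (Fin d) × ℝ) : ℝ :=
  LinearMap.trace ℝ (EuclideanSpace ℝ (Fin d))
    (M.tangProj p ∘L fderiv ℝ (fun x => M.w (x, p.2)) p.1).toLinearMap

/-- `φ` (a function near `𝒮`, only its values on `𝒮` matter) represents an element of
`C¹₀(𝒮 ∩ {a < t < b})`, extended by zero to `𝒮`. -/
def IsTest (a b : ℝ) (φ : EuclideanSpace ℝ (Fin d) × ℝ → ℝ) : Prop :=
  (∀ p ∈ M.slab 0 M.T, ContDiffAt ℝ 1 φ p) ∧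
    ∃ K : Set (EuclideanSpace ℝ (Fin d) × ℝ), IsCompact K ∧ K ⊆ M.slab a b ∧
      ∀ p ∈ M.slab 0 M.T, p ∉ K → φ p = 0

/-! ### Function spaces -/

/-- Pairs of a scalar and a vector field in `L²(𝒮)`, with the inner product
`((u, g), (v, k)) ↦ (u, v)₀ + (g, k)₀`. -/
abbrev Graph : Type :=
  WithLp 2 (Lp ℝ 2 M.stMeasure × Lp (EuclideanSpace ℝ (Fin d)) 2 M.stMeasure)

/-- The pair `u` is `(φ, ∇_Γ φ)`. -/
def Represents (u : M.Graph) (φ : EuclideanSpace ℝ (Fin d) × ℝ → ℝ) : Prop :=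
  u.fst =ᵐ[M.stMeasure] φ ∧ u.snd =ᵐ[M.stMeasure] M.tangGrad φ

/-- The Hilbert space `H` of all `v ∈ L²(𝒮)` with (generalized) tangential gradient in `L²(𝒮)`,
as the closure of `C¹₀(𝒮)` in the norm `‖v‖_H² = ‖v‖₀² + ‖∇_Γ v‖₀²`. Its elements are the pairs
`u = (v, ∇_Γ v)`, so that `u.fst` is the function and `u.snd` its tangential gradient, and the
norm of `u` is `‖v‖_H`. -/
def H : Submodule ℝ M.Graph :=
  (Submodule.span ℝ {u | ∃ φ, M.IsTest 0 M.T φ ∧ M.Represents u φ}).topologicalClosure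

/-- The subspace of those `v ∈ H` that vanish (together with `∇_Γ v`) outside the time slab
`a < t ≤ b`. -/
def Hslab (a b : ℝ) : Submodule ℝ M.Graph where
  carrier := {u | u ∈ M.H ∧ ∀ᵐ p ∂M.stMeasure, p.2 ∉ Ioc a b → u.fst p = 0 ∧ u.snd p = 0}
  zero_mem' := by
    refine ⟨M.H.zero_mem, ?_⟩
    filter_upwards [Lp.coeFn_zero ℝ 2 M.stMeasure,
      Lp.coeFn_zero (EuclideanSpace ℝ (Fin d)) 2 M.stMeasure] with p h1 h2 _
    exact ⟨by simpa using h1, by simpa using h2⟩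
  add_mem' := by
    rintro u v ⟨hu, hu'⟩ ⟨hv, hv'⟩
    refine ⟨M.H.add_mem hu hv, ?_⟩
    filter_upwards [hu', hv', Lp.coeFn_add u.fst v.fst, Lp.coeFn_add u.snd v.snd]
      with p h1 h2 h3 h4 hp
    refine ⟨?_, ?_⟩
    · rw [WithLp.add_fst, h3, Pi.add_apply, (h1 hp).1, (h2 hp).1, add_zero]
    · rw [WithLp.add_snd, h4, Pi.add_apply, (h1 hp).2, (h2 hp).2, add_zero]
  smul_mem' := by
    rintro c u ⟨hu, hu'⟩
    refine ⟨M.H.smul_mem c hu, ?_⟩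
    filter_upwards [hu', Lp.coeFn_smul c u.fst, Lp.coeFn_smul c u.snd] with p h1 h3 h4 hp
    refine ⟨?_, ?_⟩
    · rw [WithLp.smul_fst, h3, Pi.smul_apply, (h1 hp).1, smul_zero]
    · rw [WithLp.smul_snd, h4, Pi.smul_apply, (h1 hp).2, smul_zero]

/-- The bounded functional `ℓ` on `Hslab a b` extends the distributional material derivative of
`v` on the slab, `⟨v̇, φ⟩ = -∫_0^T ∫_{Γ(t)} v (φ̇ + φ div_Γ w) ds dt` for
`φ ∈ C¹₀(𝒮 ∩ {a < t < b})`. -/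
def IsMatDeriv {a b : ℝ} (v : M.Hslab a b) (ℓ : StrongDual ℝ (M.Hslab a b)) : Prop :=
  ∀ (φ : EuclideanSpace ℝ (Fin d) × ℝ → ℝ) (z : M.Hslab a b),
    M.IsTest a b φ → M.Represents z φ →
      ℓ z = -∫ p, (v : M.Graph).fst p * (M.matDeriv φ p + φ p * M.divw p) ∂M.stMeasure

/-- The space `W` of the slab: those `v ∈ Hslab a b` with `v̇ ∈ (Hslab a b)'`. -/
def Wslab (a b : ℝ) : Type :=
  {v : M.Hslab a b // ∃ ℓ : StrongDual ℝ (M.Hslab a b), M.IsMatDeriv v ℓ}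

/-- The material derivative `v̇ ∈ (Hslab a b)'`. -/
def Wslab.dot {M : EvolvingSurface d} {a b : ℝ} (v : M.Wslab a b) : StrongDual ℝ (M.Hslab a b) :=
  v.2.choose

/-- The time nodes `t_k = k T / N`. -/
def node (N k : ℕ) : ℝ := k * M.T / N

/-- The broken space `W^b`, the direct sum of the spaces `W` of the slabs `(t_k, t_{k+1}]`,
`k = 0, …, N-1`. -/
def BrokenSpace (N : ℕ) : Type := ∀ k : Fin N, M.Wslab (M.node N k) (M.node N (k + 1))

variable {M} {N : ℕ}

/-- The element of `H` with which an element of `W^b` is identified. -/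
def BrokenSpace.toH (v : M.BrokenSpace N) : M.Graph := ∑ k, ((v k).1 : M.Graph)

/-- `‖v‖_{W^b}`. -/
def BrokenSpace.wNorm (v : M.BrokenSpace N) : ℝ :=
  √(∑ k, (‖(v k).1‖ ^ 2 + ‖(v k).dot‖ ^ 2))

/-! ### One-sided traces and jumps -/

variable (M)

/-- `g ∈ L²(Γ(s))` is the limit of `u(·, t)` as `t → s` along `l`, where functions on `Γ(t)` and
on `Γ(s)` are compared along the trajectories of the flow (through `Γ₀`), in the `L²` norm.
As `u` is an `L²` class, null sets of times are disregarded (essential limit). -/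
def IsTrace (u : M.Graph) (s : ℝ) (l : Filter ℝ) (g : Lp ℝ 2 (M.surfaceMeasure s)) : Prop :=
  Tendsto (fun t => ∫⁻ y, ‖u.fst (M.Φ t y, t) - g (M.Φ s y)‖ₑ ^ 2 ∂μHE[d - 1].restrict M.Γ₀)
    (l ⊓ ae volume) (𝓝 0)

open scoped Classical in
/-- The limit in `L²(Γ(s))` of `u(·, t)` as `t → s` along `l` (zero if there is none). -/
def trace (u : M.Graph) (s : ℝ) (l : Filter ℝ) : Lp ℝ 2 (M.surfaceMeasure s) :=
  if h : ∃ g, M.IsTrace u s l g then h.choose else 0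

variable {M}

/-- `v_-^k = v_-(·, t_k)`. -/
def BrokenSpace.traceMinus (v : M.BrokenSpace N) (k : ℕ) : Lp ℝ 2 (M.surfaceMeasure (M.node N k)) :=
  M.trace v.toH (M.node N k) (𝓝[<] (M.node N k))

/-- `v_+^k = v_+(·, t_k)`. -/
def BrokenSpace.tracePlus (v : M.BrokenSpace N) (k : ℕ) : Lp ℝ 2 (M.surfaceMeasure (M.node N k)) :=
  M.trace v.toH (M.node N k) (𝓝[>] (M.node N k))

/-- The jumps `[v]^0 = v_+^0` and `[v]^k = v_+^k - v_-^k`, `k = 1, …, N-1`. -/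
def BrokenSpace.jump (v : M.BrokenSpace N) (k : ℕ) : Lp ℝ 2 (M.surfaceMeasure (M.node N k)) :=
  if k = 0 then v.tracePlus k else v.tracePlus k - v.traceMinus k

/-- The mesh-dependent norm
`|||v|||_h² = max_{1≤n≤N} ‖v_-^n‖² + ∑_{n=1}^N ‖[v]^{n-1}‖² + ‖v‖_H²`. -/
def BrokenSpace.hNorm (v : M.BrokenSpace N) : ℝ :=
  √((⨆ k : Fin N, ‖v.traceMinus (k + 1)‖ ^ 2) + ∑ k ∈ Finset.range N, ‖v.jump k‖ ^ 2
    + ‖v.toH‖ ^ 2)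

/-! ### Bilinear forms -/

/-- `∫_{Γ(t)} u ds`. -/
def surfInt (u : M.Graph) (t : ℝ) : ℝ := ∫ x, u.fst (x, t) ∂M.surfaceMeasure t

/-- `a(u,v) = ν (∇_Γ u, ∇_Γ v)₀ + (div_Γ w u, v)₀`. -/
def aForm (ν : ℝ) (u v : M.Graph) : ℝ :=
  ν * inner ℝ u.snd v.snd + ∫ p, M.divw p * u.fst p * v.fst p ∂M.stMeasure

/-- `a_σ(u,v) = a(u,v) + σ ∫_0^T ū(t) v̄(t) dt`, with `ū(t) = ∫_{Γ(t)} u ds`. -/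
def aStab (ν σ : ℝ) (u v : M.Graph) : ℝ :=
  aForm ν u v + σ * ∫ t in Ioo 0 M.T, surfInt u t * surfInt v t

/-- `d(u,v) = ∑_{n=1}^N ([u]^{n-1}, v_+^{n-1})_{t_{n-1}}`. -/
def BrokenSpace.dForm (u v : M.BrokenSpace N) : ℝ :=
  ∑ k ∈ Finset.range N, inner ℝ (u.jump k) (v.tracePlus k)

/-- `⟨u̇, v⟩_b = ∑_{n=1}^N ⟨u̇_n, v_n⟩`. -/
def BrokenSpace.dotForm (u v : M.BrokenSpace N) : ℝ := ∑ k, (u k).dot (v k).1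

/-- The stabilized bilinear form `⟨u̇, v⟩_b + a_σ(u,v) + d(u,v)`. -/
def BrokenSpace.form (ν σ : ℝ) (u v : M.BrokenSpace N) : ℝ :=
  u.dotForm v + aStab ν σ u.toH v.toH + u.dForm v

end EvolvingSurface

end

/-! The first estimate is duality and Cauchy–Schwarz. The derivative term is bounded by the dual
norms of the pieces of `e`, the form `a_σ` is bounded on the graph space (`exists_abs_aStab_le`),
and each `v_+` in `d(e,v)` is a jump plus a left trace, so its norm is at most `2 |||v|||_h`. The
slabs are mutually orthogonal in `H` (`norm_sq_toH`), which lets the slab contributions be summed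
with a constant independent of `N`.

For the second estimate the derivative is moved from `e` to `v` on each slab. Up to an error bounded
by a multiple of `‖e‖_H ‖v‖_H`, the sum of `⟨ė,v⟩` and `⟨v̇,e⟩` is the difference of the `L²` inner
products of the traces at the two ends (`Wslab.abs_dot_add_dot_sub_le`). Summation by parts
(`sum_sub_add_sum_eq_sub_sum`) combines these node terms with `d(e,v)` into `(e_-^N, v_-^N) - ∑
(e_-^n, [v]^n)`, which contains only left traces of `e`, and these are controlled by `|||e|||_h`.

The real work is to show that the traces exist and that the integration by parts holds for them.
Everything is pulled back along the flow to `Γ₀`. A function becomes a path `u(t)` in a fixed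
Hilbert space `InitH` of pairs (function, tangential gradient) with a bounded map `P = initFst` to
`L²(Γ₀)`, and the inner product of `L²(Γ(t))` becomes `⟨J(t)·,·⟩` with `J = mass`. The flow distorts
distances by at most `exp(rate·|s-t|)`, so Hausdorff measures change by at most a power of that
factor, and `J` is bounded, coercive and Lipschitz in `t` (`isMassFamily_mass`). Neither a Jacobian
formula nor differentiability of `J` is needed: the variation of `J` enters only as a bounded error,
and so does the divergence term.

Testing the definition of the material derivative with products `η(t) ζ(y)` shows that `P† J P u`
has an `L²` derivative in time (`IsMatDeriv.exists_isEnergyPath`). For two such paths the difference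
quotients of `⟨J P u, P v⟩` give an energy balance between almost all times
(`exists_energy_balance`). With `v = u` it bounds the oscillation of the energy, from which `P u` is
Cauchy at the end points (`IsEnergyPath.exists_tendsto`); the balance then extends to the end points
by a limit (`energy_balance`). -/

theorem IsCompact.exists_Icc_of_subset_Ioo {K : Set ℝ} (hK : IsCompact K) {a b : ℝ}
    (hab : a < b) (h : K ⊆ Ioo a b) : ∃ c d, a < c ∧ c < d ∧ d < b ∧ K ⊆ Icc c d := by
  rcases K.eq_empty_or_nonempty with rfl | hne
  · exact ⟨a + (b - a) / 3, b - (b - a) / 3, by linarith, by linarith, by linarith, by simp⟩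
  · have h1 := h (hK.sInf_mem hne)
    have h2 := h (hK.sSup_mem hne)
    refine ⟨(a + sInf K) / 2, (b + sSup K) / 2, by linarith [h1.1], ?_, by linarith [h2.2], ?_⟩
    · have := (csInf_le hK.bddBelow (hK.sInf_mem hne)).trans (le_csSup hK.bddAbove (hK.sInf_mem hne))
      linarith [h1.1, h2.2]
    · intro x hx
      have h3 := csInf_le hK.bddBelow hx
      have h4 := le_csSup hK.bddAbove hx
      constructor <;> linarith [h1.1, h2.2]

/-! ### Weak derivatives of vector-valued functions of time -/

section WeakDeriv

variable {V : Type*} [NormedAddCommGroup V] [NormedSpace ℝ V] [CompleteSpace V]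

/-- Integration by parts of an indefinite Lebesgue integral against a test function. -/
theorem integral_deriv_smul_primitive {a b : ℝ} {f : ℝ → V}
    (hf : IntegrableOn f (Ioo a b)) {η : ℝ → ℝ} (hη : ContDiff ℝ ∞ η)
    (hc : HasCompactSupport η) (hs : tsupport η ⊆ Ioo a b) :
    ∫ t in Ioo a b, (deriv η t • ∫ s in a..t, f s) = -∫ t in Ioo a b, η t • f t := by
  have hd : Continuous (deriv η) := hη.continuous_deriv (by simp)
  have hdc : HasCompactSupport (deriv η) := hc.deriv
  set ρ := volume.restrict (Ioo a b) with hρ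
  have hb : η b = 0 := by
    by_contra h
    exact lt_irrefl _ (hs (subset_tsupport _ h)).2
  have h1 : ∫ t, (deriv η t • ∫ s in a..t, f s) ∂ρ =
      ∫ t, ∫ s, (Iic t).indicator (fun s => deriv η t • f s) s ∂ρ ∂ρ := by
    apply setIntegral_congr_fun measurableSet_Ioo
    intro t ht
    simp only
    rw [integral_indicator measurableSet_Iic, integral_smul, hρ,
      Measure.restrict_restrict measurableSet_Iic, intervalIntegral.integral_of_le ht.1.le]
    congr 3
    ext x
    simp only [mem_Ioc, mem_inter_iff, mem_Iic, mem_Ioo]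
    constructor
    · rintro ⟨h1, h2⟩; exact ⟨h2, h1, h2.trans_lt ht.2⟩
    · rintro ⟨h1, h2, _⟩; exact ⟨h2, h1⟩
  -- Fubini over the triangle `s ≤ t`; exchanging the order leaves the integral of `η'` from `s` to
  -- `b`, which is `-η(s)` because `η(b) = 0`.
  have hint : Integrable (Function.uncurry fun t s =>
      (Iic t).indicator (fun s => deriv η t • f s) s) (ρ.prod ρ) := by
    have h2 : Integrable (fun z : ℝ × ℝ => deriv η z.1 • f z.2) (ρ.prod ρ) :=
      Integrable.smul_prod (hd.integrable_of_hasCompactSupport hdc).integrableOn hf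
    have h3 : MeasurableSet {z : ℝ × ℝ | z.2 ≤ z.1} :=
      measurableSet_le measurable_snd measurable_fst
    refine (h2.indicator h3).congr (Eventually.of_forall ?_)
    rintro ⟨t, s⟩
    simp [indicator, Function.uncurry]
  rw [h1, integral_integral_swap hint, ← integral_neg]
  apply setIntegral_congr_fun measurableSet_Ioo
  intro s hs'
  simp only
  have h4 : ∀ t, (Iic t).indicator (fun s => deriv η t • f s) s =
      ((Ici s).indicator (deriv η) t) • f s := by
    intro t
    by_cases h : s ≤ t <;> simp [indicator, h]
  simp_rw [h4]
  rw [integral_smul_const, integral_indicator measurableSet_Ici, hρ,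
    Measure.restrict_restrict measurableSet_Ici]
  have h5 : Ici s ∩ Ioo a b = Ico s b := by
    ext x
    simp only [mem_inter_iff, mem_Ici, mem_Ioo, mem_Ico]
    constructor
    · rintro ⟨h1, h2, h3⟩; exact ⟨h1, h3⟩
    · rintro ⟨h1, h2⟩; exact ⟨h1, hs'.1.trans_le h1, h2⟩
  rw [h5, ← integral_Icc_eq_integral_Ico, integral_Icc_eq_integral_Ioc,
    ← intervalIntegral.integral_of_le hs'.2.le,
    intervalIntegral.integral_deriv_eq_sub' η rfl
      (fun x _ => (hη.differentiable (by simp)) x) hd.continuousOn, hb, zero_sub, neg_smul]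

/-- The lemma of du Bois-Reymond. -/
theorem exists_ae_eq_const_of_integral_deriv_smul_eq_zero {a b : ℝ} (hab : a < b) {k : ℝ → V}
    (hk : IntegrableOn k (Ioo a b))
    (h : ∀ η : ℝ → ℝ, ContDiff ℝ ∞ η → HasCompactSupport η → tsupport η ⊆ Ioo a b →
      ∫ t in Ioo a b, deriv η t • k t = 0) :
    ∃ c : V, ∀ᵐ t, t ∈ Ioo a b → k t = c := by
  -- A normalized bump inside `(a,b)`; the constant will be the average of `k` with this weight.
  let β : ContDiffBump ((a + b) / 2) := ⟨(b - a) / 8, (b - a) / 4, by linarith, by linarith⟩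
  set χ : ℝ → ℝ := β.normed volume with hχ
  have hχs : tsupport χ ⊆ Ioo a b := by
    rw [hχ, β.tsupport_normed_eq]
    intro x hx
    rw [Metric.mem_closedBall, Real.dist_eq, abs_le] at hx
    simp only [β] at hx
    constructor <;> linarith [hx.1, hx.2]
  have hχd : ContDiff ℝ ∞ χ := β.contDiff_normed
  have hχc : HasCompactSupport χ := β.hasCompactSupport_normed
  have hχ1 : ∫ t, χ t = 1 := β.integral_normed
  refine ⟨∫ t in Ioo a b, χ t • k t, ?_⟩
  set k₀ := ∫ t in Ioo a b, χ t • k t with hk₀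
  have hmul : ∀ {η : ℝ → ℝ}, ContDiff ℝ ∞ η → HasCompactSupport η →
      Integrable (fun t => η t • k t) (volume.restrict (Ioo a b)) := by
    intro η h1 h2
    obtain ⟨C, hC⟩ := h2.exists_bound_of_continuous h1.continuous
    exact hk.bdd_smul C h1.continuous.aestronglyMeasurable (Eventually.of_forall hC)
  have key : ∀ᵐ t, t ∈ Ioo a b → k t - k₀ = 0 := by
    have hloc : LocallyIntegrableOn (fun t => k t - k₀) (Ioo a b) volume :=
      IntegrableOn.locallyIntegrableOn (hk.sub (integrableOn_const (by simp)))
    refine isOpen_Ioo.ae_eq_zero_of_integral_contDiff_smul_eq_zero hloc ?_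
    intro η hη hηc hηs
    set m := ∫ t, η t with hm
    -- Subtracting `m χ` makes the mean of `θ` zero, so that its primitive `Θ` has compact support
    -- in `(a,b)` and the hypothesis applies to `Θ`.
    set θ : ℝ → ℝ := fun t => η t - m * χ t with hθ
    have hθd : ContDiff ℝ ∞ θ := hη.sub (contDiff_const.mul hχd)
    obtain ⟨c, d, hac, hcd, hdb, hK⟩ :=
      (hηc.isCompact.union hχc.isCompact).exists_Icc_of_subset_Ioo hab
        (union_subset hηs hχs)
    have hθ0 : ∀ t, t ∉ Icc c d → θ t = 0 := by
      intro t ht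
      have h1 : t ∉ tsupport η := fun h => ht (hK (Or.inl h))
      have h2 : t ∉ tsupport χ := fun h => ht (hK (Or.inr h))
      simp [hθ, image_eq_zero_of_notMem_tsupport h1, image_eq_zero_of_notMem_tsupport h2]
    have hθi : ∫ t, θ t = 0 := by
      rw [hθ, integral_sub (hη.continuous.integrable_of_hasCompactSupport hηc)
        ((hχd.continuous.integrable_of_hasCompactSupport hχc).const_mul m),
        integral_const_mul, hχ1, mul_one, sub_self]
    set Θ : ℝ → ℝ := fun t => ∫ s in a..t, θ s with hΘ
    have hder : ∀ t, HasDerivAt Θ (θ t) t := fun t =>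
      intervalIntegral.integral_hasDerivAt_right (hθd.continuous.intervalIntegrable _ _)
        (hθd.continuous.stronglyMeasurableAtFilter _ _) hθd.continuous.continuousAt
    have hderiv : deriv Θ = θ := funext fun t => (hder t).deriv
    have hΘd : ContDiff ℝ ∞ Θ := by
      rw [contDiff_infty_iff_deriv, hderiv]
      exact ⟨fun t => (hder t).differentiableAt, hθd⟩
    have hΘ0 : ∀ t, t ∉ Icc c d → Θ t = 0 := by
      intro t ht
      by_cases htc : t < c
      · apply intervalIntegral.integral_zero_ae
        refine Eventually.of_forall fun s hs => hθ0 s fun hs' => ?_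
        rcases mem_uIoc.1 hs with h | h
        · linarith [h.2, hs'.1]
        · linarith [h.2, hs'.1]
      · have htd : d < t := by
          by_contra hh
          exact ht ⟨not_lt.1 htc, not_lt.1 hh⟩
        have : (∫ s in a..t, θ s) = ∫ s, θ s := by
          rw [intervalIntegral.integral_of_le (by linarith)]
          apply setIntegral_eq_integral_of_forall_compl_eq_zero
          intro x hx
          apply hθ0
          intro hx'
          exact hx ⟨by linarith [hx'.1], by linarith [hx'.2]⟩
        simp only [hΘ, this, hθi]
    have hΘs : tsupport Θ ⊆ Icc c d := by
      apply closure_minimal _ isClosed_Icc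
      intro x hx
      by_contra hh
      exact hx (hΘ0 x hh)
    have h1 := h Θ hΘd (HasCompactSupport.of_support_subset_isCompact isCompact_Icc
      ((subset_tsupport _).trans hΘs)) (hΘs.trans fun x hx =>
        ⟨by linarith [hx.1], by linarith [hx.2]⟩)
    rw [hderiv] at h1
    have h2 : ∫ t in Ioo a b, η t • k t = m • k₀ := by
      have : ∫ t in Ioo a b, θ t • k t = (∫ t in Ioo a b, η t • k t) - m • k₀ := by
        rw [hk₀, ← integral_smul]
        refine Eq.trans ?_ (integral_sub (hmul hη hηc) ((hmul hχd hχc).smul m))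
        congr 1
        ext t
        simp [hθ, sub_smul, mul_smul]
      rw [← sub_eq_zero, ← this, h1]
    have h3 : ∀ (η' : ℝ → V), (∀ t, t ∉ Ioo a b → η' t = 0) →
        ∫ t, η' t = ∫ t in Ioo a b, η' t := fun η' h' =>
      (setIntegral_eq_integral_of_forall_compl_eq_zero h').symm
    have hη0 : ∀ t, t ∉ Ioo a b → η t = 0 := fun t ht =>
      image_eq_zero_of_notMem_tsupport fun h => ht (hηs h)
    rw [h3 _ (fun t ht => by simp [hη0 t ht])]
    simp_rw [smul_sub]
    rw [integral_sub (hmul hη hηc), h2, integral_smul_const,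
      setIntegral_eq_integral_of_forall_compl_eq_zero hη0, sub_self]
    exact ((hη.continuous.integrable_of_hasCompactSupport hηc).integrableOn).smul_const k₀
  filter_upwards [key] with t ht hm
  exact sub_eq_zero.1 (ht hm)

/-- The difference of `y` and the primitive of `f` has weak derivative zero, so the du Bois-Reymond
lemma makes it constant. -/
theorem exists_ae_eq_const_add_integral {a b : ℝ} (hab : a < b) {y f : ℝ → V}
    (hy : IntegrableOn y (Ioo a b)) (hf : IntegrableOn f (Ioo a b))
    (h : ∀ η : ℝ → ℝ, ContDiff ℝ ∞ η → HasCompactSupport η → tsupport η ⊆ Ioo a b →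
      ∫ t in Ioo a b, deriv η t • y t = -∫ t in Ioo a b, η t • f t) :
    ∃ c : V, ∀ᵐ t, t ∈ Ioo a b → y t = c + ∫ s in a..t, f s := by
  have hF : ContinuousOn (fun t => ∫ s in a..t, f s) (Icc a b) := by
    rw [← uIcc_of_le hab.le]
    apply intervalIntegral.continuousOn_primitive_interval'
    · rwa [intervalIntegrable_iff_integrableOn_Ioo_of_le hab.le]
    · simp [hab.le]
  have hFi : IntegrableOn (fun t => ∫ s in a..t, f s) (Ioo a b) :=
    (hF.integrableOn_compact isCompact_Icc).mono_set Ioo_subset_Icc_self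
  obtain ⟨c, hc⟩ := exists_ae_eq_const_of_integral_deriv_smul_eq_zero hab (hy.sub hFi) (by
    intro η hη hηc hηs
    have hd : Continuous (deriv η) := hη.continuous_deriv (by simp)
    obtain ⟨C, hC⟩ := hηc.deriv.exists_bound_of_continuous hd
    have hm : ∀ {g : ℝ → V}, IntegrableOn g (Ioo a b) →
        Integrable (fun t => deriv η t • g t) (volume.restrict (Ioo a b)) := fun hg =>
      hg.bdd_smul C hd.aestronglyMeasurable (Eventually.of_forall hC)
    simp only [Pi.sub_apply, smul_sub]
    rw [integral_sub (hm hy) (hm hFi), h η hη hηc hηs,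
      integral_deriv_smul_primitive hf hη hηc hηs, sub_self])
  refine ⟨c, ?_⟩
  filter_upwards [hc] with t ht hm
  rw [← ht hm]
  simp

end WeakDeriv

/-! ### Translations in `L²` of the line -/

section Translation

variable {V : Type*} [NormedAddCommGroup V] [InnerProductSpace ℝ V]

/-- Translation acts continuously on `L²`, and restriction to `S` is a bounded operator, so the
integral is a continuous inner product. This provides the limits `h → 0` in the difference quotients
of the energy. -/
theorem continuous_setIntegral_inner_translate {f g : ℝ → V} (hf : MemLp f 2) (hg : MemLp g 2)
    (S : Set ℝ) :
    Continuous fun p : ℝ × ℝ => ∫ t in S, inner ℝ (f (t + p.1)) (g (t + p.2)) := by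
  let sh : ℝ → C(ℝ, ℝ) := fun r => ⟨fun t => t + r, by fun_prop⟩
  have hsh : Continuous sh := by
    let G : C(ℝ × ℝ, ℝ) := ⟨fun p => p.2 + p.1, by fun_prop⟩
    exact G.curry.continuous
  have hmp : ∀ r, MeasurePreserving (sh r) volume volume := fun r =>
    measurePreserving_add_right volume r
  let τ : ∀ (_ : Lp V 2 (volume : Measure ℝ)) (_ : ℝ), Lp V 2 (volume : Measure ℝ) :=
    fun F r => Lp.compMeasurePreserving (sh r) (hmp r) F
  have hτ : ∀ F, Continuous (τ F) := fun F =>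
    Continuous.compMeasurePreservingLp continuous_const hsh hmp (by simp)
  let R := LpToLpRestrictCLM ℝ V ℝ volume 2 S
  have hcont : Continuous fun p : ℝ × ℝ =>
      inner ℝ (R (τ (hf.toLp f) p.1)) (R (τ (hg.toLp g) p.2)) :=
    Continuous.inner (R.continuous.comp ((hτ _).comp continuous_fst))
      (R.continuous.comp ((hτ _).comp continuous_snd))
  have hτe : ∀ {f : ℝ → V} (hf : MemLp f 2) (r : ℝ),
      R (τ (hf.toLp f) r) =ᵐ[volume.restrict S] fun t => f (t + r) := by
    intro f hf r
    refine (LpToLpRestrictCLM_coeFn ℝ S _).trans ?_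
    apply ae_restrict_of_ae
    refine (Lp.coeFn_compMeasurePreserving _ (hmp r)).trans ?_
    exact (hmp r).quasiMeasurePreserving.ae_eq_comp hf.coeFn_toLp
  have heq : ∀ p : ℝ × ℝ, inner ℝ (R (τ (hf.toLp f) p.1)) (R (τ (hg.toLp g) p.2)) =
      ∫ t in S, inner ℝ (f (t + p.1)) (g (t + p.2)) := by
    intro p
    rw [L2.inner_def]
    apply integral_congr_ae
    filter_upwards [hτe hf p.1, hτe hg p.2] with t h1 h2
    rw [h1, h2]
  simpa only [heq] using hcont

end Translation

theorem MeasureTheory.MemLp.integrable_inner_of_two {α V : Type*} {m : MeasurableSpace α}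
    {μ : Measure α} [NormedAddCommGroup V] [InnerProductSpace ℝ V] {f g : α → V}
    (hf : MemLp f 2 μ) (hg : MemLp g 2 μ) : Integrable (fun t => inner ℝ (f t) (g t)) μ := by
  refine (hf.norm.integrable_mul hg.norm).mono' (hf.1.inner hg.1) (Eventually.of_forall fun t => ?_)
  exact norm_inner_le_norm (f t) (g t)

theorem MeasureTheory.MemLp.intervalIntegrable_of_two {V : Type*} [NormedAddCommGroup V]
    {f : ℝ → V} (hf : MemLp f 2) (p q : ℝ) : IntervalIntegrable f volume p q :=
  ⟨(hf.restrict _).integrable (by norm_num), (hf.restrict _).integrable (by norm_num)⟩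

/-- Justifies the later exchanges of the integrals in `t` and `r`. The restriction of `t` to `(c,d]`
is dropped first, since the shear by `r` preserves the product measure only when `t` runs over the
whole line; `r` stays in an interval of finite measure, so functions of `t` alone remain square
integrable. -/
theorem integrable_inner_translate {V : Type*} [NormedAddCommGroup V] [InnerProductSpace ℝ V]
    {f g : ℝ → V} (hf : MemLp f 2) (hg : MemLp g 2) (c d h : ℝ) :
    Integrable (fun z : ℝ × ℝ => inner ℝ (f (z.1 + z.2)) (g (z.1 + h)))
      ((volume.restrict (Ioc c d)).prod (volume.restrict (Ioc 0 h))) := by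
  have hle : (volume.restrict (Ioc c d)).prod (volume.restrict (Ioc 0 h)) ≤
      (volume : Measure ℝ).prod (volume.restrict (Ioc 0 h)) := by
    rw [← Measure.restrict_univ (μ := volume.restrict (Ioc 0 h)), Measure.prod_restrict]
    simpa using Measure.restrict_le_self
  have hfm : MemLp (fun z : ℝ × ℝ => f (z.1 + z.2)) 2
      ((volume : Measure ℝ).prod (volume.restrict (Ioc 0 h))) :=
    (hf.comp_fst _).comp_measurePreserving
      (measurePreserving_add_prod volume (volume.restrict (Ioc 0 h)))
  have hgm : MemLp (fun z : ℝ × ℝ => g (z.1 + h)) 2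
      ((volume : Measure ℝ).prod (volume.restrict (Ioc 0 h))) :=
    (hg.comp_measurePreserving (measurePreserving_add_right volume h)).comp_fst _
  exact (hfm.integrable_inner_of_two hgm).mono_measure hle

/-- Averages over shrinking intervals of a continuous function of two variables. -/
theorem tendsto_inv_mul_intervalIntegral {Q : ℝ × ℝ → ℝ} (hQ : Continuous Q) :
    Tendsto (fun h => h⁻¹ * ∫ r in (0 : ℝ)..h, Q (r, h)) (𝓝[>] 0) (𝓝 (Q 0)) := by
  -- The substitution `r = h s` turns the average into an integral over the fixed interval `[0,1]`,
  -- continuous in `h`.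
  have h1 : Continuous fun h : ℝ => ∫ s in (0 : ℝ)..1, Q (h * s, h) :=
    intervalIntegral.continuous_parametric_intervalIntegral_of_continuous'
      (f := fun h s => Q (h * s, h)) (by unfold Function.uncurry; fun_prop) 0 1
  have h2 := (h1.tendsto 0).mono_left (nhdsWithin_le_nhds (s := Ioi 0))
  simp only [zero_mul, intervalIntegral.integral_const, sub_zero, one_smul] at h2
  refine h2.congr' ?_
  filter_upwards [self_mem_nhdsWithin] with h hh
  have := intervalIntegral.integral_comp_mul_left (a := 0) (b := 1) (fun r => Q (r, h)) hh.ne'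
  simpa using this

/-! ### The energy balance for time-dependent inner products -/

section Energy

variable {𝓗 V : Type*} [NormedAddCommGroup 𝓗] [InnerProductSpace ℝ 𝓗]
  [NormedAddCommGroup V] [InnerProductSpace ℝ V]

/-- A Lipschitz family of uniformly bounded and coercive symmetric operators. -/
structure IsMassFamily (J : ℝ → 𝓗 →L[ℝ] 𝓗) (c C Λ : ℝ) : Prop where
  pos : 0 < c
  lip_nonneg : 0 ≤ Λ
  lip : ∀ s t, ‖J s - J t‖ ≤ Λ * |s - t|
  bound : ∀ t, ‖J t‖ ≤ C
  symm : ∀ t x y, inner ℝ (J t x) y = inner ℝ x (J t y)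
  coercive : ∀ t x, c * ‖x‖ ^ 2 ≤ inner ℝ (J t x) x

variable {J : ℝ → 𝓗 →L[ℝ] 𝓗} {c C Λ : ℝ}

theorem IsMassFamily.continuous (hJ : IsMassFamily J c C Λ) : Continuous J := by
  have : LipschitzWith ⟨Λ, hJ.lip_nonneg⟩ J := LipschitzWith.of_dist_le_mul fun s t => by
    rw [dist_eq_norm, Real.dist_eq]
    exact hJ.lip s t
  exact this.continuous

theorem IsMassFamily.aestronglyMeasurable (hJ : IsMassFamily J c C Λ) {x : ℝ → 𝓗}
    {μ : Measure ℝ} (hx : AEStronglyMeasurable x μ) :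
    AEStronglyMeasurable (fun t => J t (x t)) μ :=
  (ContinuousLinearMap.id ℝ (𝓗 →L[ℝ] 𝓗)).aestronglyMeasurable_comp₂
    hJ.continuous.aestronglyMeasurable hx

theorem IsMassFamily.memLp (hJ : IsMassFamily J c C Λ) {x : ℝ → 𝓗} {μ : Measure ℝ}
    (hx : MemLp x 2 μ) : MemLp (fun t => J t (x t)) 2 μ :=
  hx.of_le_mul (hJ.aestronglyMeasurable hx.1) (Eventually.of_forall fun t =>
    (J t).le_of_opNorm_le (hJ.bound t) (x t))

theorem MeasureTheory.MemLp.clm_comp {x : ℝ → V} {μ : Measure ℝ} (hx : MemLp x 2 μ)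
    (P : V →L[ℝ] 𝓗) : MemLp (fun t => P (x t)) 2 μ :=
  hx.of_le_mul (P.continuous.comp_aestronglyMeasurable hx.1)
    (Eventually.of_forall fun t => P.le_opNorm (x t))

theorem integrable_inner_mass {P : V →L[ℝ] 𝓗} {u v : ℝ → V} (hJ : IsMassFamily J c C Λ) (hu : MemLp u 2) (hv : MemLp v 2) :
    Integrable fun t => inner ℝ (J t (P (u t))) (P (v t)) :=
  (hJ.memLp (hu.clm_comp P)).integrable_inner_of_two (hv.clm_comp P)

variable [CompleteSpace 𝓗] [CompleteSpace V]

/-- `u` is square integrable, and the derivative of `P† J P u` on `(a, b)` is `f`. -/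
structure IsEnergyPath (P : V →L[ℝ] 𝓗) (J : ℝ → 𝓗 →L[ℝ] 𝓗) (a b : ℝ) (u f : ℝ → V) : Prop where
  memLp : MemLp u 2
  memLp_deriv : MemLp f 2
  exists_primitive : ∃ y₀ : V, ∀ᵐ t, t ∈ Ioo a b →
    ContinuousLinearMap.adjoint P (J t (P (u t))) = y₀ + ∫ s in a..t, f s

variable {P : V →L[ℝ] 𝓗} {a b : ℝ} {u f v k : ℝ → V}

/-- `P† J P u` at two times. -/
theorem IsEnergyPath.exists_increment (hu : IsEnergyPath P J a b u f) :
    ∃ S : Set ℝ, (∀ᵐ t, t ∈ S) ∧ ∀ s ∈ S, ∀ t ∈ S, s ∈ Ioo a b → t ∈ Ioo a b → ∀ z : V,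
      inner ℝ (J t (P (u t))) (P z) - inner ℝ (J s (P (u s))) (P z) =
        inner ℝ (∫ r in s..t, f r) z := by
  obtain ⟨y₀, hy⟩ := hu.exists_primitive
  refine ⟨_, hy, ?_⟩
  intro s hs t ht hsm htm z
  have hf := hu.memLp_deriv.intervalIntegrable_of_two
  rw [← ContinuousLinearMap.adjoint_inner_left, ← ContinuousLinearMap.adjoint_inner_left,
    hs hsm, ht htm, ← inner_sub_left, add_sub_add_left_eq_sub,
    intervalIntegral.integral_interval_sub_left (hf _ _) (hf _ _)]

/-- The difference quotients of the energy `⟨J P u, P v⟩`. -/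
theorem abs_integral_energy_increment_le (hJ : IsMassFamily J c C Λ)
    (hu : IsEnergyPath P J a b u f) (hv : IsEnergyPath P J a b v k) {p q h : ℝ}
    (hap : a < p) (hpq : p < q) (h0 : 0 < h) (hqb : q + h < b) :
    |((∫ t in p..q, inner ℝ (J (t + h) (P (u (t + h)))) (P (v (t + h)))) -
        ∫ t in p..q, inner ℝ (J t (P (u t))) (P (v t))) -
      ((∫ r in (0 : ℝ)..h, ∫ t in Ioc p q, inner ℝ (f (t + r)) (v (t + h))) +
        ∫ r in (0 : ℝ)..h, ∫ t in Ioc p q, inner ℝ (k (t + r)) (u (t + 0)))| ≤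
      Λ * h * ∫ t in Ioc p q, inner ℝ ‖P (u (t + 0))‖ ‖P (v (t + h))‖ := by
  obtain ⟨S, hS, hSi⟩ := hu.exists_increment
  obtain ⟨S', hS', hSi'⟩ := hv.exists_increment
  have hSh : ∀ᵐ t, t + h ∈ S ∩ S' :=
    (measurePreserving_add_right volume h).quasiMeasurePreserving.ae (hS.and hS')
  have hg := integrable_inner_mass (P := P) hJ hu.memLp hv.memLp
  have hgh : Integrable fun t => inner ℝ (J (t + h) (P (u (t + h)))) (P (v (t + h))) :=
    (measurePreserving_add_right volume h).integrable_comp_of_integrable hg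
  have hF1 := integrable_inner_translate hu.memLp_deriv hv.memLp p q h
  -- The shift by `-h` cancels the shift by `h` built into the lemma, so that `u` ends up evaluated
  -- at `t` itself.
  have hF2 := integrable_inner_translate hv.memLp_deriv
    (hu.memLp.comp_measurePreserving (measurePreserving_add_right volume (-h))) p q h
  simp only [Function.comp_def, add_assoc, add_neg_cancel] at hF2
  simp only [intervalIntegral.integral_of_le hpq.le, intervalIntegral.integral_of_le h0.le]
  rw [← integral_integral_swap (f := fun t r => inner ℝ (f (t + r)) (v (t + h))) hF1,
    ← integral_integral_swap (f := fun t r => inner ℝ (k (t + r)) (u (t + 0))) hF2,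
    ← integral_sub hgh.restrict hg.restrict,
    ← integral_add hF1.integral_prod_left hF2.integral_prod_left, ← integral_const_mul]
  have hA : Integrable (fun t => inner ℝ (J (t + h) (P (u (t + h)))) (P (v (t + h))) -
      inner ℝ (J t (P (u t))) (P (v t))) (volume.restrict (Ioc p q)) :=
    hgh.restrict.sub hg.restrict
  have hB : Integrable (fun t => (∫ r in Ioc 0 h, inner ℝ (f (t + r)) (v (t + h))) +
      ∫ r in Ioc 0 h, inner ℝ (k (t + r)) (u (t + 0))) (volume.restrict (Ioc p q)) :=
    hF1.integral_prod_left.add hF2.integral_prod_left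
  rw [← integral_sub hA hB, ← Real.norm_eq_abs]
  have hPi : Integrable (fun t => inner ℝ ‖P (u (t + 0))‖ ‖P (v (t + h))‖)
      (volume.restrict (Ioc p q)) := by
    have h1 : MemLp (fun t => ‖P (u (t + 0))‖) 2 := by
      simpa using (hu.memLp.clm_comp P).norm
    have h2 : MemLp (fun t => ‖P (v (t + h))‖) 2 :=
      ((hv.memLp.clm_comp P).comp_measurePreserving (measurePreserving_add_right volume h)).norm
    exact (h1.integrable_inner_of_two h2).restrict
  refine norm_integral_le_of_norm_le (hPi.const_mul _) ?_
  rw [ae_restrict_iff' measurableSet_Ioc]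
  filter_upwards [hS, hS', hSh] with t h1 h2 h3 ht
  have hta : t ∈ Ioo a b := ⟨hap.trans ht.1, by linarith [ht.2]⟩
  have hth : t + h ∈ Ioo a b := ⟨by linarith [ht.1], by linarith [ht.2]⟩
  have e1 := hSi t h1 (t + h) h3.1 hta hth (v (t + h))
  have e2 := hSi' t h2 (t + h) h3.2 hta hth (u t)
  have hfi : ∀ {f : ℝ → V}, MemLp f 2 → ∀ z : V,
      inner ℝ (∫ r in t..t + h, f r) z = ∫ r in Ioc 0 h, inner ℝ (f (t + r)) z := by
    intro f hf z
    have h4 : (∫ r in t..t + h, f r) = ∫ r in Ioc 0 h, f (t + r) := by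
      rw [← intervalIntegral.integral_of_le h0.le, intervalIntegral.integral_comp_add_left,
        add_zero]
    have h5 : Integrable (fun r => f (t + r)) (volume.restrict (Ioc 0 h)) :=
      ((hf.comp_measurePreserving (measurePreserving_add_left volume t)).restrict _).integrable
        (by norm_num)
    rw [h4, real_inner_comm, ← integral_inner h5]
    simp_rw [real_inner_comm]
  rw [hfi hu.memLp_deriv] at e1
  rw [hfi hv.memLp_deriv] at e2
  simp only [add_zero]
  rw [← e1, ← e2]
  -- The increment is split at `u(t), v(t+h)`. By symmetry of `J` the increment of `P† J P v` may be
  -- tested with `u(t)`, and what remains is the increment of `J` alone, of size `Λ h`. Neither `u`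
  -- nor `v` has to be differentiable itself.
  have e3 : inner ℝ (J (t + h) (P (u (t + h)))) (P (v (t + h))) -
      inner ℝ (J t (P (u t))) (P (v t)) -
      (inner ℝ (J (t + h) (P (u (t + h)))) (P (v (t + h))) -
        inner ℝ (J t (P (u t))) (P (v (t + h))) +
        (inner ℝ (J (t + h) (P (v (t + h)))) (P (u t)) - inner ℝ (J t (P (v t))) (P (u t)))) =
      -inner ℝ ((J (t + h) - J t) (P (v (t + h)))) (P (u t)) := by
    rw [hJ.symm t (P (u t)), hJ.symm t (P (u t)), sub_apply, inner_sub_left,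
      real_inner_comm (J t (P (v (t + h)))) (P (u t)), real_inner_comm (J t (P (v t))) (P (u t))]
    ring
  rw [e3, norm_neg]
  calc ‖inner ℝ ((J (t + h) - J t) (P (v (t + h)))) (P (u t))‖
      ≤ ‖(J (t + h) - J t) (P (v (t + h)))‖ * ‖P (u t)‖ := norm_inner_le_norm _ _
    _ ≤ (Λ * h * ‖P (v (t + h))‖) * ‖P (u t)‖ := by
        gcongr
        refine (J (t + h) - J t).le_of_opNorm_le ?_ _
        simpa [abs_of_pos h0] using hJ.lip (t + h) t
    _ = Λ * h * inner ℝ ‖P (u t)‖ ‖P (v (t + h))‖ := by simp; ring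

/-- The energy balance between two generic times. -/
theorem exists_energy_balance (hJ : IsMassFamily J c C Λ)
    (hu : IsEnergyPath P J a b u f) (hv : IsEnergyPath P J a b v k) :
    ∃ S : Set ℝ, (∀ᵐ t, t ∈ S) ∧ ∀ p ∈ S, ∀ q ∈ S, a < p → p < q → q < b →
      |inner ℝ (J q (P (u q))) (P (v q)) - inner ℝ (J p (P (u p))) (P (v p)) -
        ∫ t in p..q, (inner ℝ (f t) (v t) + inner ℝ (k t) (u t))| ≤
      Λ * ∫ t in p..q, ‖P (u t)‖ * ‖P (v t)‖ := by
  have hg := integrable_inner_mass (P := P) hJ hu.memLp hv.memLp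
  set g : ℝ → ℝ := fun t => inner ℝ (J t (P (u t))) (P (v t)) with hgdef
  -- The generic times are those where the primitive of the energy density `g` has derivative `g`.
  refine ⟨_, LocallyIntegrable.ae_hasDerivAt_integral hg.locallyIntegrable, ?_⟩
  intro p hp q hq hap hpq hqb
  have hp' := (hp 0).tendsto_slope_zero_right
  have hq' := (hq 0).tendsto_slope_zero_right
  have hQ1 := tendsto_inv_mul_intervalIntegral
    (continuous_setIntegral_inner_translate hu.memLp_deriv hv.memLp (Ioc p q))
  have hQ2 := tendsto_inv_mul_intervalIntegral (Q := fun z => ∫ t in Ioc p q,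
    inner ℝ (k (t + z.1)) (u (t + 0)))
    ((continuous_setIntegral_inner_translate hv.memLp_deriv hu.memLp (Ioc p q)).comp
      (continuous_fst.prodMk continuous_const))
  have hQ3 : Tendsto (fun h => Λ * ∫ t in Ioc p q, inner ℝ ‖P (u (t + 0))‖ ‖P (v (t + h))‖)
      (𝓝[>] 0) (𝓝 (Λ * ∫ t in Ioc p q, inner ℝ ‖P (u (t + 0))‖ ‖P (v (t + 0))‖)) := by
    have := ((continuous_setIntegral_inner_translate (hu.memLp.clm_comp P).norm
      (hv.memLp.clm_comp P).norm (Ioc p q)).comp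
      (Continuous.prodMk (continuous_const (y := (0 : ℝ))) continuous_id)).const_mul Λ
    exact (this.tendsto 0).mono_left nhdsWithin_le_nhds
  -- The increment estimate is divided by `h`. The integral of `g` over `[p+h,q+h]` minus that over
  -- `[p,q]` consists of one short integral at each end, so the quotient tends to `g q - g p`.
  have hlim := ((hq'.sub hp').sub (hQ1.add hQ2)).abs
  have hle := le_of_tendsto_of_tendsto hlim hQ3 (by
    have hev : ∀ᶠ h in 𝓝[>] (0 : ℝ), h < b - q :=
      nhdsWithin_le_nhds (Iio_mem_nhds (by linarith))
    filter_upwards [self_mem_nhdsWithin, hev] with h h0 hb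
    have h0 : 0 < h := h0
    have key := abs_integral_energy_increment_le hJ hu hv hap hpq h0 (by linarith : q + h < b)
    have hgi : ∀ x y, IntervalIntegrable g volume x y := fun x y => hg.intervalIntegrable
    have e1 : (∫ t in p..q, inner ℝ (J (t + h) (P (u (t + h)))) (P (v (t + h)))) -
        ∫ t in p..q, inner ℝ (J t (P (u t))) (P (v t)) =
        ((∫ t in (0:ℝ)..(q + h), g t) - ∫ t in (0:ℝ)..q, g t) -
          ((∫ t in (0:ℝ)..(p + h), g t) - ∫ t in (0:ℝ)..p, g t) := by
      rw [intervalIntegral.integral_comp_add_right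
        (fun t => inner ℝ (J t (P (u t))) (P (v t))) h]
      change (∫ t in p + h..q + h, g t) - ∫ t in p..q, g t = _
      rw [← intervalIntegral.integral_interval_sub_left (hgi 0 (q + h)) (hgi 0 (p + h)),
        ← intervalIntegral.integral_interval_sub_left (hgi 0 q) (hgi 0 p)]
      ring
    rw [e1] at key
    have h5 := mul_le_mul_of_nonneg_left key (inv_nonneg.2 h0.le)
    rw [← abs_of_pos (inv_pos.2 h0), ← abs_mul, abs_of_pos (inv_pos.2 h0)] at h5
    calc _ ≤ _ := le_of_eq ?_
      _ ≤ _ := h5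
      _ = _ := ?_
    · congr 1
      simp only [smul_eq_mul]
      ring
    · field_simp)
  simp only [Prod.fst_zero, Prod.snd_zero, add_zero] at hle
  rw [intervalIntegral.integral_of_le hpq.le, intervalIntegral.integral_of_le hpq.le,
    integral_add (hu.memLp_deriv.integrable_inner_of_two hv.memLp).restrict
      (hv.memLp_deriv.integrable_inner_of_two hu.memLp).restrict]
  simpa [hgdef, mul_comm] using hle

end Energy

/-! ### One-sided limits of energy paths -/

section EnergyTrace

variable {𝓗 V : Type*} [NormedAddCommGroup 𝓗] [InnerProductSpace ℝ 𝓗] [CompleteSpace 𝓗]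
  [NormedAddCommGroup V] [InnerProductSpace ℝ V] [CompleteSpace V]
  {P : V →L[ℝ] 𝓗} {J : ℝ → 𝓗 →L[ℝ] 𝓗} {a b c C Λ : ℝ} {u f v k : ℝ → V}

/-- The oscillation of the energy over an interval. -/
theorem IsEnergyPath.exists_energy_oscillation (hJ : IsMassFamily J c C Λ)
    (hu : IsEnergyPath P J a b u f) :
    ∃ S : Set ℝ, (∀ᵐ t, t ∈ S) ∧ ∀ x y, a ≤ x → y ≤ b → ∀ p ∈ S, ∀ q ∈ S,
      p ∈ Ioo x y → q ∈ Ioo x y →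
      |inner ℝ (J q (P (u q))) (P (u q)) - inner ℝ (J p (P (u p))) (P (u p))| ≤
        (1 + Λ * ‖P‖ ^ 2) * ∫ t in Ioo x y, (‖u t‖ ^ 2 + ‖f t‖ ^ 2) := by
  obtain ⟨S, hS, hb⟩ := exists_energy_balance hJ hu hu
  have hΛ := hJ.lip_nonneg
  have hW : Integrable fun t => ‖u t‖ ^ 2 + ‖f t‖ ^ 2 :=
    (hu.memLp.integrable_norm_pow two_ne_zero).add
      (hu.memLp_deriv.integrable_norm_pow two_ne_zero)
  have key : ∀ x y, a ≤ x → y ≤ b → ∀ p ∈ S, ∀ q ∈ S, p ∈ Ioo x y → q ∈ Ioo x y → p < q →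
      |inner ℝ (J q (P (u q))) (P (u q)) - inner ℝ (J p (P (u p))) (P (u p))| ≤
        (1 + Λ * ‖P‖ ^ 2) * ∫ t in Ioo x y, (‖u t‖ ^ 2 + ‖f t‖ ^ 2) := by
    intro x y hx hy p hp q hq hpm hqm hpq
    have h1 := hb p hp q hq (hx.trans_lt hpm.1) hpq (hqm.2.trans_le hy)
    have h2 : |∫ t in p..q, (inner ℝ (f t) (u t) + inner ℝ (f t) (u t))| ≤
        ∫ t in p..q, (‖u t‖ ^ 2 + ‖f t‖ ^ 2) := by
      rw [← Real.norm_eq_abs]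
      refine intervalIntegral.norm_integral_le_of_norm_le hpq.le (Eventually.of_forall ?_)
        hW.intervalIntegrable
      intro t _
      have := abs_real_inner_le_norm (f t) (u t)
      rw [Real.norm_eq_abs, ← two_mul, abs_mul, abs_two]
      nlinarith [sq_nonneg (‖u t‖ - ‖f t‖)]
    have h3 : ∫ t in p..q, ‖P (u t)‖ * ‖P (u t)‖ ≤
        ‖P‖ ^ 2 * ∫ t in p..q, (‖u t‖ ^ 2 + ‖f t‖ ^ 2) := by
      rw [← intervalIntegral.integral_const_mul]
      refine intervalIntegral.integral_mono_on hpq.le ?_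
        (hW.const_mul _).intervalIntegrable ?_
      · have := ((hu.memLp.clm_comp P).integrable_norm_pow two_ne_zero)
        simp only [sq] at this
        exact this.intervalIntegrable
      · intro t _
        calc ‖P (u t)‖ * ‖P (u t)‖ ≤ (‖P‖ * ‖u t‖) * (‖P‖ * ‖u t‖) := by
              gcongr <;> exact P.le_opNorm _
          _ ≤ ‖P‖ ^ 2 * (‖u t‖ ^ 2 + ‖f t‖ ^ 2) := by
              nlinarith [mul_nonneg (sq_nonneg ‖P‖) (sq_nonneg ‖f t‖)]
    have h4 : ∫ t in p..q, (‖u t‖ ^ 2 + ‖f t‖ ^ 2) ≤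
        ∫ t in Ioo x y, (‖u t‖ ^ 2 + ‖f t‖ ^ 2) := by
      rw [intervalIntegral.integral_of_le hpq.le]
      refine setIntegral_mono_set hW.integrableOn (Eventually.of_forall fun t => by positivity)
        (LE.le.eventuallyLE fun t ht => ?_)
      exact ⟨hpm.1.trans ht.1, ht.2.trans_lt hqm.2⟩
    have h5 : 0 ≤ ∫ t in p..q, (‖u t‖ ^ 2 + ‖f t‖ ^ 2) :=
      intervalIntegral.integral_nonneg hpq.le fun t _ => by positivity
    have h6 := abs_sub_abs_le_abs_sub
      (inner ℝ (J q (P (u q))) (P (u q)) - inner ℝ (J p (P (u p))) (P (u p)))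
      (∫ t in p..q, (inner ℝ (f t) (u t) + inner ℝ (f t) (u t)))
    calc |inner ℝ (J q (P (u q))) (P (u q)) - inner ℝ (J p (P (u p))) (P (u p))|
        ≤ (1 + Λ * ‖P‖ ^ 2) * ∫ t in p..q, (‖u t‖ ^ 2 + ‖f t‖ ^ 2) := by
          nlinarith [mul_le_mul_of_nonneg_left h3 hΛ]
      _ ≤ _ := by gcongr
  refine ⟨S, hS, ?_⟩
  intro x y hx hy p hp q hq hpm hqm
  rcases lt_trichotomy p q with h | h | h
  · exact key x y hx hy p hp q hq hpm hqm h
  · subst h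
    simp only [sub_self, abs_zero]
    have : 0 ≤ ∫ t in Ioo x y, (‖u t‖ ^ 2 + ‖f t‖ ^ 2) :=
      integral_nonneg fun t => by positivity
    positivity
  · rw [abs_sub_comm]
    exact key x y hx hy q hq p hp hqm hpm h

/-- Along a filter of shrinking intervals in `(a, b)`, disregarding null sets, `P u` converges. -/
theorem IsEnergyPath.exists_tendsto (hJ : IsMassFamily J c C Λ) (hu : IsEnergyPath P J a b u f)
    (hab : a < b) {F : Filter ℝ} [F.NeBot] (hF : F ≤ ae volume) (l : ℝ → ℝ)
    (hl : ∀ δ, 0 < δ → δ < b - a → a ≤ l δ ∧ l δ + δ ≤ b ∧ Ioo (l δ) (l δ + δ) ∈ F) :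
    ∃ U, Tendsto (fun t => P (u t)) F (𝓝 U) := by
  obtain ⟨S₁, hS₁, hosc⟩ := hu.exists_energy_oscillation hJ
  obtain ⟨S₂, hS₂, hinc⟩ := hu.exists_increment
  have hΛ := hJ.lip_nonneg
  have hc := hJ.pos
  set K := 1 + Λ * ‖P‖ ^ 2 with hK
  have hK0 : 0 ≤ K := by positivity
  set W : ℝ → ℝ := fun t => ‖u t‖ ^ 2 + ‖f t‖ ^ 2 with hWdef
  set g : ℝ → ℝ := fun t => inner ℝ (J t (P (u t))) (P (u t)) with hg
  have hW : Integrable W :=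
    (hu.memLp.integrable_norm_pow two_ne_zero).add
      (hu.memLp_deriv.integrable_norm_pow two_ne_zero)
  have hS : ∀ᵐ t, t ∈ S₁ ∩ S₂ := hS₁.and hS₂
  -- In each interval some generic time has `‖u t‖²` at most its average. At such a time the strong
  -- norm is controlled, although `u` is only square integrable in that norm.
  have hpick : ∀ x y : ℝ, x < y → ∃ t ∈ S₁ ∩ S₂, t ∈ Ioo x y ∧
      (y - x) * ‖u t‖ ^ 2 ≤ ∫ r in Ioo x y, ‖u r‖ ^ 2 := by
    intro x y hxy
    have hu2 : Integrable (fun t => ‖u t‖ ^ 2) (volume.restrict (Ioo x y)) :=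
      (hu.memLp.integrable_norm_pow two_ne_zero).restrict
    have hne : volume.restrict (Ioo x y) ≠ 0 := by
      rw [Ne, Measure.restrict_eq_zero, Real.volume_Ioo]
      simpa using hxy
    have hnull : (volume.restrict (Ioo x y)) {t | ¬ (t ∈ S₁ ∩ S₂ ∧ t ∈ Ioo x y)} = 0 := by
      rw [← ae_iff]
      exact (ae_restrict_of_ae hS).and (ae_restrict_mem measurableSet_Ioo)
    obtain ⟨t, ht, hle⟩ := exists_notMem_null_le_average hne hu2 hnull
    rw [mem_ofPred_eq, not_not] at ht
    refine ⟨t, ht.1, ht.2, ?_⟩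
    rw [setAverage_eq, smul_eq_mul, Measure.real, Real.volume_Ioo,
      ENNReal.toReal_ofReal (by linarith)] at hle
    rwa [inv_mul_eq_div, le_div_iff₀ (by linarith), mul_comm] at hle
  obtain ⟨t₀, ht₀S, ht₀m, -⟩ := hpick a b hab
  -- A uniform bound for `‖P u‖²` at generic times, from the oscillation of the energy and
  -- coercivity.
  set M := (g t₀ + K * ∫ t in Ioo a b, W t) / c with hM
  have hUM : ∀ t ∈ S₁ ∩ S₂, t ∈ Ioo a b → ‖P (u t)‖ ^ 2 ≤ M := by
    intro t ht htm
    have h1 := (abs_le.1 (hosc a b le_rfl le_rfl t₀ ht₀S.1 t ht.1 ht₀m htm)).2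
    have h2 := hJ.coercive t (P (u t))
    rw [hM, le_div_iff₀ hc]
    simp only [hg, hWdef]
    linarith
  -- The three contributions are the oscillation of the energy (`K` times the integral of `W`), the
  -- cross term (once that integral), and the change of `J` over the window (`Λ δ M`). All vanish
  -- with `δ`, the integral by absolute continuity.
  set modulus : ℝ → ℝ := fun δ => (K + 1) * (∫ t in Ioo (l δ) (l δ + δ), W t) + Λ * δ * M with hosc_def
  have hmodulus : Tendsto modulus (𝓝[>] 0) (𝓝 0) := by
    have h1 : Tendsto (fun δ => ∫ t in Ioo (l δ) (l δ + δ), W t) (𝓝[>] 0) (𝓝 0) := by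
      refine hW.tendsto_setIntegral_nhds_zero ?_
      have h2 : Tendsto (fun δ : ℝ => ENNReal.ofReal δ) (𝓝[>] 0) (𝓝 0) := by
        have := (ENNReal.continuous_ofReal.tendsto 0).mono_left (nhdsWithin_le_nhds (s := Ioi 0))
        simpa using this
      refine h2.congr fun δ => ?_
      simp [Real.volume_Ioo]
    have h3 : Tendsto (fun δ : ℝ => δ) (𝓝[>] 0) (𝓝 0) := nhdsWithin_le_nhds
    simpa using (h1.const_mul (K + 1)).add ((h3.const_mul Λ).mul_const M)
  have main : ∀ δ, 0 < δ → δ < b - a → ∃ t', ∀ t ∈ S₁ ∩ S₂, t ∈ Ioo (l δ) (l δ + δ) →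
      c * ‖P (u t) - P (u t')‖ ^ 2 ≤ modulus δ := by
    intro δ h0 hδ
    obtain ⟨hla, hlb, -⟩ := hl δ h0 hδ
    obtain ⟨t', ht'S, ht'm, hsmall⟩ := hpick (l δ) (l δ + δ) (by linarith)
    rw [add_sub_cancel_left] at hsmall
    refine ⟨t', fun t ht htm => ?_⟩
    have hsub : ∀ s ∈ Ioo (l δ) (l δ + δ), s ∈ Ioo a b := fun s hs =>
      ⟨hla.trans_lt hs.1, hs.2.trans_le hlb⟩
    have h1 := (abs_le.1 (hosc _ _ hla hlb t' ht'S.1 t ht.1 ht'm htm)).2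
    have h2 := hinc t' ht'S.2 t ht.2 (hsub t' ht'm) (hsub t htm) (u t')
    have h3 := hJ.coercive t (P (u t) - P (u t'))
    have h4 : |inner ℝ ((J t - J t') (P (u t'))) (P (u t'))| ≤ Λ * δ * M := by
      calc |inner ℝ ((J t - J t') (P (u t'))) (P (u t'))|
          ≤ ‖(J t - J t') (P (u t'))‖ * ‖P (u t')‖ := abs_real_inner_le_norm _ _
        _ ≤ (Λ * |t - t'| * ‖P (u t')‖) * ‖P (u t')‖ := by
            gcongr
            exact (J t - J t').le_of_opNorm_le (hJ.lip t t') _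
        _ = Λ * |t - t'| * ‖P (u t')‖ ^ 2 := by ring
        _ ≤ Λ * δ * M := by
            gcongr
            · rw [abs_le]
              constructor <;> linarith [htm.1, htm.2, ht'm.1, ht'm.2]
            · exact hUM t' ht'S (hsub t' ht'm)
    -- The cross term contains `u t'` in the strong norm. The choice of `t'` gives `δ ‖u t'‖²` at
    -- most the integral of `‖u‖²` over the window, just what Young's inequality under the integral
    -- needs.
    have h5 : 2 * |inner ℝ (∫ r in t'..t, f r) (u t')| ≤ ∫ r in Ioo (l δ) (l δ + δ), W r := by
      have hfi : Integrable (fun r => ‖f r‖) (volume.restrict (Ioo (l δ) (l δ + δ))) :=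
        ((hu.memLp_deriv.restrict _).integrable (by norm_num)).norm
      have h6 : ‖∫ r in t'..t, f r‖ ≤ ∫ r in Ioo (l δ) (l δ + δ), ‖f r‖ := by
        refine (intervalIntegral.norm_integral_le_integral_norm_uIoc).trans ?_
        refine setIntegral_mono_set hfi (Eventually.of_forall fun t => norm_nonneg _)
          (LE.le.eventuallyLE fun r hr => ?_)
        rcases mem_uIoc.1 hr with h | h
        · exact ⟨ht'm.1.trans h.1, h.2.trans_lt htm.2⟩
        · exact ⟨htm.1.trans h.1, h.2.trans_lt ht'm.2⟩
      calc 2 * |inner ℝ (∫ r in t'..t, f r) (u t')|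
          ≤ 2 * ((∫ r in Ioo (l δ) (l δ + δ), ‖f r‖) * ‖u t'‖) := by
            gcongr
            exact (abs_real_inner_le_norm _ _).trans (by gcongr)
        _ = ∫ r in Ioo (l δ) (l δ + δ), ‖f r‖ * (2 * ‖u t'‖) := by
            rw [integral_mul_const]; ring
        _ ≤ ∫ r in Ioo (l δ) (l δ + δ), (‖f r‖ ^ 2 + ‖u t'‖ ^ 2) := by
            refine integral_mono (hfi.mul_const _) (Integrable.add
              (hu.memLp_deriv.integrable_norm_pow two_ne_zero).restrict
              (integrable_const _)) fun r => ?_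
            simp only
            nlinarith [sq_nonneg (‖f r‖ - ‖u t'‖)]
        _ = (∫ r in Ioo (l δ) (l δ + δ), ‖f r‖ ^ 2) + δ * ‖u t'‖ ^ 2 := by
            rw [integral_add (hu.memLp_deriv.integrable_norm_pow two_ne_zero).restrict
              (integrable_const _)]
            simp [Measure.real, Real.volume_Ioo, h0.le]
        _ ≤ (∫ r in Ioo (l δ) (l δ + δ), ‖f r‖ ^ 2) +
              ∫ r in Ioo (l δ) (l δ + δ), ‖u r‖ ^ 2 := by gcongr
        _ = ∫ r in Ioo (l δ) (l δ + δ), W r := by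
            rw [← integral_add (hu.memLp_deriv.integrable_norm_pow two_ne_zero).restrict
              (hu.memLp.integrable_norm_pow two_ne_zero).restrict]
            simp [hWdef, add_comm]
    -- The squared distance in the metric `J t` is expanded around the reference time `t'`. Only
    -- increments of the energy, of `P† J P u` and of `J` appear, so no continuity of `P u` is
    -- presupposed.
    have h7 : inner ℝ (J t (P (u t) - P (u t'))) (P (u t) - P (u t')) =
        (g t - g t') - 2 * inner ℝ (∫ r in t'..t, f r) (u t') +
          inner ℝ ((J t - J t') (P (u t'))) (P (u t')) := by
      rw [← h2]
      simp only [hg, map_sub, inner_sub_left, inner_sub_right, sub_apply]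
      rw [hJ.symm t (P (u t')) (P (u t)), real_inner_comm (J t (P (u t)))]
      ring
    have h8 := (abs_le.1 h4).2
    have h9 := (abs_le.1 (le_refl |inner ℝ (∫ r in t'..t, f r) (u t')|)).1
    rw [h7] at h3
    simp only [hosc_def]
    simp only [hWdef] at h1 h5 ⊢
    nlinarith
  have hcauchy : Cauchy (map (fun t => P (u t)) F) := by
    rw [Metric.cauchy_iff]
    refine ⟨inferInstance, fun ε hε => ?_⟩
    have hev : ∀ᶠ δ in 𝓝[>] (0 : ℝ), modulus δ < c * (ε / 2) ^ 2 ∧ δ < b - a :=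
      (hmodulus.eventually_lt_const (by positivity)).and
        (nhdsWithin_le_nhds (Iio_mem_nhds (by linarith)))
    obtain ⟨δ, ⟨hδω', hδb⟩, hδ0⟩ := (hev.and self_mem_nhdsWithin).exists
    obtain ⟨t', ht'⟩ := main δ hδ0 hδb
    obtain ⟨-, -, hIF⟩ := hl δ hδ0 hδb
    have hd : ∀ t ∈ S₁ ∩ S₂, t ∈ Ioo (l δ) (l δ + δ) → dist (P (u t)) (P (u t')) < ε / 2 := by
      intro t h1 h2
      have h3 := (ht' t h1 h2).trans_lt hδω'
      rw [dist_eq_norm]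
      exact lt_of_pow_lt_pow_left₀ 2 (by positivity) (lt_of_mul_lt_mul_left h3 hc.le)
    refine ⟨_, image_mem_map (inter_mem (hF hS) hIF), ?_⟩
    rintro _ ⟨s, ⟨hs, hs'⟩, rfl⟩ _ ⟨t, ⟨ht, ht'⟩, rfl⟩
    have h1 := hd s hs hs'
    have h2 := hd t ht ht'
    have h3 := dist_triangle_right (P (u s)) (P (u t)) (P (u t'))
    linarith
  exact CompleteSpace.complete hcauchy

/-- Intervals are not null sets, so essential one-sided limits are taken along proper filters and
are unique. -/
theorem inf_ae_neBot_of_forall_Ioo {l : Filter ℝ}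
    (h : ∀ S ∈ l, ∃ x y : ℝ, x < y ∧ Ioo x y ⊆ S) : (l ⊓ ae (volume : Measure ℝ)).NeBot := by
  rw [inf_neBot_iff]
  intro S hS S' hS'
  obtain ⟨x, y, hxy, hsub⟩ := h S hS
  by_contra hne
  have h1 : Ioo x y ⊆ S'ᶜ := fun t ht ht' => hne ⟨t, hsub ht, ht'⟩
  have h2 := measure_mono_null h1 (mem_ae_iff.1 hS')
  rw [Real.volume_Ioo, ENNReal.ofReal_eq_zero] at h2
  linarith

instance nhdsGT_inf_ae_neBot (s : ℝ) : (𝓝[>] s ⊓ ae (volume : Measure ℝ)).NeBot :=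
  inf_ae_neBot_of_forall_Ioo fun _ hS => by
    obtain ⟨u, hu, h⟩ := mem_nhdsGT_iff_exists_Ioo_subset.1 hS
    exact ⟨s, u, hu, h⟩

instance nhdsLT_inf_ae_neBot (s : ℝ) : (𝓝[<] s ⊓ ae (volume : Measure ℝ)).NeBot :=
  inf_ae_neBot_of_forall_Ioo fun _ hS => by
    obtain ⟨u, hu, h⟩ := mem_nhdsLT_iff_exists_Ioo_subset.1 hS
    exact ⟨u, s, hu, h⟩

/-- The windows are `(a, a+δ)` here, and `(b-δ, b)` for the limit at the right end. -/
theorem IsEnergyPath.exists_tendsto_left (hJ : IsMassFamily J c C Λ)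
    (hu : IsEnergyPath P J a b u f) (hab : a < b) :
    ∃ U, Tendsto (fun t => P (u t)) (𝓝[>] a ⊓ ae volume) (𝓝 U) :=
  hu.exists_tendsto hJ hab inf_le_right (fun _ => a) fun δ h0 hδ =>
    ⟨le_rfl, by linarith, mem_inf_of_left (Ioo_mem_nhdsGT (by linarith))⟩

theorem IsEnergyPath.exists_tendsto_right (hJ : IsMassFamily J c C Λ)
    (hu : IsEnergyPath P J a b u f) (hab : a < b) :
    ∃ U, Tendsto (fun t => P (u t)) (𝓝[<] b ⊓ ae volume) (𝓝 U) :=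
  hu.exists_tendsto hJ hab inf_le_right (fun δ => b - δ) fun δ h0 hδ =>
    ⟨by linarith, by linarith, mem_inf_of_left (by
      rw [sub_add_cancel]; exact Ioo_mem_nhdsLT (by linarith))⟩

/-- The energy balance between the end points, in terms of the one-sided limits. -/
theorem energy_balance (hJ : IsMassFamily J c C Λ)
    (hu : IsEnergyPath P J a b u f) (hv : IsEnergyPath P J a b v k) (hab : a < b)
    {Ua Ub Va Vb : 𝓗} (hUa : Tendsto (fun t => P (u t)) (𝓝[>] a ⊓ ae volume) (𝓝 Ua))
    (hUb : Tendsto (fun t => P (u t)) (𝓝[<] b ⊓ ae volume) (𝓝 Ub))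
    (hVa : Tendsto (fun t => P (v t)) (𝓝[>] a ⊓ ae volume) (𝓝 Va))
    (hVb : Tendsto (fun t => P (v t)) (𝓝[<] b ⊓ ae volume) (𝓝 Vb)) :
    |inner ℝ (J b Ub) Vb - inner ℝ (J a Ua) Va -
        ∫ t in a..b, (inner ℝ (f t) (v t) + inner ℝ (k t) (u t))| ≤
      Λ * ∫ t in a..b, ‖P (u t)‖ * ‖P (v t)‖ := by
  obtain ⟨S, hS, hbal⟩ := exists_energy_balance hJ hu hv
  have hw₁ : Integrable fun t => inner ℝ (f t) (v t) + inner ℝ (k t) (u t) :=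
    (hu.memLp_deriv.integrable_inner_of_two hv.memLp).add
      (hv.memLp_deriv.integrable_inner_of_two hu.memLp)
  have hw₂ : Integrable fun t => ‖P (u t)‖ * ‖P (v t)‖ :=
    (hu.memLp.clm_comp P).norm.integrable_mul (hv.memLp.clm_comp P).norm
  have hprim : ∀ {w : ℝ → ℝ}, Integrable w → Tendsto (fun z : ℝ × ℝ => ∫ t in z.1..z.2, w t)
      ((𝓝[>] a ⊓ ae volume) ×ˢ (𝓝[<] b ⊓ ae volume)) (𝓝 (∫ t in a..b, w t)) := by
    intro w hw
    have hi : ∀ x y, IntervalIntegrable w volume x y := fun x y => hw.intervalIntegrable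
    have hcont := intervalIntegral.continuous_primitive hi 0
    have h1 := ((hcont.tendsto b).mono_left (inf_le_left.trans (nhdsWithin_le_nhds (s := Iio b)) :
      𝓝[<] b ⊓ ae volume ≤ 𝓝 b)).comp
        (tendsto_snd (f := 𝓝[>] a ⊓ ae volume) (g := 𝓝[<] b ⊓ ae volume))
    have h2 := ((hcont.tendsto a).mono_left (inf_le_left.trans (nhdsWithin_le_nhds (s := Ioi a)) :
      𝓝[>] a ⊓ ae volume ≤ 𝓝 a)).comp
        (tendsto_fst (f := 𝓝[>] a ⊓ ae volume) (g := 𝓝[<] b ⊓ ae volume))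
    have h3 := h1.sub h2
    rw [intervalIntegral.integral_interval_sub_left (hi _ _) (hi _ _)] at h3
    refine h3.congr fun z => ?_
    exact intervalIntegral.integral_interval_sub_left (hi _ _) (hi _ _)
  have hg : ∀ {F : Filter ℝ} {s : ℝ} {x y : ℝ → 𝓗} {X Y : 𝓗}, F ≤ 𝓝 s → Tendsto x F (𝓝 X) →
      Tendsto y F (𝓝 Y) → Tendsto (fun t => inner ℝ (J t (x t)) (y t)) F
        (𝓝 (inner ℝ (J s X) Y)) := by
    intro F s x y X Y hF hx hy
    have h1 : Tendsto (fun t => J t (x t)) F (𝓝 (J s X)) :=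
      (isBoundedBilinearMap_apply.continuous.tendsto (J s, X)).comp
        (((hJ.continuous.tendsto s).mono_left hF).prodMk_nhds hx)
    exact h1.inner hy
  have hgb := (hg (inf_le_left.trans nhdsWithin_le_nhds) hUb hVb).comp
    (tendsto_snd (f := 𝓝[>] a ⊓ ae volume) (g := 𝓝[<] b ⊓ ae volume))
  have hga := (hg (inf_le_left.trans nhdsWithin_le_nhds) hUa hVa).comp
    (tendsto_fst (f := 𝓝[>] a ⊓ ae volume) (g := 𝓝[<] b ⊓ ae volume))
  refine le_of_tendsto_of_tendsto ((hgb.sub hga).sub (hprim hw₁)).abs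
    ((hprim hw₂).const_mul Λ) ?_
  -- Separating the two times by the midpoint guarantees `p < q` in the balance before the limit.
  have ha : ∀ᶠ t in 𝓝[>] a ⊓ ae volume, t ∈ S ∧ t ∈ Ioo a ((a + b) / 2) :=
    Filter.Eventually.and (mem_inf_of_right hS)
      (mem_inf_of_left (Ioo_mem_nhdsGT (by linarith)))
  have hb : ∀ᶠ t in 𝓝[<] b ⊓ ae volume, t ∈ S ∧ t ∈ Ioo ((a + b) / 2) b :=
    Filter.Eventually.and (mem_inf_of_right hS)
      (mem_inf_of_left (Ioo_mem_nhdsLT (by linarith)))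
  filter_upwards [ha.prod_mk hb] with z hz
  exact hbal z.1 hz.1.1 z.2 hz.2.1 hz.1.2.1 (hz.1.2.2.trans hz.2.2.1) hz.2.2.2

end EnergyTrace

/-! ### Bounds for derivatives from distance estimates at one point -/

theorem HasFDerivAt.norm_apply_le_of_eventually_le {E F : Type*} [NormedAddCommGroup E]
    [NormedSpace ℝ E] [NormedAddCommGroup F] [NormedSpace ℝ F] {f : E → F} {f' : E →L[ℝ] F}
    {y : E} (hf : HasFDerivAt f f' y) {C : ℝ}
    (h : ∀ᶠ z in 𝓝 y, ‖f z - f y‖ ≤ C * ‖z - y‖) (v : E) : ‖f' v‖ ≤ C * ‖v‖ := by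
  have h1 := (hf.hasLineDerivAt v).tendsto_slope_zero.norm
  have h2 : Tendsto (fun r : ℝ => y + r • v) (𝓝[≠] 0) (𝓝 y) := by
    have : Continuous fun r : ℝ => y + r • v := by fun_prop
    simpa using (this.tendsto 0).mono_left nhdsWithin_le_nhds
  refine le_of_tendsto h1 ?_
  filter_upwards [h2.eventually h, self_mem_nhdsWithin] with r hr hr0
  have hr0 : 0 < ‖r‖ := norm_pos_iff.2 hr0
  rw [add_sub_cancel_left, norm_smul] at hr
  rw [norm_smul, norm_inv, inv_mul_le_iff₀ hr0]
  linarith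

theorem HasFDerivAt.le_norm_apply_of_eventually_le {E F : Type*} [NormedAddCommGroup E]
    [NormedSpace ℝ E] [NormedAddCommGroup F] [NormedSpace ℝ F] {f : E → F} {f' : E →L[ℝ] F}
    {y : E} (hf : HasFDerivAt f f' y) {C : ℝ}
    (h : ∀ᶠ z in 𝓝 y, C * ‖z - y‖ ≤ ‖f z - f y‖) (v : E) : C * ‖v‖ ≤ ‖f' v‖ := by
  have h1 := (hf.hasLineDerivAt v).tendsto_slope_zero.norm
  have h2 : Tendsto (fun r : ℝ => y + r • v) (𝓝[≠] 0) (𝓝 y) := by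
    have : Continuous fun r : ℝ => y + r • v := by fun_prop
    simpa using (this.tendsto 0).mono_left nhdsWithin_le_nhds
  refine ge_of_tendsto h1 ?_
  filter_upwards [h2.eventually h, self_mem_nhdsWithin] with r hr hr0
  have hr0 : 0 < ‖r‖ := norm_pos_iff.2 hr0
  rw [add_sub_cancel_left, norm_smul] at hr
  rw [norm_smul, norm_inv, le_inv_mul_iff₀ hr0]
  linarith

namespace EvolvingSurface

variable {d : ℕ} (M : EvolvingSurface d)

/-! ### The flow near the initial surface -/

/-- Compactness gives uniform constants, and having `Γ₀` in the interior allows spatial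
differentiation of the flow at points of `Γ₀`. -/
theorem exists_collar : ∃ K, IsCompact K ∧ M.Γ₀ ⊆ interior K ∧ K ⊆ M.V :=
  exists_compact_between M.isCompact_Γ₀ M.isOpen_V M.Γ₀_subset_V

/-- A compact neighbourhood of the initial surface on which the flow is defined. -/
noncomputable def collar : Set (EuclideanSpace ℝ (Fin d)) := M.exists_collar.choose

theorem isCompact_collar : IsCompact M.collar := M.exists_collar.choose_spec.1

theorem Γ₀_subset_interior_collar : M.Γ₀ ⊆ interior M.collar := M.exists_collar.choose_spec.2.1

theorem Γ₀_subset_collar : M.Γ₀ ⊆ M.collar := M.Γ₀_subset_interior_collar.trans interior_subset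

theorem collar_subset_V : M.collar ⊆ M.V := M.exists_collar.choose_spec.2.2

/-- The field is smooth only up to the end times, on a set that is not open in time. A ball times
the closed time interval is convex, which is enough for a `C¹` function to be locally Lipschitz
there. -/
theorem locallyLipschitzOn_w : LocallyLipschitzOn (M.Ω ×ˢ Icc 0 M.T) M.w := by
  rintro ⟨x, t⟩ ⟨hx, ht⟩
  obtain ⟨r, hr, hsub⟩ := Metric.isOpen_iff.1 M.isOpen_Ω x hx
  have hconv : Convex ℝ (Metric.ball x r ×ˢ Icc 0 M.T) := (convex_ball x r).prod (convex_Icc _ _)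
  have hmem : (x, t) ∈ Metric.ball x r ×ˢ Icc 0 M.T := ⟨Metric.mem_ball_self hr, ht⟩
  have hcd : ContDiffOn ℝ 1 M.w (Metric.ball x r ×ˢ Icc 0 M.T) :=
    (M.contDiffOn_w.mono (prod_mono_left hsub)).of_le (by exact_mod_cast le_top)
  obtain ⟨K, S, hS, hL⟩ := hcd.locallyLipschitzOn hconv hmem
  refine ⟨K, S, ?_, hL⟩
  rw [nhdsWithin_prod_eq, IsOpen.nhdsWithin_eq Metric.isOpen_ball (Metric.mem_ball_self hr)] at hS
  rwa [nhdsWithin_prod_eq, IsOpen.nhdsWithin_eq M.isOpen_Ω hx]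

/-- The points reached from the collar. -/
noncomputable def range : Set (EuclideanSpace ℝ (Fin d)) :=
  (fun q : EuclideanSpace ℝ (Fin d) × ℝ => M.Φ q.2 q.1) '' (M.collar ×ˢ Icc 0 M.T)

theorem continuousOn_flow : ContinuousOn
    (fun q : EuclideanSpace ℝ (Fin d) × ℝ => M.Φ q.2 q.1) (M.V ×ˢ Icc 0 M.T) :=
  M.contDiffOn_Φ.continuousOn

theorem isCompact_range : IsCompact M.range :=
  (M.isCompact_collar.prod isCompact_Icc).image_of_continuousOn
    (M.continuousOn_flow.mono (prod_mono_left M.collar_subset_V))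

theorem range_subset : M.range ⊆ M.Ω := by
  rintro _ ⟨⟨y, t⟩, ⟨hy, ht⟩, rfl⟩
  exact M.Φ_mem y (M.collar_subset_V hy) t ht

/-- A locally Lipschitz function is Lipschitz on compact sets; convexity of the range of the flow is
not required. The estimate is then specialized to equal times. -/
theorem exists_lipschitz_w : ∃ L : ℝ, 0 ≤ L ∧ ∀ t ∈ Icc 0 M.T, ∀ x ∈ M.range, ∀ y ∈ M.range,
    ‖M.w (x, t) - M.w (y, t)‖ ≤ L * ‖x - y‖ := by
  obtain ⟨K, hK⟩ := (M.locallyLipschitzOn_w.mono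
    (prod_mono_left M.range_subset)).exists_lipschitzOnWith_of_compact
      (M.isCompact_range.prod isCompact_Icc)
  refine ⟨K, K.2, fun t ht x hx y hy => ?_⟩
  have := hK.dist_le_mul (x, t) ⟨hx, ht⟩ (y, t) ⟨hy, ht⟩
  simpa [dist_eq_norm, Prod.norm_def] using this

/-- A Lipschitz constant for the velocity field along the flow. -/
noncomputable def rate : ℝ := M.exists_lipschitz_w.choose

theorem rate_nonneg : 0 ≤ M.rate := M.exists_lipschitz_w.choose_spec.1

theorem norm_w_sub_le {t : ℝ} (ht : t ∈ Icc 0 M.T) {x y : EuclideanSpace ℝ (Fin d)}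
    (hx : x ∈ M.range) (hy : y ∈ M.range) : ‖M.w (x, t) - M.w (y, t)‖ ≤ M.rate * ‖x - y‖ :=
  M.exists_lipschitz_w.choose_spec.2 t ht x hx y hy

/-- Two trajectories separate or approach each other at most exponentially fast. -/
theorem norm_flow_sub_le {x y : EuclideanSpace ℝ (Fin d)} (hx : x ∈ M.collar)
    (hy : y ∈ M.collar) {s t : ℝ} (hs : s ∈ Icc 0 M.T) (ht : t ∈ Icc 0 M.T) :
    ‖M.Φ t x - M.Φ t y‖ ≤ Real.exp (M.rate * |s - t|) * ‖M.Φ s x - M.Φ s y‖ := by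
  set L := M.rate with hL
  set h : ℝ → ℝ := fun r => ‖M.Φ r x - M.Φ r y‖ ^ 2 with hh
  set h' : ℝ → ℝ := fun r =>
    2 * inner ℝ (M.Φ r x - M.Φ r y) (M.w (M.Φ r x, r) - M.w (M.Φ r y, r)) with hh'
  have hder : ∀ r ∈ Icc 0 M.T, HasDerivWithinAt h (h' r) (Icc 0 M.T) r := fun r hr =>
    ((M.hasDerivWithinAt_Φ x (M.collar_subset_V hx) r hr).sub
      (M.hasDerivWithinAt_Φ y (M.collar_subset_V hy) r hr)).norm_sq
  have hb : ∀ r ∈ Icc 0 M.T, |h' r| ≤ 2 * L * h r := by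
    intro r hr
    simp only [hh', hh, abs_mul, abs_two]
    have h1 := abs_real_inner_le_norm (M.Φ r x - M.Φ r y) (M.w (M.Φ r x, r) - M.w (M.Φ r y, r))
    have h2 := M.norm_w_sub_le hr (x := M.Φ r x) (y := M.Φ r y)
      ⟨(x, r), ⟨hx, hr⟩, rfl⟩ ⟨(y, r), ⟨hy, hr⟩, rfl⟩
    nlinarith [norm_nonneg (M.Φ r x - M.Φ r y)]
  have hexp : ∀ κ r : ℝ, HasDerivAt (fun r => Real.exp (κ * r)) (Real.exp (κ * r) * κ) r :=
    fun κ r => by simpa using ((hasDerivAt_id r).const_mul κ).exp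
  have hmul : ∀ κ, ∀ r ∈ Icc 0 M.T, HasDerivWithinAt (fun r => Real.exp (κ * r) * h r)
      (Real.exp (κ * r) * (κ * h r + h' r)) (Icc 0 M.T) r := fun κ r hr => by
    have e : Real.exp (κ * r) * (κ * h r + h' r) =
        Real.exp (κ * r) * κ * h r + Real.exp (κ * r) * h' r := by ring
    rw [e]
    exact (hexp κ r).hasDerivWithinAt.mul (hder r hr)
  have hint : ∀ κ, ∀ r ∈ interior (Icc 0 M.T), HasDerivAt (fun r => Real.exp (κ * r) * h r)
      (Real.exp (κ * r) * (κ * h r + h' r)) r := fun κ r hr =>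
    (hmul κ r (interior_subset hr)).hasDerivAt (mem_interior_iff_mem_nhds.1 hr)
  -- Grönwall in both time directions: since `|h'| ≤ 2 L h`, multiplication by `exp(2 L r)` makes
  -- `h` increasing and by `exp(-2 L r)` decreasing.
  have hmono : MonotoneOn (fun r => Real.exp (2 * L * r) * h r) (Icc 0 M.T) := by
    refine monotoneOn_of_deriv_nonneg (convex_Icc _ _)
      (fun r hr => (hmul _ r hr).continuousWithinAt)
      (fun r hr => (hint _ r hr).differentiableAt.differentiableWithinAt) fun r hr => ?_
    rw [(hint _ r hr).deriv]
    have := (abs_le.1 (hb r (interior_subset hr))).1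
    exact mul_nonneg (Real.exp_pos _).le (by linarith)
  have hanti : AntitoneOn (fun r => Real.exp (-(2 * L) * r) * h r) (Icc 0 M.T) := by
    refine antitoneOn_of_deriv_nonpos (convex_Icc _ _)
      (fun r hr => (hmul _ r hr).continuousWithinAt)
      (fun r hr => (hint _ r hr).differentiableAt.differentiableWithinAt) fun r hr => ?_
    rw [(hint _ r hr).deriv]
    have := (abs_le.1 (hb r (interior_subset hr))).2
    exact mul_nonpos_of_nonneg_of_nonpos (Real.exp_pos _).le (by linarith)
  have key : h t ≤ Real.exp (2 * L * |s - t|) * h s := by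
    rcases le_total s t with hst | hst
    · have h1 := hanti hs ht hst
      simp only at h1
      rw [abs_of_nonpos (by linarith)]
      calc h t = Real.exp (2 * L * t) * (Real.exp (-(2 * L) * t) * h t) := by
            rw [← mul_assoc, ← Real.exp_add]; simp
        _ ≤ Real.exp (2 * L * t) * (Real.exp (-(2 * L) * s) * h s) := by gcongr
        _ = _ := by rw [← mul_assoc, ← Real.exp_add]; ring_nf
    · have h1 := hmono ht hs hst
      simp only at h1
      rw [abs_of_nonneg (by linarith)]
      calc h t = Real.exp (-(2 * L) * t) * (Real.exp (2 * L * t) * h t) := by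
            rw [← mul_assoc, ← Real.exp_add]; simp
        _ ≤ Real.exp (-(2 * L) * t) * (Real.exp (2 * L * s) * h s) := by gcongr
        _ = _ := by rw [← mul_assoc, ← Real.exp_add]; ring_nf
  refine (sq_le_sq₀ (norm_nonneg _) (by positivity)).1 ?_
  rw [mul_pow, ← Real.exp_nat_mul]
  simpa [hh, mul_assoc] using key

theorem injOn_flow {t : ℝ} (ht : t ∈ Icc 0 M.T) : InjOn (M.Φ t) M.collar := by
  intro x hx y hy hxy
  have h0 : (0 : ℝ) ∈ Icc 0 M.T := ⟨le_rfl, M.T_pos.le⟩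
  have := M.norm_flow_sub_le hx hy ht h0
  rw [hxy, sub_self, norm_zero, mul_zero, M.Φ_zero x (M.collar_subset_V hx),
    M.Φ_zero y (M.collar_subset_V hy)] at this
  exact sub_eq_zero.1 (norm_eq_zero.1 (le_antisymm this (norm_nonneg _)))

/-- The distortion of distances by the flow. -/
noncomputable def distortion : ℝ := Real.exp (M.rate * M.T)

theorem distortion_pos : 0 < M.distortion := Real.exp_pos _

theorem norm_flow_sub_le_distortion {x y : EuclideanSpace ℝ (Fin d)} (hx : x ∈ M.collar)
    (hy : y ∈ M.collar) {t : ℝ} (ht : t ∈ Icc 0 M.T) :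
    ‖M.Φ t x - M.Φ t y‖ ≤ M.distortion * ‖x - y‖ ∧ ‖x - y‖ ≤ M.distortion * ‖M.Φ t x - M.Φ t y‖ := by
  have h0 : (0 : ℝ) ∈ Icc 0 M.T := ⟨le_rfl, M.T_pos.le⟩
  have h1 := M.norm_flow_sub_le hx hy h0 ht
  have h2 := M.norm_flow_sub_le hx hy ht h0
  rw [M.Φ_zero x (M.collar_subset_V hx), M.Φ_zero y (M.collar_subset_V hy)] at h1 h2
  have h3 : Real.exp (M.rate * |t|) ≤ M.distortion := by
    rw [abs_of_nonneg ht.1]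
    exact Real.exp_le_exp.2 (mul_le_mul_of_nonneg_left ht.2 M.rate_nonneg)
  rw [zero_sub, abs_neg] at h1
  rw [sub_zero] at h2
  exact ⟨h1.trans (by gcongr), h2.trans (by gcongr)⟩

theorem contDiffAt_flow {y : EuclideanSpace ℝ (Fin d)} (hy : y ∈ M.V) {t : ℝ}
    (ht : t ∈ Ioo 0 M.T) :
    ContDiffAt ℝ ∞ (fun q : EuclideanSpace ℝ (Fin d) × ℝ => M.Φ q.2 q.1) (y, t) :=
  M.contDiffOn_Φ.contDiffAt (prod_mem_nhds (M.isOpen_V.mem_nhds hy) (Icc_mem_nhds ht.1 ht.2))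

theorem hasDerivAt_flow {y : EuclideanSpace ℝ (Fin d)} (hy : y ∈ M.V) {t : ℝ}
    (ht : t ∈ Ioo 0 M.T) : HasDerivAt (fun s => M.Φ s y) (M.w (M.Φ t y, t)) t :=
  (M.hasDerivWithinAt_Φ y hy t (Ioo_subset_Icc_self ht)).hasDerivAt (Icc_mem_nhds ht.1 ht.2)

theorem contDiffAt_flow_slice {y : EuclideanSpace ℝ (Fin d)} (hy : y ∈ M.V) {t : ℝ}
    (ht : t ∈ Ioo 0 M.T) : ContDiffAt ℝ ∞ (M.Φ t) y :=
  ContDiffAt.comp (f := fun z : EuclideanSpace ℝ (Fin d) => (z, t)) y (M.contDiffAt_flow hy ht)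
    (by fun_prop)

/-- The spatial derivative of the flow. -/
noncomputable def dΦ (q : EuclideanSpace ℝ (Fin d) × ℝ) :
    EuclideanSpace ℝ (Fin d) →L[ℝ] EuclideanSpace ℝ (Fin d) := fderiv ℝ (M.Φ q.2) q.1

theorem hasFDerivAt_flow_slice {y : EuclideanSpace ℝ (Fin d)} (hy : y ∈ M.V) {t : ℝ}
    (ht : t ∈ Ioo 0 M.T) : HasFDerivAt (M.Φ t) (M.dΦ (y, t)) y :=
  ((M.contDiffAt_flow_slice hy ht).differentiableAt (by simp)).hasFDerivAt

theorem dΦ_eq_fderiv_comp {y : EuclideanSpace ℝ (Fin d)} (hy : y ∈ M.V) {t : ℝ}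
    (ht : t ∈ Ioo 0 M.T) : M.dΦ (y, t) =
      (fderiv ℝ (fun q : EuclideanSpace ℝ (Fin d) × ℝ => M.Φ q.2 q.1) (y, t)).comp
        (ContinuousLinearMap.inl ℝ _ _) := by
  have h1 := ((M.contDiffAt_flow hy ht).differentiableAt (by simp)).hasFDerivAt
  exact (h1.comp y (hasFDerivAt_prodMk_left (𝕜 := ℝ) y t)).fderiv

theorem continuousOn_dΦ : ContinuousOn M.dΦ (M.V ×ˢ Ioo 0 M.T) := by
  have h1 : ContinuousOn
      (fderiv ℝ fun q : EuclideanSpace ℝ (Fin d) × ℝ => M.Φ q.2 q.1) (M.V ×ˢ Ioo 0 M.T) :=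
    (M.contDiffOn_Φ.mono (prod_mono_right Ioo_subset_Icc_self)).continuousOn_fderiv_of_isOpen
      (M.isOpen_V.prod isOpen_Ioo) (by simp)
  refine (h1.clm_comp (continuousOn_const
    (c := ContinuousLinearMap.inl ℝ (EuclideanSpace ℝ (Fin d)) ℝ))).congr ?_
  rintro ⟨y, t⟩ ⟨hy, ht⟩
  exact M.dΦ_eq_fderiv_comp hy ht

theorem norm_dΦ_apply_le {y : EuclideanSpace ℝ (Fin d)} (hy : y ∈ interior M.collar) {t : ℝ}
    (ht : t ∈ Ioo 0 M.T) (v : EuclideanSpace ℝ (Fin d)) :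
    ‖M.dΦ (y, t) v‖ ≤ M.distortion * ‖v‖ := by
  refine (M.hasFDerivAt_flow_slice (M.collar_subset_V (interior_subset hy))
    ht).norm_apply_le_of_eventually_le ?_ v
  filter_upwards [mem_interior_iff_mem_nhds.1 hy] with z hz
  exact (M.norm_flow_sub_le_distortion hz (interior_subset hy) (Ioo_subset_Icc_self ht)).1

theorem le_norm_dΦ_apply {y : EuclideanSpace ℝ (Fin d)} (hy : y ∈ interior M.collar) {t : ℝ}
    (ht : t ∈ Ioo 0 M.T) (v : EuclideanSpace ℝ (Fin d)) :
    ‖v‖ ≤ M.distortion * ‖M.dΦ (y, t) v‖ := by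
  have h := (M.hasFDerivAt_flow_slice (M.collar_subset_V (interior_subset hy))
    ht).le_norm_apply_of_eventually_le (C := M.distortion⁻¹) (by
      filter_upwards [mem_interior_iff_mem_nhds.1 hy] with z hz
      rw [inv_mul_le_iff₀ M.distortion_pos]
      exact (M.norm_flow_sub_le_distortion hz (interior_subset hy) (Ioo_subset_Icc_self ht)).2) v
  rwa [inv_mul_le_iff₀ M.distortion_pos] at h

theorem injective_dΦ {y : EuclideanSpace ℝ (Fin d)} (hy : y ∈ interior M.collar) {t : ℝ}
    (ht : t ∈ Ioo 0 M.T) : Function.Injective (M.dΦ (y, t)) := by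
  refine (injective_iff_map_eq_zero _).2 fun v hv => ?_
  have := M.le_norm_dΦ_apply hy ht v
  rw [hv, norm_zero, mul_zero] at this
  exact norm_eq_zero.1 (le_antisymm this (norm_nonneg _))

/-! ### The inverse of the flow -/

/-- The initial position of the particle that is at `p.1` at time `p.2`. -/
noncomputable def back (p : EuclideanSpace ℝ (Fin d) × ℝ) : EuclideanSpace ℝ (Fin d) :=
  Function.invFunOn (M.Φ p.2) M.collar p.1

theorem back_flow {y : EuclideanSpace ℝ (Fin d)} (hy : y ∈ M.collar) {t : ℝ}
    (ht : t ∈ Icc 0 M.T) : M.back (M.Φ t y, t) = y :=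
  (M.injOn_flow ht).leftInvOn_invFunOn hy

/-- The inverse function theorem for the space-time map `(y,t) ↦ (Φ t y, t)`, whose derivative is
block triangular with invertible diagonal blocks. It yields smoothness in space and time together,
as test functions need. -/
theorem contDiffAt_back {y : EuclideanSpace ℝ (Fin d)} (hy : y ∈ interior M.collar) {t : ℝ}
    (ht : t ∈ Ioo 0 M.T) : ContDiffAt ℝ ∞ M.back (M.Φ t y, t) := by
  have hyV : y ∈ M.V := M.collar_subset_V (interior_subset hy)
  set F : EuclideanSpace ℝ (Fin d) × ℝ → EuclideanSpace ℝ (Fin d) := fun q => M.Φ q.2 q.1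
  set Ψ : EuclideanSpace ℝ (Fin d) × ℝ → EuclideanSpace ℝ (Fin d) × ℝ := fun q => (F q, q.2)
  have hΨ : ContDiffAt ℝ ∞ Ψ (y, t) := (M.contDiffAt_flow hyV ht).prodMk contDiffAt_snd
  have hF := ((M.contDiffAt_flow hyV ht).differentiableAt (by simp)).hasFDerivAt
  have hΨ' : HasFDerivAt Ψ ((fderiv ℝ F (y, t)).prod (ContinuousLinearMap.snd ℝ _ _)) (y, t) :=
    hF.prodMk hasFDerivAt_snd
  set D := (fderiv ℝ F (y, t)).prod
    (ContinuousLinearMap.snd ℝ (EuclideanSpace ℝ (Fin d)) ℝ) with hD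
  have hinj : Function.Injective D.toLinearMap := by
    refine (injective_iff_map_eq_zero _).2 ?_
    rintro ⟨h, τ⟩ h0
    have h0' : fderiv ℝ F (y, t) (h, τ) = 0 ∧ τ = 0 := by simpa [hD] using h0
    obtain ⟨h1, rfl⟩ := h0'
    have h2 : M.dΦ (y, t) h = 0 := by
      rw [M.dΦ_eq_fderiv_comp hyV ht]
      simpa using h1
    have h3 := M.injective_dΦ hy ht (h2.trans (map_zero _).symm)
    simp [h3]
  let e : (EuclideanSpace ℝ (Fin d) × ℝ) ≃L[ℝ] (EuclideanSpace ℝ (Fin d) × ℝ) :=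
    (LinearEquiv.ofInjectiveEndo D.toLinearMap hinj).toContinuousLinearEquiv
  have he : HasFDerivAt Ψ (e : (EuclideanSpace ℝ (Fin d) × ℝ) →L[ℝ] _) (y, t) := by
    have : (e : (EuclideanSpace ℝ (Fin d) × ℝ) →L[ℝ] _) = D :=
      ContinuousLinearMap.ext fun _ => rfl
    rwa [this]
  have hst := hΨ.hasStrictFDerivAt' he (by simp)
  have hinv : ContDiffAt ℝ ∞ (hΨ.localInverse he (by simp)) (Ψ (y, t)) :=
    hΨ.to_localInverse he (by simp)
  have hright : ∀ᶠ p in 𝓝 (Ψ (y, t)), Ψ (hΨ.localInverse he (by simp) p) = p :=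
    hst.eventually_right_inverse
  have hcont : Tendsto (hΨ.localInverse he (by simp)) (𝓝 (Ψ (y, t))) (𝓝 (y, t)) := by
    have := hinv.continuousAt.tendsto
    rwa [hΨ.localInverse_apply_image he (by simp)] at this
  have hnear : ∀ᶠ q in 𝓝 (y, t), q ∈ M.collar ×ˢ Icc 0 M.T :=
    prod_mem_nhds (mem_interior_iff_mem_nhds.1 hy) (Icc_mem_nhds ht.1 ht.2)
  -- Near the point the local inverse stays in the collar, where the flow is injective, so its first
  -- component is `back`.
  refine (contDiffAt_fst.comp _ hinv).congr_of_eventuallyEq ?_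
  filter_upwards [hright, hcont.eventually hnear] with p hp hq
  conv_lhs => rw [← hp]
  exact M.back_flow hq.1 hq.2

end EvolvingSurface

/-! ### Hausdorff measure and tangent vectors of hypersurfaces -/

theorem LipschitzOnWith.euclideanHausdorffMeasure_image_le {X Y : Type*} [EMetricSpace X]
    [EMetricSpace Y] [MeasurableSpace X] [BorelSpace X] [MeasurableSpace Y] [BorelSpace Y]
    {K : NNReal} {f : X → Y} {s : Set X} (h : LipschitzOnWith K f s) (n : ℕ) :
    μHE[n] (f '' s) ≤ (K : ℝ≥0∞) ^ n * μHE[n] s := by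
  have h1 := h.hausdorffMeasure_image_le (d := n) (Nat.cast_nonneg n)
  rw [ENNReal.rpow_natCast] at h1
  simp only [Measure.euclideanHausdorffMeasure_def, Measure.smul_apply, ENNReal.smul_def,
    smul_eq_mul]
  calc _ ≤ _ * ((K : ℝ≥0∞) ^ n * μH[n] s) := by gcongr
    _ = _ := by ring

section Hypersurface

variable {d : ℕ} {Γ : Set (EuclideanSpace ℝ (Fin d))} {y : EuclideanSpace ℝ (Fin d)}

theorem IsSmoothHypersurface.exists_local_equation (h : IsSmoothHypersurface Γ) (hy : y ∈ Γ) :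
    ∃ (U : Set (EuclideanSpace ℝ (Fin d))) (f : EuclideanSpace ℝ (Fin d) → ℝ), U ∈ 𝓝 y ∧
      HasStrictFDerivAt f (innerSL ℝ (gradient f y)) y ∧ gradient f y ≠ 0 ∧
      ∀ z ∈ U, z ∈ Γ ↔ f z = 0 := by
  obtain ⟨U, hU, hyU, f, hf, hne, heq⟩ := h y hy
  have hd : innerSL ℝ (gradient f y) = fderiv ℝ f y := by
    ext v
    simp [inner_gradient_left]
  refine ⟨U, f, hU.mem_nhds hyU, ?_, ?_, fun z hz => ?_⟩
  · rw [hd]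
    exact (hf.contDiffAt (hU.mem_nhds hyU)).hasStrictFDerivAt (by simp)
  · intro h0
    apply hne y hyU
    rw [← hd, h0, map_zero]
  · have : z ∈ Γ ∩ U ↔ z ∈ {y ∈ U | f y = 0} := by rw [heq]
    simpa [hz] using this

/-- Vectors orthogonal to the gradient of a local equation are tangent to the hypersurface. -/
theorem mem_tangentConeAt_of_local_equation {U : Set (EuclideanSpace ℝ (Fin d))}
    {f : EuclideanSpace ℝ (Fin d) → ℝ} (hU : U ∈ 𝓝 y) (hy : y ∈ Γ)
    (hf : HasStrictFDerivAt f (innerSL ℝ (gradient f y)) y) (hne : gradient f y ≠ 0)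
    (heq : ∀ z ∈ U, z ∈ Γ ↔ f z = 0) {v : EuclideanSpace ℝ (Fin d)}
    (hv : inner ℝ (gradient f y) v = 0) : v ∈ tangentConeAt ℝ Γ y := by
  have hrange : (innerSL ℝ (gradient f y)).toLinearMap.range = ⊤ := by
    rw [LinearMap.range_eq_top]
    intro c
    refine ⟨(c / ‖gradient f y‖ ^ 2) • gradient f y, ?_⟩
    have : ‖gradient f y‖ ^ 2 ≠ 0 := by simpa using hne
    simp
    field_simp
  let k : (innerSL ℝ (gradient f y)).toLinearMap.ker := ⟨v, by simpa using hv⟩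
  -- The implicit function theorem supplies a curve in the level set of `f` through `y` with
  -- velocity `v`.
  let γ : ℝ → EuclideanSpace ℝ (Fin d) := fun r =>
    HasStrictFDerivAt.implicitFunction f _ hf hrange (f y) (r • k)
  have hlin : HasDerivAt (fun r : ℝ => r • k) k 0 := by
    have h1 := (hasDerivAt_id (0 : ℝ)).smul_const k
    rw [one_smul ℝ k] at h1
    exact h1
  have hγ : HasDerivAt γ v 0 := by
    have h1 := (hf.to_implicitFunction hrange).hasFDerivAt
    rw [← zero_smul ℝ k] at h1
    exact h1.comp_hasDerivAt 0 hlin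
  have hγ0 : γ 0 = y := by
    simp only [γ, zero_smul]
    exact hf.implicitFunction_apply_image hrange
  have hfγ : ∀ᶠ r in 𝓝 (0 : ℝ), f (γ r) = f y := by
    have h1 : Tendsto (fun r : ℝ => (f y, r • k)) (𝓝 0) (𝓝 (f y, 0)) := by
      have h2 := hlin.continuousAt.tendsto
      rw [zero_smul] at h2
      exact tendsto_const_nhds.prodMk_nhds h2
    exact h1.eventually (hf.map_implicitFunction_eq hrange)
  have hγU : ∀ᶠ r in 𝓝 (0 : ℝ), γ r ∈ U := by
    have := hγ.continuousAt.tendsto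
    rw [hγ0] at this
    exact this hU
  have hfy : f y = 0 := (heq y (mem_of_mem_nhds hU)).1 hy
  refine mem_tangentConeAt_of_seq (𝓝[≠] (0 : ℝ)) (fun r => r⁻¹) (fun r => γ r - y) ?_ ?_ ?_
  · have := (hγ.continuousAt.tendsto).mono_left (nhdsWithin_le_nhds (s := {0}ᶜ))
    rw [hγ0] at this
    simpa using this.sub_const y
  · filter_upwards [nhdsWithin_le_nhds hfγ, nhdsWithin_le_nhds hγU] with r h1 h2
    rw [add_sub_cancel]
    exact (heq _ h2).2 (h1.trans hfy)
  · have := hγ.tendsto_slope_zero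
    simpa [hγ0] using this

/-- Near each point the orthogonal projection to the tangent hyperplane is injective on the surface
with 2-Lipschitz inverse, so a piece of the surface is a Lipschitz image of a bounded set in
dimension `d - 1`. Compactness reduces to such pieces. -/
theorem IsSmoothHypersurface.measure_lt_top (h : IsSmoothHypersurface Γ) (hc : IsCompact Γ) :
    μHE[d - 1] Γ < ⊤ := by
  refine hc.measure_lt_top_of_nhdsWithin fun y hy => ?_
  obtain ⟨U, f, hU, hf, hne, heq⟩ := h.exists_local_equation hy
  set g := gradient f y with hg
  have hgpos : 0 < ‖g‖ := norm_pos_iff.2 hne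
  have hev := hf.isLittleO.def (c := ‖g‖ / 2) (by positivity)
  rw [nhds_prod_eq] at hev
  obtain ⟨N, hN, hNb⟩ := mem_prod_same_iff.1 hev
  set S := Γ ∩ (N ∩ U ∩ Metric.ball y 1) with hS
  have hSmem : S ∈ 𝓝[Γ] y := inter_mem_nhdsWithin Γ (inter_mem (inter_mem hN hU)
    (Metric.ball_mem_nhds y one_pos))
  let k : Submodule ℝ (EuclideanSpace ℝ (Fin d)) := (Submodule.span ℝ {g})ᗮ
  let p := k.orthogonalProjectionOnto
  have hfr : Module.finrank ℝ k = d - 1 := by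
    have h1 := (Submodule.span ℝ {g}).finrank_add_finrank_orthogonal
    rw [finrank_span_singleton hne, finrank_euclideanSpace_fin] at h1
    change Module.finrank ℝ (Submodule.span ℝ {g})ᗮ = d - 1
    omega
  have hanti : ∀ z ∈ S, ∀ z' ∈ S, ‖z - z'‖ ≤ 2 * ‖p z - p z'‖ := by
    intro z hz z' hz'
    have h1 : ‖f z - f z' - inner ℝ g (z - z')‖ ≤ ‖g‖ / 2 * ‖z - z'‖ :=
      hNb (show (z, z') ∈ N ×ˢ N from ⟨hz.2.1.1, hz'.2.1.1⟩)
    rw [(heq z hz.2.1.2).1 hz.1, (heq z' hz'.2.1.2).1 hz'.1, sub_zero, zero_sub, norm_neg] at h1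
    have h2 : ‖z - z'‖ ^ 2 = ‖(Submodule.span ℝ {g}).starProjection (z - z')‖ ^ 2 +
        ‖p z - p z'‖ ^ 2 := by
      rw [← map_sub]
      exact Submodule.norm_sq_eq_add_norm_sq_starProjection (z - z') (Submodule.span ℝ {g})
    -- For two points of the surface the values of `f` cancel, so strict differentiability with
    -- tolerance `‖g‖ / 2` leaves a normal component of at most half their distance.
    have h3 : ‖(Submodule.span ℝ {g}).starProjection (z - z')‖ ≤ ‖z - z'‖ / 2 := by
      rw [Submodule.starProjection_singleton, norm_smul, norm_div]
      simp only [RCLike.ofReal_real_eq_id, id_eq, norm_pow, norm_norm]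
      rw [div_mul_eq_mul_div, div_le_iff₀ (by positivity)]
      nlinarith
    have h4 := norm_nonneg ((Submodule.span ℝ {g}).starProjection (z - z'))
    refine abs_le_of_sq_le_sq' ?_ (by positivity) |>.2
    nlinarith [norm_nonneg (z - z')]
  let q := Function.invFunOn p S
  have hinj : InjOn p S := by
    intro z hz z' hz' he
    have := hanti z hz z' hz'
    rw [he, sub_self, norm_zero, mul_zero] at this
    exact sub_eq_zero.1 (norm_eq_zero.1 (le_antisymm this (norm_nonneg _)))
  have hleft : LeftInvOn q p S := hinj.leftInvOn_invFunOn
  have hlip : LipschitzOnWith 2 q (p '' S) := by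
    refine LipschitzOnWith.of_dist_le_mul ?_
    rintro _ ⟨z, hz, rfl⟩ _ ⟨z', hz', rfl⟩
    rw [hleft hz, hleft hz', dist_eq_norm, dist_eq_norm]
    exact hanti z hz z' hz'
  have himg : q '' (p '' S) = S := hleft.image_image
  have hfin : μHE[d - 1] (p '' S) < ⊤ := by
    have hb : Bornology.IsBounded (p '' S) :=
      p.lipschitz.isBounded_image (Metric.isBounded_ball.subset fun z hz => hz.2.2)
    rw [← hfr]
    exact hb.measure_lt_top
  refine ⟨S, hSmem, ?_⟩
  rw [← himg]
  exact (hlip.euclideanHausdorffMeasure_image_le (d - 1)).trans_lt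
    (ENNReal.mul_lt_top (by simp) hfin)

end Hypersurface

/-! ### Normals, tangential projections and the pull-back of gradients -/

namespace EvolvingSurface

variable {d : ℕ} (M : EvolvingSurface d)

theorem flow_zero_image : M.Φ 0 '' M.Γ₀ = M.Γ₀ := by
  have : EqOn (M.Φ 0) id M.Γ₀ := fun y hy => M.Φ_zero y (M.Γ₀_subset_V hy)
  rw [this.image_eq, image_id]

theorem norm_normal_flow {y : EuclideanSpace ℝ (Fin d)} (hy : y ∈ M.Γ₀) {t : ℝ}
    (ht : t ∈ Icc 0 M.T) : ‖M.normal (M.Φ t y, t)‖ = 1 :=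
  M.norm_normal t ht _ (mem_image_of_mem _ hy)

theorem norm_normal_initial {y : EuclideanSpace ℝ (Fin d)} (hy : y ∈ M.Γ₀) :
    ‖M.normal (y, 0)‖ = 1 :=
  M.norm_normal 0 ⟨le_rfl, M.T_pos.le⟩ y (by rwa [M.flow_zero_image])

/-- The normal is known only through orthogonality to the tangent cone. The cone contains the
orthogonal complement of the gradient of a local equation, so the unit normal is a nonzero multiple
of that gradient and has the same orthogonal complement. -/
theorem mem_tangentConeAt_of_inner_normal {y : EuclideanSpace ℝ (Fin d)} (hy : y ∈ M.Γ₀)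
    {v : EuclideanSpace ℝ (Fin d)} (hv : inner ℝ (M.normal (y, 0)) v = 0) :
    v ∈ tangentConeAt ℝ M.Γ₀ y := by
  obtain ⟨U, f, hU, hf, hne, heq⟩ := M.isSmoothHypersurface_Γ₀.exists_local_equation hy
  have hcone : ∀ {z}, inner ℝ (gradient f y) z = 0 → z ∈ tangentConeAt ℝ M.Γ₀ y := fun hz =>
    mem_tangentConeAt_of_local_equation hU hy hf hne heq hz
  have hspan : M.normal (y, 0) ∈ Submodule.span ℝ {gradient f y} := by
    rw [← (Submodule.span ℝ {gradient f y}).orthogonal_orthogonal, Submodule.mem_orthogonal']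
    intro z hz
    rw [Submodule.mem_orthogonal_singleton_iff_inner_right] at hz
    refine M.inner_normal 0 ⟨le_rfl, M.T_pos.le⟩ y ?_ z ?_ <;> rw [M.flow_zero_image]
    · exact hy
    · exact hcone hz
  obtain ⟨c, hc⟩ := Submodule.mem_span_singleton.1 hspan
  refine hcone ?_
  rw [← hc, real_inner_smul_left, mul_eq_zero] at hv
  refine hv.resolve_left fun h0 => ?_
  have := M.norm_normal_initial hy
  rw [← hc, h0, zero_smul, norm_zero] at this
  exact zero_ne_one this

/-- The derivative of the flow maps tangent vectors to tangent vectors. -/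
theorem inner_normal_dΦ {y : EuclideanSpace ℝ (Fin d)} (hy : y ∈ M.Γ₀) {t : ℝ}
    (ht : t ∈ Ioo 0 M.T) {v : EuclideanSpace ℝ (Fin d)}
    (hv : inner ℝ (M.normal (y, 0)) v = 0) :
    inner ℝ (M.normal (M.Φ t y, t)) (M.dΦ (y, t) v) = 0 := by
  refine M.inner_normal t (Ioo_subset_Icc_self ht) _ (mem_image_of_mem _ hy) _ ?_
  exact (M.hasFDerivAt_flow_slice (M.Γ₀_subset_V hy) ht).hasFDerivWithinAt.mapsTo_tangent_cone
    (M.mem_tangentConeAt_of_inner_normal hy hv)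

theorem tangProj_apply (p : EuclideanSpace ℝ (Fin d) × ℝ) (v : EuclideanSpace ℝ (Fin d)) :
    M.tangProj p v = v - inner ℝ (M.normal p) v • M.normal p := rfl

theorem inner_normal_tangProj {p : EuclideanSpace ℝ (Fin d) × ℝ} (hp : ‖M.normal p‖ = 1)
    (v : EuclideanSpace ℝ (Fin d)) : inner ℝ (M.normal p) (M.tangProj p v) = 0 := by
  rw [tangProj_apply, inner_sub_right, real_inner_smul_right, real_inner_self_eq_norm_sq, hp]
  ring

theorem inner_tangProj_left (p : EuclideanSpace ℝ (Fin d) × ℝ) (v z : EuclideanSpace ℝ (Fin d)) :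
    inner ℝ (M.tangProj p v) z = inner ℝ v (M.tangProj p z) := by
  rw [tangProj_apply, tangProj_apply, inner_sub_left, inner_sub_right, real_inner_smul_left,
    real_inner_smul_right, real_inner_comm v]
  ring

theorem norm_tangProj_apply_le {p : EuclideanSpace ℝ (Fin d) × ℝ} (hp : ‖M.normal p‖ = 1)
    (v : EuclideanSpace ℝ (Fin d)) : ‖M.tangProj p v‖ ≤ ‖v‖ := by
  have h1 : ‖M.tangProj p v‖ ^ 2 ≤ ‖v‖ * ‖M.tangProj p v‖ := by
    have h2 : ‖M.tangProj p v‖ ^ 2 = inner ℝ v (M.tangProj p v) := by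
      rw [← real_inner_self_eq_norm_sq]
      conv_lhs => rw [tangProj_apply M p v, inner_sub_left, ← tangProj_apply M p v,
        real_inner_smul_left, M.inner_normal_tangProj hp]
      ring
    rw [h2]
    exact real_inner_le_norm _ _
  by_contra h
  have h0 := norm_nonneg v
  nlinarith

/-- The operator by which the tangential gradient on `Γ(t)` is pulled back to `Γ₀`. -/
noncomputable def pullGrad (q : EuclideanSpace ℝ (Fin d) × ℝ) :
    EuclideanSpace ℝ (Fin d) →L[ℝ] EuclideanSpace ℝ (Fin d) :=
  M.tangProj (q.1, 0) ∘L ContinuousLinearMap.adjoint (M.dΦ q)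

theorem norm_pullGrad_apply_le {y : EuclideanSpace ℝ (Fin d)} (hy : y ∈ M.Γ₀) {t : ℝ}
    (ht : t ∈ Ioo 0 M.T) (v : EuclideanSpace ℝ (Fin d)) :
    ‖M.pullGrad (y, t) v‖ ≤ M.distortion * ‖v‖ := by
  refine (M.norm_tangProj_apply_le (M.norm_normal_initial hy) _).trans ?_
  refine ContinuousLinearMap.le_of_opNorm_le _ ?_ v
  rw [LinearIsometryEquiv.norm_map]
  exact ContinuousLinearMap.opNorm_le_bound _ M.distortion_pos.le
    (M.norm_dΦ_apply_le (M.Γ₀_subset_interior_collar hy) ht)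

/-- The derivative of the flow maps tangent vectors to tangent vectors, hence its adjoint maps
normals to normals, which the projection at the initial point kills. -/
theorem pullGrad_normal {y : EuclideanSpace ℝ (Fin d)} (hy : y ∈ M.Γ₀) {t : ℝ}
    (ht : t ∈ Ioo 0 M.T) : M.pullGrad (y, t) (M.normal (M.Φ t y, t)) = 0 := by
  set w := ContinuousLinearMap.adjoint (M.dΦ (y, t)) (M.normal (M.Φ t y, t)) with hw
  have h1 := M.norm_normal_initial hy
  have h2 : inner ℝ w (M.tangProj (y, 0) w) = 0 := by
    rw [hw, ContinuousLinearMap.adjoint_inner_left]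
    exact M.inner_normal_dΦ hy ht (M.inner_normal_tangProj h1 _)
  have h3 : inner ℝ (M.tangProj (y, 0) w) (M.tangProj (y, 0) w) = (0 : ℝ) := by
    conv_lhs => rw [tangProj_apply M _ w, inner_sub_left, ← tangProj_apply M _ w,
      real_inner_smul_left, M.inner_normal_tangProj h1, h2]
    ring
  exact inner_self_eq_zero.1 h3

theorem pullGrad_tangProj {y : EuclideanSpace ℝ (Fin d)} (hy : y ∈ M.Γ₀) {t : ℝ}
    (ht : t ∈ Ioo 0 M.T) (v : EuclideanSpace ℝ (Fin d)) :
    M.pullGrad (y, t) (M.tangProj (M.Φ t y, t) v) = M.pullGrad (y, t) v := by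
  rw [tangProj_apply, map_sub, map_smul, M.pullGrad_normal hy ht, smul_zero, sub_zero]

/-- Write `v = dΦ h`. As the adjoint of `dΦ` maps the normal to a nonzero normal, `h` is tangential,
so `‖v‖²` is the inner product of `pullGrad v` with `h`, and `‖h‖` is at most the distortion times
`‖v‖`. -/
theorem norm_le_norm_pullGrad_apply {y : EuclideanSpace ℝ (Fin d)} (hy : y ∈ M.Γ₀) {t : ℝ}
    (ht : t ∈ Ioo 0 M.T) {v : EuclideanSpace ℝ (Fin d)}
    (hv : inner ℝ (M.normal (M.Φ t y, t)) v = 0) :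
    ‖v‖ ≤ M.distortion * ‖M.pullGrad (y, t) v‖ := by
  have hyc := M.Γ₀_subset_interior_collar hy
  have hn := M.norm_normal_flow hy (Ioo_subset_Icc_self ht)
  have hsurj : Function.Surjective (M.dΦ (y, t)) :=
    LinearMap.injective_iff_surjective (f := (M.dΦ (y, t)).toLinearMap).1 (M.injective_dΦ hyc ht)
  obtain ⟨h, rfl⟩ := hsurj v
  obtain ⟨m, hm⟩ := hsurj (M.normal (M.Φ t y, t))
  set w := ContinuousLinearMap.adjoint (M.dΦ (y, t)) (M.normal (M.Φ t y, t)) with hw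
  have hw0 : M.tangProj (y, 0) w = 0 := M.pullGrad_normal hy ht
  rw [tangProj_apply, sub_eq_zero] at hw0
  have hne : inner ℝ (M.normal (y, 0)) w ≠ 0 := by
    intro h0
    rw [h0, zero_smul] at hw0
    have : inner ℝ w m = (1 : ℝ) := by
      -- Here `m` is a preimage of the unit normal under `dΦ`; pairing with it shows that the
      -- adjoint image of the normal does not vanish.
      rw [hw, ContinuousLinearMap.adjoint_inner_left, hm, real_inner_self_eq_norm_sq, hn, one_pow]
    rw [hw0, inner_zero_left] at this
    exact zero_ne_one this
  have hh : inner ℝ (M.normal (y, 0)) h = 0 := by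
    rw [← ContinuousLinearMap.adjoint_inner_left, ← hw, hw0, real_inner_smul_left] at hv
    exact (mul_eq_zero.1 hv).resolve_left hne
  have hP : M.tangProj (y, 0) h = h := by rw [tangProj_apply, hh, zero_smul, sub_zero]
  have h1 : ‖M.dΦ (y, t) h‖ ^ 2 =
      inner ℝ (M.pullGrad (y, t) (M.dΦ (y, t) h)) h := by
    rw [pullGrad, ContinuousLinearMap.comp_apply, inner_tangProj_left, hP,
      ContinuousLinearMap.adjoint_inner_left, real_inner_self_eq_norm_sq]
  have h2 := real_inner_le_norm (M.pullGrad (y, t) (M.dΦ (y, t) h)) h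
  have h3 := M.le_norm_dΦ_apply hyc ht h
  by_contra hcon
  have h4 := norm_nonneg (M.pullGrad (y, t) (M.dΦ (y, t) h))
  have h5 := norm_nonneg (M.dΦ (y, t) h)
  have h6 := M.distortion_pos
  rw [not_le] at hcon
  have h7 := mul_lt_mul_of_pos_right hcon ((mul_nonneg h6.le h4).trans_lt hcon)
  have h8 := mul_le_mul_of_nonneg_left h3 h4
  nlinarith

/-- The pulled back tangential gradient is the tangential gradient of the pulled back function. -/
theorem pullGrad_tangProj_gradient {y : EuclideanSpace ℝ (Fin d)} (hy : y ∈ M.Γ₀) {t : ℝ}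
    (ht : t ∈ Ioo 0 M.T) {φ : EuclideanSpace ℝ (Fin d) → ℝ}
    (hφ : DifferentiableAt ℝ φ (M.Φ t y)) :
    M.pullGrad (y, t) (M.tangProj (M.Φ t y, t) (gradient φ (M.Φ t y))) =
      M.tangProj (y, 0) (gradient (fun z => φ (M.Φ t z)) y) := by
  rw [M.pullGrad_tangProj hy ht, pullGrad, ContinuousLinearMap.comp_apply]
  congr 1
  refine ext_inner_right ℝ fun v => ?_
  have h1 : HasFDerivAt (fun z => φ (M.Φ t z)) ((fderiv ℝ φ (M.Φ t y)).comp (M.dΦ (y, t))) y :=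
    hφ.hasFDerivAt.comp y (M.hasFDerivAt_flow_slice (M.Γ₀_subset_V hy) ht)
  rw [inner_gradient_left, h1.fderiv, ContinuousLinearMap.adjoint_inner_left, inner_gradient_left]
  rfl

end EvolvingSurface

/-! ### Surface measures pulled back to the initial surface -/

theorem Real.abs_sub_le_of_le_exp_mul {p q x X m : ℝ} (h1 : p ≤ Real.exp x * q)
    (h2 : q ≤ Real.exp x * p) (hx : 0 ≤ x) (hX : x ≤ X) (hp0 : 0 ≤ p) (hq0 : 0 ≤ q)
    (hp : p ≤ m) (hq : q ≤ m) : |p - q| ≤ Real.exp X * m * x := by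
  have he : Real.exp x - 1 ≤ x * Real.exp X := by
    have h3 := Real.add_one_le_exp (-x)
    have h4 := mul_le_mul_of_nonneg_right h3 (Real.exp_pos x).le
    rw [← Real.exp_add, neg_add_cancel, Real.exp_zero] at h4
    have h5 := Real.exp_le_exp.2 hX
    nlinarith
  have h0 : 0 ≤ x * Real.exp X := mul_nonneg hx (Real.exp_pos X).le
  rw [abs_le]
  constructor
  · nlinarith [mul_le_mul_of_nonneg_right he hp0, mul_le_mul_of_nonneg_left hp h0]
  · nlinarith [mul_le_mul_of_nonneg_right he hq0, mul_le_mul_of_nonneg_left hq h0]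

namespace EvolvingSurface

variable {d : ℕ} (M : EvolvingSurface d)

/-- The surface measure of the initial surface. -/
noncomputable def refMeasure : Measure (EuclideanSpace ℝ (Fin d)) := μHE[d - 1].restrict M.Γ₀

instance : IsFiniteMeasure M.refMeasure :=
  ⟨by
    rw [refMeasure, Measure.restrict_apply_univ]
    exact M.isSmoothHypersurface_Γ₀.measure_lt_top M.isCompact_Γ₀⟩

theorem ae_mem_Γ₀ : ∀ᵐ y ∂M.refMeasure, y ∈ M.Γ₀ :=
  ae_restrict_mem M.isCompact_Γ₀.measurableSet

/-- The time `t`, brought to the interval `[0, T]`. -/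
noncomputable def clamp (t : ℝ) : ℝ := max 0 (min t M.T)

theorem clamp_mem (t : ℝ) : M.clamp t ∈ Icc 0 M.T :=
  ⟨le_max_left _ _, max_le M.T_pos.le (min_le_right _ _)⟩

theorem clamp_of_mem {t : ℝ} (ht : t ∈ Icc 0 M.T) : M.clamp t = t := by
  rw [clamp, min_eq_left ht.2, max_eq_right ht.1]

/-- `IsMassFamily` asks for Lipschitz bounds at all real times; clamping extends the family from
`[0,T]` without increasing Lipschitz constants. -/
theorem abs_clamp_sub_le (s t : ℝ) : |M.clamp s - M.clamp t| ≤ |s - t| := by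
  unfold clamp
  rw [max_comm 0, max_comm 0]
  exact (abs_max_sub_max_le_abs _ _ _).trans (abs_min_sub_min_le_max s M.T t M.T |>.trans (by simp))

theorem isCompact_Γ {t : ℝ} (ht : t ∈ Icc 0 M.T) : IsCompact (M.Γ t) := by
  refine M.isCompact_Γ₀.image_of_continuousOn ?_
  exact M.continuousOn_flow.comp (f := fun y => (y, t)) (by fun_prop)
    fun y hy => ⟨M.Γ₀_subset_V hy, ht⟩

/-- The passage from `Γ(t)` to `Γ(s)` along the flow. -/
theorem lipschitzOnWith_flow_back {s t : ℝ} (hs : s ∈ Icc 0 M.T) (ht : t ∈ Icc 0 M.T) :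
    LipschitzOnWith (Real.exp (M.rate * |t - s|)).toNNReal (fun x => M.Φ s (M.back (x, t)))
      (M.Γ t) := by
  refine LipschitzOnWith.of_dist_le_mul ?_
  rintro _ ⟨y, hy, rfl⟩ _ ⟨z, hz, rfl⟩
  have hy' := M.Γ₀_subset_collar hy
  have hz' := M.Γ₀_subset_collar hz
  rw [M.back_flow hy' ht, M.back_flow hz' ht, dist_eq_norm, dist_eq_norm,
    Real.coe_toNNReal _ (Real.exp_pos _).le]
  exact M.norm_flow_sub_le hy' hz' ht hs

theorem continuousOn_back {t : ℝ} (ht : t ∈ Icc 0 M.T) :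
    ContinuousOn (fun x => M.back (x, t)) (M.Γ t) := by
  have h0 : (0 : ℝ) ∈ Icc 0 M.T := ⟨le_rfl, M.T_pos.le⟩
  refine (M.lipschitzOnWith_flow_back h0 ht).continuousOn.congr ?_
  rintro _ ⟨y, hy, rfl⟩
  have hy' := M.Γ₀_subset_collar hy
  simp only [M.back_flow hy' ht]
  rw [M.Φ_zero y (M.collar_subset_V hy')]

theorem aemeasurable_back {t : ℝ} (ht : t ∈ Icc 0 M.T) :
    AEMeasurable (fun x => M.back (x, t)) (M.surfaceMeasure t) :=
  (M.continuousOn_back ht).aemeasurable (M.isCompact_Γ ht).measurableSet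

/-- The surface measure of `Γ(t)`, pulled back to the initial surface. -/
noncomputable def pulled (t : ℝ) : Measure (EuclideanSpace ℝ (Fin d)) :=
  (M.surfaceMeasure (M.clamp t)).map fun x => M.back (x, M.clamp t)

theorem pulled_of_mem {t : ℝ} (ht : t ∈ Icc 0 M.T) :
    M.pulled t = (M.surfaceMeasure t).map fun x => M.back (x, t) := by
  rw [pulled, M.clamp_of_mem ht]

theorem pulled_apply {t : ℝ} {B : Set (EuclideanSpace ℝ (Fin d))} (hB : MeasurableSet B) :
    M.pulled t B = μHE[d - 1] (M.Φ (M.clamp t) '' (M.Γ₀ ∩ B)) := by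
  have ht := M.clamp_mem t
  rw [pulled, Measure.map_apply_of_aemeasurable (M.aemeasurable_back ht) hB, surfaceMeasure,
    Measure.restrict_apply' (M.isCompact_Γ ht).measurableSet]
  congr 1
  ext x
  constructor
  · rintro ⟨hx, y, hy, rfl⟩
    rw [mem_preimage, M.back_flow (M.Γ₀_subset_collar hy) ht] at hx
    exact ⟨y, ⟨hy, hx⟩, rfl⟩
  · rintro ⟨y, ⟨hy, hyB⟩, rfl⟩
    refine ⟨?_, y, hy, rfl⟩
    rwa [mem_preimage, M.back_flow (M.Γ₀_subset_collar hy) ht]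

theorem pulled_zero : M.pulled 0 = M.refMeasure := by
  ext B hB
  rw [M.pulled_apply hB, M.clamp_of_mem ⟨le_rfl, M.T_pos.le⟩, refMeasure,
    Measure.restrict_apply hB, inter_comm]
  have : EqOn (M.Φ 0) id (B ∩ M.Γ₀) := fun y hy => M.Φ_zero y (M.Γ₀_subset_V hy.2)
  rw [this.image_eq, image_id]

/-- The rate at which the surface measure may change. -/
noncomputable def massRate : ℝ := (d - 1 : ℕ) * M.rate

theorem massRate_nonneg : 0 ≤ M.massRate := mul_nonneg (Nat.cast_nonneg _) M.rate_nonneg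

/-- The passage from `Γ(t)` to `Γ(s)` along trajectories is Lipschitz with constant `exp(rate
|t-s|)`, and `(d-1)`-dimensional Hausdorff measure grows at most by the power `d-1` of it. Used in
both directions, this replaces a formula for the Jacobian. -/
theorem pulled_le_smul (s t : ℝ) :
    M.pulled s ≤ ENNReal.ofReal (Real.exp (M.massRate * |M.clamp s - M.clamp t|)) •
      M.pulled t := by
  refine Measure.le_iff.2 fun B hB => ?_
  have hs := M.clamp_mem s
  have ht := M.clamp_mem t
  rw [Measure.smul_apply, M.pulled_apply hB, M.pulled_apply hB, smul_eq_mul]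
  have h1 := ((M.lipschitzOnWith_flow_back hs ht).mono
    (image_mono (f := M.Φ (M.clamp t)) (inter_subset_left (s := M.Γ₀) (t := B)))
    ).euclideanHausdorffMeasure_image_le (d - 1)
  rw [image_image] at h1
  have h2 : (fun y => M.Φ (M.clamp s) (M.back (M.Φ (M.clamp t) y, M.clamp t))) '' (M.Γ₀ ∩ B) =
      M.Φ (M.clamp s) '' (M.Γ₀ ∩ B) :=
    image_congr fun y hy => by rw [M.back_flow (M.Γ₀_subset_collar hy.1) ht]
  rw [h2] at h1
  refine h1.trans (le_of_eq ?_)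
  congr 1
  rw [← ENNReal.coe_pow, ENNReal.ofReal, ENNReal.coe_inj, ← Real.toNNReal_pow (Real.exp_pos _).le,
    ← Real.exp_nat_mul, massRate, abs_sub_comm]
  congr 2
  ring

/-- Bound for the density of the surface measures relative to each other. -/
noncomputable def massBound : ℝ := Real.exp (M.massRate * M.T)

theorem massBound_pos : 0 < M.massBound := Real.exp_pos _

theorem massRate_mul_abs_clamp_sub_le (s t : ℝ) :
    M.massRate * |M.clamp s - M.clamp t| ≤ M.massRate * M.T := by
  refine mul_le_mul_of_nonneg_left ?_ M.massRate_nonneg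
  have hs := M.clamp_mem s
  have ht := M.clamp_mem t
  rw [abs_le]
  exact ⟨by linarith [hs.1, ht.2], by linarith [hs.2, ht.1]⟩

theorem pulled_le_refMeasure (t : ℝ) :
    M.pulled t ≤ ENNReal.ofReal M.massBound • M.refMeasure := by
  rw [← M.pulled_zero]
  refine (M.pulled_le_smul t 0).trans (Measure.le_iff.2 fun B _ => ?_)
  simp only [Measure.smul_apply, smul_eq_mul]
  gcongr
  exact Real.exp_le_exp.2 (M.massRate_mul_abs_clamp_sub_le t 0)

theorem refMeasure_le_pulled (t : ℝ) :
    M.refMeasure ≤ ENNReal.ofReal M.massBound • M.pulled t := by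
  conv_lhs => rw [← M.pulled_zero]
  refine (M.pulled_le_smul 0 t).trans (Measure.le_iff.2 fun B _ => ?_)
  simp only [Measure.smul_apply, smul_eq_mul]
  gcongr
  exact Real.exp_le_exp.2 (M.massRate_mul_abs_clamp_sub_le 0 t)

instance (t : ℝ) : IsFiniteMeasure (M.pulled t) :=
  ⟨(M.pulled_le_refMeasure t univ).trans_lt
    (ENNReal.mul_lt_top ENNReal.ofReal_lt_top (measure_lt_top _ _))⟩

theorem pulled_absolutelyContinuous (t : ℝ) : M.pulled t ≪ M.refMeasure :=
  (Measure.absolutelyContinuous_of_le (M.pulled_le_refMeasure t)).trans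
    Measure.smul_absolutelyContinuous

theorem refMeasure_absolutelyContinuous (t : ℝ) : M.refMeasure ≪ M.pulled t :=
  (Measure.absolutelyContinuous_of_le (M.refMeasure_le_pulled t)).trans
    Measure.smul_absolutelyContinuous

theorem surfaceMeasure_eq_map {t : ℝ} (ht : t ∈ Icc 0 M.T) :
    M.surfaceMeasure t = (M.pulled t).map (M.Φ t) := by
  have hc : ContinuousOn (M.Φ t) M.Γ₀ :=
    M.continuousOn_flow.comp (f := fun y => (y, t)) (by fun_prop)
      fun y hy => ⟨M.Γ₀_subset_V hy, ht⟩
  have hm : AEMeasurable (M.Φ t) (M.pulled t) :=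
    (hc.aemeasurable M.isCompact_Γ₀.measurableSet).mono_ac (M.pulled_absolutelyContinuous t)
  rw [M.pulled_of_mem ht] at hm ⊢
  rw [AEMeasurable.map_map_of_aemeasurable hm (M.aemeasurable_back ht)]
  have h1 : (M.Φ t ∘ fun x => M.back (x, t)) =ᵐ[M.surfaceMeasure t] id := by
    filter_upwards [ae_restrict_mem (M.isCompact_Γ ht).measurableSet]
    rintro _ ⟨y, hy, rfl⟩
    simp [M.back_flow (M.Γ₀_subset_collar hy) ht]
  rw [Measure.map_congr h1, Measure.map_id]

theorem aemeasurable_flow {t : ℝ} (ht : t ∈ Icc 0 M.T) : AEMeasurable (M.Φ t) M.refMeasure :=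
  (M.continuousOn_flow.comp (f := fun y => (y, t)) (by fun_prop)
      fun _ hy => ⟨M.Γ₀_subset_V hy, ht⟩).aemeasurable M.isCompact_Γ₀.measurableSet

/-- The two-sided exponential comparison makes the measure of each fixed set Lipschitz in time;
measurability is needed for the pulled back measures to form a kernel. -/
theorem measurable_pulled : Measurable M.pulled := by
  refine Measure.measurable_of_measurable_coe _ fun B hB => ?_
  set m := M.massBound * (M.refMeasure univ).toReal with hm
  have hle : ∀ t, (M.pulled t B).toReal ≤ m := fun t => by
    have h1 : M.pulled t B ≤ ENNReal.ofReal M.massBound * M.refMeasure univ :=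
      (measure_mono (subset_univ B)).trans (M.pulled_le_refMeasure t univ)
    have h2 := ENNReal.toReal_mono
      (ENNReal.mul_lt_top ENNReal.ofReal_lt_top (measure_lt_top _ _)).ne h1
    rwa [ENNReal.toReal_mul, ENNReal.toReal_ofReal M.massBound_pos.le] at h2
  have hst : ∀ s t, (M.pulled s B).toReal ≤
      Real.exp (M.massRate * |M.clamp s - M.clamp t|) * (M.pulled t B).toReal := fun s t => by
    have h2 := ENNReal.toReal_mono
      (ENNReal.mul_lt_top ENNReal.ofReal_lt_top (measure_lt_top _ _)).ne (M.pulled_le_smul s t B)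
    rwa [ENNReal.toReal_mul, ENNReal.toReal_ofReal (Real.exp_pos _).le] at h2
  have hlip : LipschitzWith (M.massBound * m * M.massRate).toNNReal
      fun t => (M.pulled t B).toReal := by
    refine LipschitzWith.of_dist_le_mul fun s t => ?_
    have hm0 : 0 ≤ m := ENNReal.toReal_nonneg.trans (hle s)
    rw [Real.coe_toNNReal _ (by have := M.massBound_pos; have := M.massRate_nonneg; positivity),
      Real.dist_eq, Real.dist_eq]
    refine (Real.abs_sub_le_of_le_exp_mul (hst s t) ?_
      (mul_nonneg M.massRate_nonneg (abs_nonneg _)) (M.massRate_mul_abs_clamp_sub_le s t)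
      ENNReal.toReal_nonneg ENNReal.toReal_nonneg (hle s) (hle t)).trans ?_
    · rw [abs_sub_comm]
      exact hst t s
    · rw [mul_assoc (M.massBound * m)]
      exact mul_le_mul_of_nonneg_left (mul_le_mul_of_nonneg_left (M.abs_clamp_sub_le s t)
        M.massRate_nonneg) (mul_nonneg M.massBound_pos.le hm0)
  have : (fun t => M.pulled t B) = fun t => ENNReal.ofReal (M.pulled t B).toReal := by
    ext t
    rw [ENNReal.ofReal_toReal (measure_ne_top _ _)]
  rw [this]
  exact hlip.continuous.measurable.ennreal_ofReal

/-- The pulled back surface measures as a kernel. -/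
noncomputable def massKernel : ProbabilityTheory.Kernel ℝ (EuclideanSpace ℝ (Fin d)) :=
  ⟨M.pulled, M.measurable_pulled⟩

instance : ProbabilityTheory.IsFiniteKernel M.massKernel :=
  ⟨⟨ENNReal.ofReal M.massBound * M.refMeasure univ,
    ENNReal.mul_lt_top ENNReal.ofReal_lt_top (measure_lt_top _ _),
    fun t => M.pulled_le_refMeasure t univ⟩⟩

/-- Lebesgue measure on the time interval. -/
noncomputable def timeMeasure : Measure ℝ := volume.restrict (Ioo 0 M.T)

instance : IsFiniteMeasure M.timeMeasure := by unfold timeMeasure; infer_instance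

/-- The trajectories of the flow, from times and initial points to space-time points. -/
noncomputable def traj (q : ℝ × EuclideanSpace ℝ (Fin d)) : EuclideanSpace ℝ (Fin d) × ℝ :=
  ((Icc 0 M.T ×ˢ M.Γ₀).indicator (fun q => M.Φ q.1 q.2) q, q.1)

theorem traj_of_mem {t : ℝ} (ht : t ∈ Icc 0 M.T) {y : EuclideanSpace ℝ (Fin d)} (hy : y ∈ M.Γ₀) :
    M.traj (t, y) = (M.Φ t y, t) := by
  rw [traj, indicator_of_mem (show (t, y) ∈ Icc 0 M.T ×ˢ M.Γ₀ from ⟨ht, hy⟩)]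

open scoped Classical in
theorem measurable_traj : Measurable M.traj := by
  refine Measurable.prodMk ?_ measurable_fst
  have h : ContinuousOn (fun q : ℝ × EuclideanSpace ℝ (Fin d) => M.Φ q.1 q.2)
      (Icc 0 M.T ×ˢ M.Γ₀) :=
    M.continuousOn_flow.comp (f := fun q : ℝ × EuclideanSpace ℝ (Fin d) => (q.2, q.1))
      (by fun_prop) fun q hq => ⟨M.Γ₀_subset_V hq.2, hq.1⟩
  rw [← piecewise_eq_indicator]
  exact h.measurable_piecewise continuousOn_const
    (measurableSet_Icc.prod M.isCompact_Γ₀.measurableSet)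

/-- The space-time surface measure, pulled back along the trajectories. -/
noncomputable def massMeasure : Measure (ℝ × EuclideanSpace ℝ (Fin d)) :=
  M.timeMeasure.compProd M.massKernel

instance : IsFiniteMeasure M.massMeasure := by unfold massMeasure; infer_instance

theorem massMeasure_apply {A : Set (ℝ × EuclideanSpace ℝ (Fin d))} (hA : MeasurableSet A) :
    M.massMeasure A = ∫⁻ t, M.pulled t (Prod.mk t ⁻¹' A) ∂M.timeMeasure :=
  Measure.compProd_apply hA

open ProbabilityTheory in
-- On the time interval the family in the definition of `stMeasure` agrees with the image of a
-- genuine kernel under the trajectories, and this image is measurable in `t`. Fubini arguments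
-- become available in this form.
theorem stMeasure_eq_map : M.stMeasure = M.massMeasure.map M.traj := by
  have hker : ∀ t ∈ Icc 0 M.T, (M.surfaceMeasure t).map (fun x => (x, t)) =
      (M.massKernel t).map fun y => M.traj (t, y) := by
    intro t ht
    change _ = (M.pulled t).map _
    rw [M.surfaceMeasure_eq_map ht, AEMeasurable.map_map_of_aemeasurable (by fun_prop)
      ((M.aemeasurable_flow ht).mono_ac (M.pulled_absolutelyContinuous t))]
    refine Measure.map_congr ?_
    filter_upwards [(M.pulled_absolutelyContinuous t).ae_le M.ae_mem_Γ₀] with y hy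
    rw [M.traj_of_mem ht hy]
    rfl
  have hmeas : Measurable fun t => (M.massKernel t).map fun y => M.traj (t, y) := by
    refine Measure.measurable_of_measurable_coe _ fun A hA => ?_
    have : (fun t => ((M.massKernel t).map fun y => M.traj (t, y)) A) =
        fun t => M.massKernel t (Prod.mk t ⁻¹' (M.traj ⁻¹' A)) := by
      ext t
      rw [Measure.map_apply (f := fun y => M.traj (t, y))
        (M.measurable_traj.comp measurable_prodMk_left) hA]
      rfl
    rw [this]
    exact Kernel.measurable_kernel_prodMk_left (M.measurable_traj hA)
  have hbind : M.stMeasure = M.timeMeasure.bind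
      fun t => (M.massKernel t).map fun y => M.traj (t, y) := by
    unfold stMeasure timeMeasure
    refine Measure.bind_congr_right ?_
    filter_upwards [ae_restrict_mem measurableSet_Ioo] with t ht
    exact hker t (Ioo_subset_Icc_self ht)
  ext A hA
  rw [hbind, Measure.bind_apply hA hmeas.aemeasurable, Measure.map_apply M.measurable_traj hA,
    M.massMeasure_apply (M.measurable_traj hA)]
  refine lintegral_congr fun t => ?_
  rw [Measure.map_apply (f := fun y => M.traj (t, y))
        (M.measurable_traj.comp measurable_prodMk_left) hA]
  rfl

theorem massMeasure_le : M.massMeasure ≤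
    ENNReal.ofReal M.massBound • M.timeMeasure.prod M.refMeasure := by
  refine Measure.le_iff.2 fun A hA => ?_
  rw [M.massMeasure_apply hA, Measure.smul_apply, Measure.prod_apply hA, smul_eq_mul,
    ← lintegral_const_mul _ (measurable_measure_prodMk_left hA)]
  exact lintegral_mono fun t => M.pulled_le_refMeasure t _

theorem prod_le_massMeasure : M.timeMeasure.prod M.refMeasure ≤
    ENNReal.ofReal M.massBound • M.massMeasure := by
  refine Measure.le_iff.2 fun A hA => ?_
  rw [Measure.prod_apply hA, Measure.smul_apply, M.massMeasure_apply hA, smul_eq_mul,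
    ← lintegral_const_mul' _ _ ENNReal.ofReal_ne_top]
  exact lintegral_mono fun t => M.refMeasure_le_pulled t _

theorem prod_absolutelyContinuous_massMeasure :
    M.timeMeasure.prod M.refMeasure ≪ M.massMeasure :=
  (Measure.absolutelyContinuous_of_le M.prod_le_massMeasure).trans Measure.smul_absolutelyContinuous

theorem massMeasure_absolutelyContinuous_prod :
    M.massMeasure ≪ M.timeMeasure.prod M.refMeasure :=
  (Measure.absolutelyContinuous_of_le M.massMeasure_le).trans Measure.smul_absolutelyContinuous

/-- Almost everywhere statements on the space-time surface hold along trajectories for the plain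
product measure, the measure used for slicing in time. -/
theorem quasiMeasurePreserving_traj :
    Measure.QuasiMeasurePreserving M.traj (M.timeMeasure.prod M.refMeasure) M.stMeasure := by
  refine ⟨M.measurable_traj, ?_⟩
  rw [M.stMeasure_eq_map]
  exact M.prod_absolutelyContinuous_massMeasure.map M.measurable_traj

theorem measurePreserving_traj :
    MeasurePreserving M.traj M.massMeasure M.stMeasure :=
  ⟨M.measurable_traj, M.stMeasure_eq_map.symm⟩

instance : IsFiniteMeasure M.stMeasure := by
  rw [M.stMeasure_eq_map]
  infer_instance

/-- Almost every pair of a time and an initial point is what it should be. -/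
theorem ae_mem_domain : ∀ᵐ q ∂M.timeMeasure.prod M.refMeasure, q.1 ∈ Ioo 0 M.T ∧ q.2 ∈ M.Γ₀ := by
  have h1 : ∀ᵐ t ∂M.timeMeasure, t ∈ Ioo 0 M.T := ae_restrict_mem measurableSet_Ioo
  filter_upwards [Measure.quasiMeasurePreserving_fst.ae h1,
    Measure.quasiMeasurePreserving_snd.ae M.ae_mem_Γ₀] with q h1 h2
  exact ⟨h1, h2⟩

end EvolvingSurface

/-! ### Square integrable functions on a product as `L²`-valued functions -/

section Slices

/-- By second countability every open set is a countable union of balls, whose preimages are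
sublevel sets of the distances. -/
theorem AEMeasurable.of_dist_const {α X : Type*} {m : MeasurableSpace α} {μ : Measure α}
    [PseudoMetricSpace X] [SecondCountableTopology X] [MeasurableSpace X] [BorelSpace X]
    {f : α → X} (h : ∀ c : X, AEMeasurable (fun t => Dist.dist (f t) c) μ) : AEMeasurable f μ := by
  have key : ∀ U : Set X, IsOpen U → NullMeasurableSet (f ⁻¹' U) μ := fun U hU => ?_
  · exact NullMeasurable.aemeasurable
      (@measurable_of_isOpen X (NullMeasurableSpace α μ) _ _ _ _ f key)
  choose! r hr hsub using Metric.isOpen_iff.1 hU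
  obtain ⟨S, hSU, hS, hcover⟩ := TopologicalSpace.isOpen_biUnion_countable U
    (fun x => Metric.ball x (r x)) fun x _ => Metric.isOpen_ball
  have hUeq : U = ⋃ x ∈ S, Metric.ball x (r x) := by
    rw [hcover]
    refine Subset.antisymm (fun x hx => mem_biUnion hx (Metric.mem_ball_self (hr x hx))) ?_
    exact iUnion₂_subset hsub
  rw [hUeq, preimage_iUnion₂]
  refine NullMeasurableSet.biUnion hS fun x _ => ?_
  exact (h x).nullMeasurable measurableSet_Iio

theorem MeasureTheory.Lp.norm_sq_eq_integral {α F : Type*} {m : MeasurableSpace α} {μ : Measure α}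
    [NormedAddCommGroup F] (f : Lp F 2 μ) : ‖f‖ ^ 2 = ∫ x, ‖f x‖ ^ 2 ∂μ := by
  have h1 := (Lp.memLp f).eLpNorm_eq_integral_rpow_norm two_ne_zero ENNReal.ofNat_ne_top
  rw [Lp.norm_def, h1, ENNReal.toReal_ofReal (by positivity)]
  simp only [ENNReal.toReal_ofNat, Real.rpow_two]
  have h2 : 0 ≤ ∫ x, ‖f x‖ ^ 2 ∂μ := integral_nonneg fun x => by positivity
  rw [← Real.rpow_natCast, ← Real.rpow_mul h2]
  norm_num

variable {α β F : Type*} [MeasurableSpace β] {ν : Measure β}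
  [NormedAddCommGroup F]

open scoped Classical in
/-- The slices of a function on a product as elements of `L²`. -/
noncomputable def lpSlice (ν : Measure β) (g : α × β → F) (t : α) : Lp F 2 ν :=
  if h : MemLp (fun y => g (t, y)) 2 ν then h.toLp else 0

theorem coeFn_lpSlice {g : α × β → F} {t : α} (h : MemLp (fun y => g (t, y)) 2 ν) :
    lpSlice ν g t =ᵐ[ν] fun y => g (t, y) := by
  rw [lpSlice, dif_pos h]
  exact h.coeFn_toLp

theorem lpSlice_congr {g g' : α × β → F} {t : α} (h : ∀ᵐ y ∂ν, g (t, y) = g' (t, y)) :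
    lpSlice ν g t = lpSlice ν g' t := by
  unfold lpSlice
  by_cases h1 : MemLp (fun y => g (t, y)) 2 ν
  · rw [dif_pos h1, dif_pos ((memLp_congr_ae h).1 h1)]
    exact (MemLp.toLp_eq_toLp_iff _ _).2 h
  · rw [dif_neg h1, dif_neg fun h2 => h1 ((memLp_congr_ae h).2 h2)]

variable [MeasurableSpace α] {μ : Measure α} [SFinite ν] [SFinite μ]

theorem MeasureTheory.MemLp.ae_memLp_slice {g : α × β → F} (hg : MemLp g 2 (μ.prod ν)) :
    ∀ᵐ t ∂μ, MemLp (fun y => g (t, y)) 2 ν := by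
  have h1 := ((memLp_two_iff_integrable_sq_norm hg.1).1 hg).prod_right_ae
  filter_upwards [hg.1.prodMk_left, h1] with t ht1 ht2
  exact (memLp_two_iff_integrable_sq_norm ht1).2 ht2

theorem MeasureTheory.MemLp.ae_coeFn_lpSlice {g : α × β → F} (hg : MemLp g 2 (μ.prod ν)) :
    ∀ᵐ t ∂μ, ∀ᵐ y ∂ν, lpSlice ν g t y = g (t, y) := by
  filter_upwards [hg.ae_memLp_slice] with t ht using coeFn_lpSlice ht

/-- The distance of the slice to a fixed element is the root of a parameter integral, hence
measurable by Fubini; separability of `L²` turns this into strong measurability. -/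
theorem MeasureTheory.MemLp.aestronglyMeasurable_lpSlice {g : α × β → F}
    [SecondCountableTopology (Lp F 2 ν)]
    (hg : MemLp g 2 (μ.prod ν)) : AEStronglyMeasurable (lpSlice ν g) μ := by
  borelize ↥(Lp F 2 ν)
  refine AEMeasurable.aestronglyMeasurable (AEMeasurable.of_dist_const fun c => ?_)
  have h1 : AEStronglyMeasurable (fun q : α × β => ‖g q - c q.2‖ ^ 2) (μ.prod ν) := by
    have h2 : AEStronglyMeasurable (fun q : α × β => c q.2) (μ.prod ν) :=
      (Lp.aestronglyMeasurable c).comp_snd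
    exact (hg.1.sub h2).norm.pow 2
  have h3 := h1.integral_prod_right'.aemeasurable.sqrt
  refine h3.congr ?_
  filter_upwards [hg.ae_coeFn_lpSlice] with t ht
  rw [dist_eq_norm, ← Real.sqrt_sq (norm_nonneg (lpSlice ν g t - c)), Lp.norm_sq_eq_integral]
  congr 1
  refine integral_congr_ae ?_
  filter_upwards [ht, Lp.coeFn_sub (lpSlice ν g t) c] with y h4 h5
  rw [h5, Pi.sub_apply, h4]

theorem MeasureTheory.MemLp.ae_norm_sq_lpSlice {g : α × β → F} (hg : MemLp g 2 (μ.prod ν)) :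
    ∀ᵐ t ∂μ, ‖lpSlice ν g t‖ ^ 2 = ∫ y, ‖g (t, y)‖ ^ 2 ∂ν := by
  filter_upwards [hg.ae_coeFn_lpSlice] with t ht
  rw [Lp.norm_sq_eq_integral]
  refine integral_congr_ae ?_
  filter_upwards [ht] with y h4
  rw [h4]

theorem MeasureTheory.MemLp.memLp_lpSlice {g : α × β → F} [SecondCountableTopology (Lp F 2 ν)]
    (hg : MemLp g 2 (μ.prod ν)) : MemLp (lpSlice ν g) 2 μ := by
  rw [memLp_two_iff_integrable_sq_norm hg.aestronglyMeasurable_lpSlice]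
  refine Integrable.congr ?_ (EventuallyEq.symm hg.ae_norm_sq_lpSlice)
  exact ((memLp_two_iff_integrable_sq_norm hg.1).1 hg).integral_prod_left

theorem MeasureTheory.MemLp.integral_norm_sq_lpSlice {g : α × β → F} (hg : MemLp g 2 (μ.prod ν)) :
    ∫ t, ‖lpSlice ν g t‖ ^ 2 ∂μ = ∫ q, ‖g q‖ ^ 2 ∂μ.prod ν := by
  rw [integral_prod _ ((memLp_two_iff_integrable_sq_norm hg.1).1 hg)]
  exact integral_congr_ae hg.ae_norm_sq_lpSlice

end Slices

/-! ### Enlarging and shrinking measures -/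

section InclOfLe

variable {α F : Type*} {m : MeasurableSpace α} {μ ν : Measure α} {C : ℝ}

/-- The inclusion of `L²(μ)` in `L²(ν)` for `ν ≤ C μ`. -/
noncomputable def lpInclOfLe (F : Type*) [NormedAddCommGroup F] [InnerProductSpace ℝ F]
    (h : ν ≤ ENNReal.ofReal C • μ) : Lp F 2 μ →L[ℝ] Lp F 2 ν :=
  LinearMap.mkContinuous
    { toFun := fun f => ((Lp.memLp f).of_measure_le_smul ENNReal.ofReal_ne_top h).toLp
      map_add' := fun f g => by
        rw [← MemLp.toLp_add, MemLp.toLp_eq_toLp_iff]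
        exact ((Measure.absolutelyContinuous_of_le h).trans
          Measure.smul_absolutelyContinuous).ae_le (Lp.coeFn_add f g)
      map_smul' := fun c f => by
        rw [RingHom.id_apply, ← MemLp.toLp_const_smul, MemLp.toLp_eq_toLp_iff]
        exact ((Measure.absolutelyContinuous_of_le h).trans
          Measure.smul_absolutelyContinuous).ae_le (Lp.coeFn_smul c f) }
    √C fun f => by
      change ‖MemLp.toLp f ((Lp.memLp f).of_measure_le_smul ENNReal.ofReal_ne_top h)‖ ≤ _
      refine abs_le_of_sq_le_sq' ?_ (by positivity) |>.2
      have hi := ((memLp_two_iff_integrable_sq_norm (Lp.aestronglyMeasurable f)).1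
        (Lp.memLp f)).smul_measure (c := ENNReal.ofReal C) ENNReal.ofReal_ne_top
      rw [mul_pow, Real.sq_sqrt', Lp.norm_sq_eq_integral, Lp.norm_sq_eq_integral,
        ← ENNReal.toReal_ofReal', ← smul_eq_mul, ← integral_smul_measure,
        integral_congr_ae (f := fun x => ‖MemLp.toLp f _ x‖ ^ 2) (g := fun x => ‖f x‖ ^ 2)
          ((MemLp.coeFn_toLp
          ((Lp.memLp f).of_measure_le_smul ENNReal.ofReal_ne_top h)).fun_comp fun x => ‖x‖ ^ 2)]
      exact integral_mono_measure h (Eventually.of_forall fun x => by positivity) hi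

variable [NormedAddCommGroup F] [InnerProductSpace ℝ F]

theorem coeFn_lpInclOfLe (h : ν ≤ ENNReal.ofReal C • μ) (f : Lp F 2 μ) :
    lpInclOfLe F h f =ᵐ[ν] f :=
  MemLp.coeFn_toLp ((Lp.memLp f).of_measure_le_smul ENNReal.ofReal_ne_top h)

theorem inner_lpInclOfLe (h : ν ≤ ENNReal.ofReal C • μ) (f g : Lp F 2 μ) :
    inner ℝ (lpInclOfLe F h f) (lpInclOfLe F h g) = ∫ x, inner ℝ (f x) (g x) ∂ν := by
  rw [L2.inner_def]
  refine integral_congr_ae ?_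
  filter_upwards [coeFn_lpInclOfLe h f, coeFn_lpInclOfLe h g] with x h1 h2
  rw [h1, h2]

theorem norm_sq_lpInclOfLe (h : ν ≤ ENNReal.ofReal C • μ) (f : Lp F 2 μ) :
    ‖lpInclOfLe F h f‖ ^ 2 = ∫ x, ‖f x‖ ^ 2 ∂ν := by
  rw [← real_inner_self_eq_norm_sq, inner_lpInclOfLe]
  simp

end InclOfLe

/-- A bound for the quadratic form of a symmetric operator bounds its norm. -/
theorem ContinuousLinearMap.norm_le_of_symm_of_abs_inner_self_le {E : Type*}
    [NormedAddCommGroup E] [InnerProductSpace ℝ E] (A : E →L[ℝ] E)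
    (hA : ∀ x y, inner ℝ (A x) y = inner ℝ x (A y)) {K : ℝ} (hK : 0 ≤ K)
    (h : ∀ x, |inner ℝ (A x) x| ≤ K * ‖x‖ ^ 2) : ‖A‖ ≤ K := by
  refine A.opNorm_le_bound hK fun x => ?_
  -- Polarization: by symmetry the bilinear form is a combination of quadratic forms at `x + y` and
  -- `x - y`. It will be used with `y` the multiple of `A x` that has the norm of `x`.
  have key : ∀ y, 2 * inner ℝ (A x) y ≤ K * (‖x‖ ^ 2 + ‖y‖ ^ 2) := fun y => by
    have h1 := (le_abs_self _).trans (h (x + y))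
    have h2 := (neg_abs_le _).trans' (neg_le_neg (h (x - y)))
    have h3 : inner ℝ (A y) x = inner ℝ (A x) y := by rw [hA, real_inner_comm]
    have h4 := parallelogram_law_with_norm ℝ x y
    simp only [map_add, map_sub, inner_add_left, inner_add_right, inner_sub_left,
      inner_sub_right, h3] at h1 h2
    nlinarith
  rcases eq_or_ne (A x) 0 with h0 | h0
  · rw [h0, norm_zero]
    positivity
  have hx : 0 < ‖x‖ := norm_pos_iff.2 fun hx => h0 (by rw [hx, map_zero])
  have hn : 0 < ‖A x‖ := norm_pos_iff.2 h0
  have h1 := key ((‖x‖ / ‖A x‖) • A x)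
  rw [real_inner_smul_right, real_inner_self_eq_norm_sq, norm_smul, Real.norm_eq_abs,
    abs_of_pos (div_pos hx hn), div_mul_cancel₀ _ hn.ne'] at h1
  have h2 : ‖x‖ / ‖A x‖ * ‖A x‖ ^ 2 = ‖x‖ * ‖A x‖ := by field_simp
  rw [h2] at h1
  by_contra hcon
  rw [not_le] at hcon
  nlinarith

namespace EvolvingSurface

variable {d : ℕ} (M : EvolvingSurface d)

/-! ### The space-time surface -/

theorem mem_slab_iff {a b : ℝ} {p : EuclideanSpace ℝ (Fin d) × ℝ} :
    p ∈ M.slab a b ↔ ∃ t ∈ Ioo a b, ∃ y ∈ M.Γ₀, p = (M.Φ t y, t) := by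
  constructor
  · rintro ⟨ht, y, hy, hp⟩
    exact ⟨p.2, ht, y, hy, Prod.ext hp.symm rfl⟩
  · rintro ⟨t, ht, y, hy, rfl⟩
    exact ⟨ht, y, hy, rfl⟩

theorem flow_mem_slab {a b t : ℝ} (ht : t ∈ Ioo a b) {y : EuclideanSpace ℝ (Fin d)}
    (hy : y ∈ M.Γ₀) : (M.Φ t y, t) ∈ M.slab a b := M.mem_slab_iff.2 ⟨t, ht, y, hy, rfl⟩

theorem isCompact_trajectories {I : Set ℝ} (hI : IsCompact I) (hsub : I ⊆ Icc 0 M.T) :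
    IsCompact ((fun q : ℝ × EuclideanSpace ℝ (Fin d) => (M.Φ q.1 q.2, q.1)) '' (I ×ˢ M.Γ₀)) := by
  refine (hI.prod M.isCompact_Γ₀).image_of_continuousOn (ContinuousOn.prodMk ?_ continuousOn_fst)
  exact M.continuousOn_flow.comp (f := fun q : ℝ × EuclideanSpace ℝ (Fin d) => (q.2, q.1))
    (by fun_prop) fun q hq => ⟨M.Γ₀_subset_V hq.2, hsub hq.1⟩

theorem measurableSet_slab : MeasurableSet (M.slab 0 M.T) := by
  have : M.slab 0 M.T = (fun q : ℝ × EuclideanSpace ℝ (Fin d) => (M.Φ q.1 q.2, q.1)) ''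
      (Icc 0 M.T ×ˢ M.Γ₀) ∩ Prod.snd ⁻¹' Ioo 0 M.T := by
    ext p
    rw [mem_slab_iff]
    constructor
    · rintro ⟨t, ht, y, hy, rfl⟩
      exact ⟨⟨(t, y), ⟨Ioo_subset_Icc_self ht, hy⟩, rfl⟩, ht⟩
    · rintro ⟨⟨⟨t, y⟩, ⟨_, hy⟩, rfl⟩, ht⟩
      exact ⟨t, ht, y, hy, rfl⟩
  rw [this]
  exact (M.isCompact_trajectories isCompact_Icc subset_rfl).measurableSet.inter
    (measurable_snd measurableSet_Ioo)

theorem ae_mem_slab : ∀ᵐ p ∂M.stMeasure, p ∈ M.slab 0 M.T := by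
  rw [M.stMeasure_eq_map, ae_map_iff (p := fun p => p ∈ M.slab 0 M.T) M.measurable_traj.aemeasurable
    M.measurableSet_slab]
  refine M.massMeasure_absolutelyContinuous_prod.ae_le ?_
  filter_upwards [M.ae_mem_domain] with q hq
  rw [show q = (q.1, q.2) from rfl, M.traj_of_mem (Ioo_subset_Icc_self hq.1) hq.2]
  exact M.flow_mem_slab hq.1 hq.2

theorem _root_.ContinuousOn.aestronglyMeasurable_stMeasure {F : Type*} [TopologicalSpace F]
    [TopologicalSpace.PseudoMetrizableSpace F] [SecondCountableTopology F]
    {f : EuclideanSpace ℝ (Fin d) × ℝ → F} (hf : ContinuousOn f (M.slab 0 M.T)) :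
    AEStronglyMeasurable f M.stMeasure := by
  rw [← Measure.restrict_eq_self_of_ae_mem M.ae_mem_slab]
  borelize F
  exact (hf.aemeasurable M.measurableSet_slab).aestronglyMeasurable

theorem _root_.ContinuousOn.aestronglyMeasurable_prod {F : Type*} [TopologicalSpace F]
    [TopologicalSpace.PseudoMetrizableSpace F] [SecondCountableTopology F]
    {f : ℝ × EuclideanSpace ℝ (Fin d) → F} (hf : ContinuousOn f (Ioo 0 M.T ×ˢ M.Γ₀)) :
    AEStronglyMeasurable f (M.timeMeasure.prod M.refMeasure) := by
  rw [← Measure.restrict_eq_self_of_ae_mem (s := Ioo 0 M.T ×ˢ M.Γ₀) M.ae_mem_domain]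
  borelize F
  exact (hf.aemeasurable (measurableSet_Ioo.prod
    M.isCompact_Γ₀.measurableSet)).aestronglyMeasurable

theorem continuousOn_tangProj : ContinuousOn M.tangProj {p | p.2 ∈ Icc 0 M.T ∧ p.1 ∈ M.Γ p.2} := by
  have h : Continuous fun n : EuclideanSpace ℝ (Fin d) =>
      ContinuousLinearMap.id ℝ (EuclideanSpace ℝ (Fin d)) - (innerSL ℝ n).smulRight n := by
    have h1 : Continuous fun n : EuclideanSpace ℝ (Fin d) => (innerSL ℝ n).smulRight n :=
      ((ContinuousLinearMap.smulRightL ℝ (EuclideanSpace ℝ (Fin d))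
        (EuclideanSpace ℝ (Fin d))).continuous₂).comp
        ((innerSL ℝ).continuous.prodMk continuous_id)
    exact continuous_const.sub h1
  exact h.comp_continuousOn M.continuousOn_normal

theorem slab_subset : M.slab 0 M.T ⊆ {p | p.2 ∈ Icc 0 M.T ∧ p.1 ∈ M.Γ p.2} :=
  fun _ hp => ⟨Ioo_subset_Icc_self hp.1, hp.2⟩

theorem continuousOn_pullGrad : ContinuousOn
    (fun q : ℝ × EuclideanSpace ℝ (Fin d) => M.pullGrad (q.2, q.1)) (Ioo 0 M.T ×ˢ M.Γ₀) := by
  have h1 : ContinuousOn (fun q : ℝ × EuclideanSpace ℝ (Fin d) => M.tangProj (q.2, 0))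
      (Ioo 0 M.T ×ˢ M.Γ₀) :=
    M.continuousOn_tangProj.comp (f := fun q : ℝ × EuclideanSpace ℝ (Fin d) => (q.2, (0 : ℝ)))
      (by fun_prop) fun q hq =>
        ⟨⟨le_rfl, M.T_pos.le⟩, by simpa only [Γ, M.flow_zero_image] using hq.2⟩
  have h2 : ContinuousOn (fun q : ℝ × EuclideanSpace ℝ (Fin d) => M.dΦ (q.2, q.1))
      (Ioo 0 M.T ×ˢ M.Γ₀) :=
    M.continuousOn_dΦ.comp (f := fun q : ℝ × EuclideanSpace ℝ (Fin d) => (q.2, q.1))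
      (by fun_prop) fun q hq => ⟨M.Γ₀_subset_V hq.2, hq.1⟩
  exact h1.clm_comp (ContinuousLinearMap.adjoint.continuous.comp_continuousOn h2)

/-! ### The surface divergence of the velocity -/

theorem hasFDerivAt_w_slice {x : EuclideanSpace ℝ (Fin d)} (hx : x ∈ M.Ω) {t : ℝ}
    (ht : t ∈ Ioo 0 M.T) : HasFDerivAt (fun x => M.w (x, t))
      ((fderiv ℝ M.w (x, t)).comp (ContinuousLinearMap.inl ℝ _ _)) x := by
  have h1 : ContDiffAt ℝ ∞ M.w (x, t) := M.contDiffOn_w.contDiffAt (prod_mem_nhds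
    (M.isOpen_Ω.mem_nhds hx) (Icc_mem_nhds ht.1 ht.2))
  exact (h1.differentiableAt (by simp)).hasFDerivAt.comp x (hasFDerivAt_prodMk_left (𝕜 := ℝ) x t)

/-- The Lipschitz bound for the field is only known between points of the range, so it is composed
with the flow, differentiated at an interior point of the collar, and the flow is then undone. Each
of the last two operations costs one distortion factor. -/
theorem norm_fderiv_w_le {y : EuclideanSpace ℝ (Fin d)} (hy : y ∈ M.Γ₀) {t : ℝ}
    (ht : t ∈ Ioo 0 M.T) : ‖fderiv ℝ (fun x => M.w (x, t)) (M.Φ t y)‖ ≤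
      M.rate * M.distortion * M.distortion := by
  have hyc := M.Γ₀_subset_interior_collar hy
  have hyV := M.Γ₀_subset_V hy
  have ht' := Ioo_subset_Icc_self ht
  have hd := M.distortion_pos
  have hr := M.rate_nonneg
  have hw := (M.hasFDerivAt_w_slice (M.Φ_mem y hyV t ht') ht).differentiableAt.hasFDerivAt
  have hcomp := hw.comp y (M.hasFDerivAt_flow_slice hyV ht)
  have hb := hcomp.norm_apply_le_of_eventually_le (C := M.rate * M.distortion) (by
    filter_upwards [mem_interior_iff_mem_nhds.1 hyc] with z hz
    have hyc' := interior_subset hyc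
    refine (M.norm_w_sub_le ht' (mem_image_of_mem _ (show (z, t) ∈ _ from ⟨hz, ht'⟩))
      (mem_image_of_mem _ (show (y, t) ∈ _ from ⟨hyc', ht'⟩))).trans ?_
    rw [mul_assoc]
    exact mul_le_mul_of_nonneg_left (M.norm_flow_sub_le_distortion hz hyc' ht').1 hr)
  refine ContinuousLinearMap.opNorm_le_bound _ (by positivity) fun v => ?_
  have hsurj : Function.Surjective (M.dΦ (y, t)) :=
    LinearMap.injective_iff_surjective (f := (M.dΦ (y, t)).toLinearMap).1 (M.injective_dΦ hyc ht)
  obtain ⟨h, rfl⟩ := hsurj v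
  refine (hb h).trans ?_
  rw [mul_assoc (M.rate * M.distortion)]
  exact mul_le_mul_of_nonneg_left (M.le_norm_dΦ_apply hyc ht h) (by positivity)

theorem continuousOn_fderiv_w : ContinuousOn
    (fun p : EuclideanSpace ℝ (Fin d) × ℝ => fderiv ℝ (fun x => M.w (x, p.2)) p.1)
    (M.Ω ×ˢ Ioo 0 M.T) := by
  have h1 : ContinuousOn (fderiv ℝ M.w) (M.Ω ×ˢ Ioo 0 M.T) :=
    (M.contDiffOn_w.mono (prod_mono_right Ioo_subset_Icc_self)).continuousOn_fderiv_of_isOpen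
      (M.isOpen_Ω.prod isOpen_Ioo) (by simp)
  refine (h1.clm_comp (continuousOn_const
    (c := ContinuousLinearMap.inl ℝ (EuclideanSpace ℝ (Fin d)) ℝ))).congr ?_
  rintro ⟨x, t⟩ ⟨hx, ht⟩
  exact (M.hasFDerivAt_w_slice hx ht).fderiv

/-- The trace as a continuous functional. -/
noncomputable def traceCLM (E : Type*) [NormedAddCommGroup E] [NormedSpace ℝ E]
    [FiniteDimensional ℝ E] : (E →L[ℝ] E) →L[ℝ] ℝ :=
  LinearMap.toContinuousLinearMap (LinearMap.trace ℝ E ∘ₗ ContinuousLinearMap.coeLM ℝ)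

theorem slab_subset_prod : M.slab 0 M.T ⊆ M.Ω ×ˢ Ioo 0 M.T := by
  rintro p hp
  obtain ⟨t, ht, y, hy, rfl⟩ := M.mem_slab_iff.1 hp
  exact ⟨M.Φ_mem y (M.Γ₀_subset_V hy) t (Ioo_subset_Icc_self ht), ht⟩

theorem continuousOn_divw : ContinuousOn M.divw (M.slab 0 M.T) := by
  have h := (M.continuousOn_tangProj.mono M.slab_subset).clm_comp
    (M.continuousOn_fderiv_w.mono M.slab_subset_prod)
  exact (traceCLM (EuclideanSpace ℝ (Fin d))).continuous.comp_continuousOn h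

/-- A bound for the surface divergence of the velocity. -/
noncomputable def divBound : ℝ :=
  ‖traceCLM (EuclideanSpace ℝ (Fin d))‖ * (M.rate * M.distortion * M.distortion)

theorem divBound_nonneg : 0 ≤ M.divBound := by
  have := M.distortion_pos
  have := M.rate_nonneg
  unfold divBound
  positivity

theorem abs_divw_le {p : EuclideanSpace ℝ (Fin d) × ℝ} (hp : p ∈ M.slab 0 M.T) :
    |M.divw p| ≤ M.divBound := by
  obtain ⟨t, ht, y, hy, rfl⟩ := M.mem_slab_iff.1 hp
  have h1 : M.divw (M.Φ t y, t) = traceCLM (EuclideanSpace ℝ (Fin d))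
      (M.tangProj (M.Φ t y, t) ∘L fderiv ℝ (fun x => M.w (x, t)) (M.Φ t y)) := rfl
  rw [h1, ← Real.norm_eq_abs]
  refine ((traceCLM (EuclideanSpace ℝ (Fin d))).le_opNorm _).trans
    (mul_le_mul_of_nonneg_left ?_ (norm_nonneg _))
  refine ContinuousLinearMap.opNorm_le_bound _ ((norm_nonneg _).trans (M.norm_fderiv_w_le hy ht))
    fun v => ?_
  refine (M.norm_tangProj_apply_le (M.norm_normal_flow hy (Ioo_subset_Icc_self ht)) _).trans ?_
  exact ContinuousLinearMap.le_of_opNorm_le _ (M.norm_fderiv_w_le hy ht) v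

theorem ae_abs_divw_le : ∀ᵐ p ∂M.stMeasure, |M.divw p| ≤ M.divBound := by
  filter_upwards [M.ae_mem_slab] with p hp using M.abs_divw_le hp

theorem aestronglyMeasurable_divw : AEStronglyMeasurable M.divw M.stMeasure :=
  ContinuousOn.aestronglyMeasurable_stMeasure M M.continuousOn_divw

/-! ### Test functions that are products along the flow -/

/-- The function `η(t) ζ(y)` of the time and the initial point. -/
noncomputable def productTest (η : ℝ → ℝ) (ζ : EuclideanSpace ℝ (Fin d) → ℝ)
    (p : EuclideanSpace ℝ (Fin d) × ℝ) : ℝ := η p.2 * ζ (M.back p)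

variable {η : ℝ → ℝ} {ζ : EuclideanSpace ℝ (Fin d) → ℝ}

theorem contDiffAt_productTest (hη : ContDiff ℝ ∞ η) (hζ : ∀ y ∈ M.Γ₀, ContDiffAt ℝ 1 ζ y)
    {p : EuclideanSpace ℝ (Fin d) × ℝ} (hp : p ∈ M.slab 0 M.T) :
    ContDiffAt ℝ 1 (M.productTest η ζ) p := by
  obtain ⟨t, ht, y, hy, rfl⟩ := M.mem_slab_iff.1 hp
  have h1 : ContDiffAt ℝ 1 (fun p : EuclideanSpace ℝ (Fin d) × ℝ => η p.2) (M.Φ t y, t) :=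
    ((hη.of_le (by exact_mod_cast le_top)).comp contDiff_snd).contDiffAt
  have h2 : ContDiffAt ℝ 1 M.back (M.Φ t y, t) :=
    (M.contDiffAt_back (M.Γ₀_subset_interior_collar hy) ht).of_le (by exact_mod_cast le_top)
  refine h1.mul (ContDiffAt.comp (M.Φ t y, t) ?_ h2)
  rw [M.back_flow (M.Γ₀_subset_collar hy) (Ioo_subset_Icc_self ht)]
  exact hζ y hy

theorem productTest_flow {y : EuclideanSpace ℝ (Fin d)} (hy : y ∈ M.collar) {t : ℝ}
    (ht : t ∈ Icc 0 M.T) : M.productTest η ζ (M.Φ t y, t) = η t * ζ y := by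
  rw [productTest, M.back_flow hy ht]

theorem isTest_productTest (hη : ContDiff ℝ ∞ η) (hc : HasCompactSupport η) {a b : ℝ}
    (h0 : 0 ≤ a) (hT : b ≤ M.T) (hs : tsupport η ⊆ Ioo a b)
    (hζ : ∀ y ∈ M.Γ₀, ContDiffAt ℝ 1 ζ y) : M.IsTest a b (M.productTest η ζ) := by
  have hsub : tsupport η ⊆ Icc 0 M.T := fun t ht =>
    ⟨h0.trans (hs ht).1.le, (hs ht).2.le.trans hT⟩
  refine ⟨fun p hp => M.contDiffAt_productTest hη hζ hp, _,
    M.isCompact_trajectories hc hsub, ?_, ?_⟩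
  · rintro _ ⟨⟨t, y⟩, ⟨ht, hy⟩, rfl⟩
    exact M.flow_mem_slab (hs ht) hy
  · intro p hp hpK
    obtain ⟨t, ht, y, hy, rfl⟩ := M.mem_slab_iff.1 hp
    have : t ∉ tsupport η := fun h => hpK ⟨(t, y), ⟨h, hy⟩, rfl⟩
    rw [productTest, show η t = 0 from image_eq_zero_of_notMem_tsupport this, zero_mul]

/-- The material derivative is the derivative along a trajectory, on which the initial point is
constant, so only `η` is differentiated. -/
theorem matDeriv_productTest (hη : ContDiff ℝ ∞ η) (hζ : ∀ y ∈ M.Γ₀, ContDiffAt ℝ 1 ζ y)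
    {y : EuclideanSpace ℝ (Fin d)} (hy : y ∈ M.Γ₀) {t : ℝ} (ht : t ∈ Ioo 0 M.T) :
    M.matDeriv (M.productTest η ζ) (M.Φ t y, t) = deriv η t * ζ y := by
  have h1 := ((M.contDiffAt_productTest hη hζ (M.flow_mem_slab ht hy)).differentiableAt
    one_ne_zero).hasFDerivAt
  have h2 : HasDerivAt (fun s => (M.Φ s y, s)) (M.w (M.Φ t y, t), (1 : ℝ)) t :=
    (M.hasDerivAt_flow (M.Γ₀_subset_V hy) ht).prodMk (hasDerivAt_id t)
  have h3 := h1.comp_hasDerivAt (f := fun s => (M.Φ s y, s)) t h2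
  have h4 : HasDerivAt (fun s => η s * ζ y) (deriv η t * ζ y) t :=
    ((hη.differentiable (by simp)).differentiableAt.hasDerivAt).mul_const _
  refine h3.unique (h4.congr_of_eventuallyEq ?_)
  filter_upwards [Ioo_mem_nhds ht.1 ht.2] with s hs
  exact M.productTest_flow (M.Γ₀_subset_collar hy) (Ioo_subset_Icc_self hs)

theorem continuousOn_tangGrad {φ : EuclideanSpace ℝ (Fin d) × ℝ → ℝ}
    (hφ : ∀ p ∈ M.slab 0 M.T, ContDiffAt ℝ 1 φ p) :
    ContinuousOn (M.tangGrad φ) (M.slab 0 M.T) := by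
  have h1 : ContinuousOn (fun p : EuclideanSpace ℝ (Fin d) × ℝ =>
      gradient (fun x => φ (x, p.2)) p.1) (M.slab 0 M.T) := by
    have h2 : ContinuousOn (fun p => (fderiv ℝ φ p).comp (ContinuousLinearMap.inl ℝ _ _))
        (M.slab 0 M.T) := fun p hp =>
      (((hφ p hp).fderiv_right (m := 0) (by simp)).continuousAt.clm_comp
        continuousAt_const).continuousWithinAt
    refine ((InnerProductSpace.toDual ℝ _).symm.continuous.comp_continuousOn h2).congr ?_
    intro p hp
    have h3 := ((hφ p hp).differentiableAt one_ne_zero).hasFDerivAt.comp p.1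
      (hasFDerivAt_prodMk_left (𝕜 := ℝ) p.1 p.2)
    simp only [gradient, Function.comp_apply]
    congr 1
    exact h3.fderiv
  exact (M.continuousOn_tangProj.mono M.slab_subset).clm_apply h1

theorem tangGrad_productTest_eq_zero {p : EuclideanSpace ℝ (Fin d) × ℝ} (hp : η p.2 = 0) :
    M.tangGrad (M.productTest η ζ) p = 0 := by
  have : (fun x => M.productTest η ζ (x, p.2)) = fun _ => (0 : ℝ) := by
    ext x
    simp [productTest, hp]
  rw [tangGrad, this]
  simp

theorem pullGrad_tangGrad_productTest (hη : ContDiff ℝ ∞ η) (hζ : ∀ y ∈ M.Γ₀, ContDiffAt ℝ 1 ζ y)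
    {y : EuclideanSpace ℝ (Fin d)} (hy : y ∈ M.Γ₀) {t : ℝ} (ht : t ∈ Ioo 0 M.T) :
    M.pullGrad (y, t) (M.tangGrad (M.productTest η ζ) (M.Φ t y, t)) =
      η t • M.tangProj (y, 0) (gradient ζ y) := by
  have hd : DifferentiableAt ℝ (fun x => M.productTest η ζ (x, t)) (M.Φ t y) :=
    ((M.contDiffAt_productTest hη hζ (M.flow_mem_slab ht hy)).differentiableAt
      one_ne_zero).comp (f := fun x => (x, t)) (M.Φ t y) (by fun_prop)
  rw [tangGrad]
  refine (M.pullGrad_tangProj_gradient hy ht hd).trans ?_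
  rw [← map_smul]
  congr 1
  have h1 : (fun z => M.productTest η ζ (M.Φ t z, t)) =ᶠ[𝓝 y] fun z => η t * ζ z := by
    filter_upwards [mem_interior_iff_mem_nhds.1 (M.Γ₀_subset_interior_collar hy)] with z hz
    exact M.productTest_flow hz (Ioo_subset_Icc_self ht)
  rw [gradient, h1.fderiv_eq, fderiv_const_mul ((hζ y hy).differentiableAt one_ne_zero), map_smul]
  rfl

/-- Continuous functions on the space-time surface that vanish outside of a compact time interval
are square integrable. -/
theorem memLp_of_continuousOn {F : Type*} [NormedAddCommGroup F] [SecondCountableTopology F]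
    {f : EuclideanSpace ℝ (Fin d) × ℝ → F} (hf : ContinuousOn f (M.slab 0 M.T)) {I : Set ℝ}
    (hI : IsCompact I) (hsub : I ⊆ Ioo 0 M.T) (h0 : ∀ p ∈ M.slab 0 M.T, p.2 ∉ I → f p = 0) :
    MemLp f 2 M.stMeasure := by
  have hK := M.isCompact_trajectories hI (hsub.trans Ioo_subset_Icc_self)
  have hKs : (fun q : ℝ × EuclideanSpace ℝ (Fin d) => (M.Φ q.1 q.2, q.1)) '' (I ×ˢ M.Γ₀) ⊆
      M.slab 0 M.T := by
    rintro _ ⟨⟨t, y⟩, ⟨ht, hy⟩, rfl⟩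
    exact M.flow_mem_slab (hsub ht) hy
  obtain ⟨C, hC⟩ := hK.exists_bound_of_continuousOn (hf.mono hKs)
  refine MemLp.of_bound (ContinuousOn.aestronglyMeasurable_stMeasure M hf) (max C 0) ?_
  filter_upwards [M.ae_mem_slab] with p hp
  by_cases hpI : p.2 ∈ I
  · obtain ⟨t, ht, y, hy, rfl⟩ := M.mem_slab_iff.1 hp
    exact (hC _ ⟨(t, y), ⟨hpI, hy⟩, rfl⟩).trans (le_max_left _ _)
  · rw [h0 p hp hpI, norm_zero]
    exact le_max_right _ _

theorem exists_represents_productTest (hη : ContDiff ℝ ∞ η) (hc : HasCompactSupport η) {a b : ℝ}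
    (h0 : 0 ≤ a) (hT : b ≤ M.T) (hs : tsupport η ⊆ Ioo a b)
    (hζ : ∀ y ∈ M.Γ₀, ContDiffAt ℝ 1 ζ y) :
    ∃ z : M.Hslab a b, M.Represents z (M.productTest η ζ) := by
  have hsub : tsupport η ⊆ Ioo 0 M.T := hs.trans (Ioo_subset_Ioo h0 hT)
  have hC := fun p hp => M.contDiffAt_productTest (p := p) hη hζ hp
  have hz : ∀ t ∉ tsupport η, η t = 0 := fun t ht => image_eq_zero_of_notMem_tsupport ht
  have h1 : MemLp (M.productTest η ζ) 2 M.stMeasure :=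
    M.memLp_of_continuousOn (fun p hp => (hC p hp).continuousAt.continuousWithinAt) hc hsub
      fun p _ hp => by rw [productTest, hz _ hp, zero_mul]
  have h2 : MemLp (M.tangGrad (M.productTest η ζ)) 2 M.stMeasure :=
    M.memLp_of_continuousOn (M.continuousOn_tangGrad hC) hc hsub
      fun p _ hp => M.tangGrad_productTest_eq_zero (hz _ hp)
  let z : M.Graph := WithLp.toLp 2 (h1.toLp, h2.toLp)
  have hrep : M.Represents z (M.productTest η ζ) := ⟨h1.coeFn_toLp, h2.coeFn_toLp⟩
  refine ⟨⟨z, Submodule.le_topologicalClosure _ (Submodule.subset_span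
    ⟨_, M.isTest_productTest hη hc le_rfl le_rfl hsub hζ, hrep⟩), ?_⟩, hrep⟩
  filter_upwards [hrep.1, hrep.2] with p hp1 hp2 hp
  have h3 : p.2 ∉ tsupport η := fun h => hp (Ioo_subset_Ioc_self (hs h))
  rw [hp1, hp2, M.tangGrad_productTest_eq_zero (hz _ h3), productTest, hz _ h3, zero_mul]
  exact ⟨rfl, rfl⟩

end EvolvingSurface

/-! ### Pointwise constraints in `L²` and linearity of slices -/

theorem MeasureTheory.Lp.isClosed_setOf_ae_mem {α F : Type*} {m : MeasurableSpace α}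
    {μ : Measure α} [NormedAddCommGroup F] {S : α → Set F} (hS : ∀ x, IsClosed (S x)) :
    IsClosed {f : Lp F 2 μ | ∀ᵐ x ∂μ, f x ∈ S x} := by
  refine IsSeqClosed.isClosed fun f g hf hfg => ?_
  -- Convergence in `L²` gives almost everywhere convergence of a subsequence. In this way
  -- tangentiality, vanishing outside a slab and membership in `InitH` pass to closures.
  obtain ⟨ns, -, hns⟩ := (tendstoInMeasure_of_tendsto_Lp hfg).exists_seq_tendsto_ae
  have h1 : ∀ᵐ x ∂μ, ∀ n, f n x ∈ S x := ae_all_iff.2 hf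
  filter_upwards [hns, h1] with x h2 h3
  exact (hS x).mem_of_tendsto h2 (Eventually.of_forall fun n => h3 (ns n))

section Slices

variable {α β F : Type*} [MeasurableSpace β] {ν : Measure β} [NormedAddCommGroup F]
  {g h : α × β → F} {t : α}

theorem lpSlice_add (hg : MemLp (fun y => g (t, y)) 2 ν) (hh : MemLp (fun y => h (t, y)) 2 ν) :
    lpSlice ν (fun q => g q + h q) t = lpSlice ν g t + lpSlice ν h t := by
  rw [lpSlice, dif_pos (show MemLp (fun y => g (t, y) + h (t, y)) 2 ν from hg.add hh), lpSlice,
    dif_pos hg, lpSlice, dif_pos hh]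
  rfl

theorem lpSlice_smul [NormedSpace ℝ F] (r : ℝ) (hg : MemLp (fun y => g (t, y)) 2 ν) :
    lpSlice ν (fun q => r • g q) t = r • lpSlice ν g t := by
  rw [lpSlice, dif_pos (show MemLp (fun y => r • g (t, y)) 2 ν from hg.const_smul r), lpSlice,
    dif_pos hg]
  rfl

end Slices

namespace EvolvingSurface

variable {d : ℕ} (M : EvolvingSurface d)

/-! ### Transport of integrals to the initial surface -/

theorem integrable_comp_traj {f : EuclideanSpace ℝ (Fin d) × ℝ → ℝ}
    (hf : Integrable f M.stMeasure) :
    Integrable (fun q => f (M.traj q)) (M.timeMeasure.prod M.refMeasure) := by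
  have h1 : Integrable (fun q => f (M.traj q)) M.massMeasure :=
    M.measurePreserving_traj.integrable_comp_of_integrable hf
  exact (h1.smul_measure (c := ENNReal.ofReal M.massBound) ENNReal.ofReal_ne_top).mono_measure
    M.prod_le_massMeasure

theorem integral_comp_traj {f : EuclideanSpace ℝ (Fin d) × ℝ → ℝ}
    (hf : AEStronglyMeasurable f M.stMeasure) :
    ∫ q, f (M.traj q) ∂M.massMeasure = ∫ p, f p ∂M.stMeasure := by
  rw [M.stMeasure_eq_map] at hf ⊢
  exact (integral_map M.measurable_traj.aemeasurable hf).symm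

theorem integral_prod_comp_traj_le {f : EuclideanSpace ℝ (Fin d) × ℝ → ℝ}
    (hf : Integrable f M.stMeasure) (h0 : ∀ p, 0 ≤ f p) :
    ∫ q, f (M.traj q) ∂M.timeMeasure.prod M.refMeasure ≤
      M.massBound * ∫ p, f p ∂M.stMeasure := by
  have h1 : Integrable (fun q => f (M.traj q)) M.massMeasure :=
    M.measurePreserving_traj.integrable_comp_of_integrable hf
  refine (integral_mono_measure M.prod_le_massMeasure (Eventually.of_forall fun q => h0 _)
    (h1.smul_measure ENNReal.ofReal_ne_top)).trans ?_
  rw [integral_smul_measure, ENNReal.toReal_ofReal M.massBound_pos.le, smul_eq_mul,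
    M.integral_comp_traj hf.1]

theorem integral_le_integral_prod_comp_traj {f : EuclideanSpace ℝ (Fin d) × ℝ → ℝ}
    (hf : Integrable f M.stMeasure) (h0 : ∀ p, 0 ≤ f p) :
    ∫ p, f p ∂M.stMeasure ≤
      M.massBound * ∫ q, f (M.traj q) ∂M.timeMeasure.prod M.refMeasure := by
  rw [← M.integral_comp_traj hf.1]
  refine (integral_mono_measure M.massMeasure_le (Eventually.of_forall fun q => h0 _)
    ((M.integrable_comp_traj hf).smul_measure ENNReal.ofReal_ne_top)).trans ?_
  rw [integral_smul_measure, ENNReal.toReal_ofReal M.massBound_pos.le, smul_eq_mul]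

theorem integral_stMeasure {f : EuclideanSpace ℝ (Fin d) × ℝ → ℝ}
    (hf : Integrable f M.stMeasure) :
    ∫ p, f p ∂M.stMeasure = ∫ t, ∫ y, f (M.traj (t, y)) ∂M.pulled t ∂M.timeMeasure := by
  rw [← M.integral_comp_traj hf.1]
  exact Measure.integral_compProd (κ := M.massKernel)
    (M.measurePreserving_traj.integrable_comp_of_integrable hf)

theorem memLp_comp_traj {F : Type*} [NormedAddCommGroup F]
    {f : EuclideanSpace ℝ (Fin d) × ℝ → F} (hf : MemLp f 2 M.stMeasure) :
    MemLp (fun q => f (M.traj q)) 2 (M.timeMeasure.prod M.refMeasure) :=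
  (hf.comp_measurePreserving M.measurePreserving_traj).of_measure_le_smul ENNReal.ofReal_ne_top
    M.prod_le_massMeasure

/-! ### The pull-back of the graph space -/

instance secondCountable_lp_refMeasure {F : Type*} [NormedAddCommGroup F]
    [SecondCountableTopology F] : SecondCountableTopology (Lp F 2 M.refMeasure) := by
  have : Fact ((2 : ℝ≥0∞) ≠ ⊤) := ⟨ENNReal.ofNat_ne_top⟩
  infer_instance

/-- `L²` of the initial surface. -/
abbrev InitL2 : Type := Lp ℝ 2 M.refMeasure

/-- Pairs of a scalar and a vector field in `L²` of the initial surface. -/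
abbrev InitGraph : Type := WithLp 2 (M.InitL2 × Lp (EuclideanSpace ℝ (Fin d)) 2 M.refMeasure)

/-- The pulled back gradient component. -/
noncomputable def gradLift (u : M.Graph) (q : ℝ × EuclideanSpace ℝ (Fin d)) :
    EuclideanSpace ℝ (Fin d) := M.pullGrad (q.2, q.1) (u.snd (M.traj q))

variable {M} in
theorem memLp_fst_traj (u : M.Graph) :
    MemLp (fun q => u.fst (M.traj q)) 2 (M.timeMeasure.prod M.refMeasure) :=
  M.memLp_comp_traj (Lp.memLp u.fst)

variable {M} in
theorem memLp_snd_traj (u : M.Graph) :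
    MemLp (fun q => u.snd (M.traj q)) 2 (M.timeMeasure.prod M.refMeasure) :=
  M.memLp_comp_traj (Lp.memLp u.snd)

theorem ae_norm_gradLift_le (u : M.Graph) : ∀ᵐ q ∂M.timeMeasure.prod M.refMeasure,
    ‖M.gradLift u q‖ ≤ M.distortion * ‖u.snd (M.traj q)‖ := by
  filter_upwards [M.ae_mem_domain] with q hq
  exact M.norm_pullGrad_apply_le hq.2 hq.1 _

theorem memLp_gradLift (u : M.Graph) :
    MemLp (M.gradLift u) 2 (M.timeMeasure.prod M.refMeasure) := by
  refine (memLp_snd_traj u).of_le_mul ?_ (M.ae_norm_gradLift_le u)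
  exact (ContinuousLinearMap.id ℝ (EuclideanSpace ℝ (Fin d) →L[ℝ]
    EuclideanSpace ℝ (Fin d))).aestronglyMeasurable_comp₂
      (ContinuousOn.aestronglyMeasurable_prod M M.continuousOn_pullGrad) (memLp_snd_traj u).1

/-- An element of the graph space as a function of time with values in the graph space of the
initial surface. -/
noncomputable def path (u : M.Graph) (t : ℝ) : M.InitGraph :=
  WithLp.toLp 2 (lpSlice M.refMeasure (fun q => u.fst (M.traj q)) t,
    lpSlice M.refMeasure (M.gradLift u) t)

theorem ae_coeFn_path_fst (u : M.Graph) : ∀ᵐ t ∂M.timeMeasure, ∀ᵐ y ∂M.refMeasure,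
    (M.path u t).fst y = u.fst (M.traj (t, y)) :=
  (memLp_fst_traj u).ae_coeFn_lpSlice

theorem norm_sq_path (u : M.Graph) (t : ℝ) : ‖M.path u t‖ ^ 2 =
    ‖lpSlice M.refMeasure (fun q => u.fst (M.traj q)) t‖ ^ 2 +
      ‖lpSlice M.refMeasure (M.gradLift u) t‖ ^ 2 :=
  WithLp.prod_norm_sq_eq_of_L2 _

theorem memLp_path (u : M.Graph) : MemLp (M.path u) 2 M.timeMeasure := by
  have h1 := (memLp_fst_traj u).memLp_lpSlice
  have h2 := (M.memLp_gradLift u).memLp_lpSlice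
  have hm : AEStronglyMeasurable (M.path u) M.timeMeasure :=
    (WithLp.prod_continuous_toLp 2 _ _).comp_aestronglyMeasurable (h1.1.prodMk h2.1)
  rw [memLp_two_iff_integrable_sq_norm hm]
  simp_rw [norm_sq_path]
  exact ((memLp_two_iff_integrable_sq_norm h1.1).1 h1).add
    ((memLp_two_iff_integrable_sq_norm h2.1).1 h2)

theorem integral_norm_sq_path (u : M.Graph) : ∫ t, ‖M.path u t‖ ^ 2 ∂M.timeMeasure =
    ∫ q, ‖u.fst (M.traj q)‖ ^ 2 ∂M.timeMeasure.prod M.refMeasure +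
      ∫ q, ‖M.gradLift u q‖ ^ 2 ∂M.timeMeasure.prod M.refMeasure := by
  have h1 := (memLp_fst_traj u).memLp_lpSlice
  have h2 := (M.memLp_gradLift u).memLp_lpSlice
  simp_rw [norm_sq_path]
  rw [integral_add ((memLp_two_iff_integrable_sq_norm h1.1).1 h1)
    ((memLp_two_iff_integrable_sq_norm h2.1).1 h2), (memLp_fst_traj u).integral_norm_sq_lpSlice,
    (M.memLp_gradLift u).integral_norm_sq_lpSlice]

/-- The constant by which the pull-back of the graph space is bounded. -/
noncomputable def pathBound : ℝ := M.massBound * (1 + M.distortion ^ 2)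

theorem pathBound_pos : 0 < M.pathBound := by
  have := M.massBound_pos
  unfold pathBound
  positivity

theorem norm_sq_graph (u : M.Graph) : ‖u‖ ^ 2 = ‖u.fst‖ ^ 2 + ‖u.snd‖ ^ 2 :=
  WithLp.prod_norm_sq_eq_of_L2 u

theorem integrable_norm_sq_lp {α F : Type*} {m : MeasurableSpace α} {μ : Measure α}
    [NormedAddCommGroup F] (f : Lp F 2 μ) : Integrable (fun x => ‖f x‖ ^ 2) μ :=
  (memLp_two_iff_integrable_sq_norm (Lp.aestronglyMeasurable f)).1 (Lp.memLp f)

theorem integral_norm_sq_path_le (u : M.Graph) :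
    ∫ t, ‖M.path u t‖ ^ 2 ∂M.timeMeasure ≤ M.pathBound * ‖u‖ ^ 2 := by
  have h1 := M.integral_prod_comp_traj_le (integrable_norm_sq_lp u.fst) fun p => by positivity
  have h2 := M.integral_prod_comp_traj_le (integrable_norm_sq_lp u.snd) fun p => by positivity
  have h3 : ∫ q, ‖M.gradLift u q‖ ^ 2 ∂M.timeMeasure.prod M.refMeasure ≤
      ∫ q, M.distortion ^ 2 * ‖u.snd (M.traj q)‖ ^ 2 ∂M.timeMeasure.prod M.refMeasure := by
    refine integral_mono_ae
      ((memLp_two_iff_integrable_sq_norm (M.memLp_gradLift u).1).1 (M.memLp_gradLift u))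
      ((M.integrable_comp_traj (integrable_norm_sq_lp u.snd)).const_mul _) ?_
    filter_upwards [M.ae_norm_gradLift_le u] with q hq
    rw [← mul_pow]
    exact pow_le_pow_left₀ (norm_nonneg _) hq 2
  rw [integral_const_mul] at h3
  rw [← Lp.norm_sq_eq_integral] at h1 h2
  rw [integral_norm_sq_path, norm_sq_graph, pathBound]
  have h4 := M.massBound_pos
  have h5 : 0 ≤ M.massBound * ‖u.snd‖ ^ 2 := by positivity
  have h6 : 0 ≤ M.massBound * M.distortion ^ 2 * ‖u.fst‖ ^ 2 := by positivity
  have h7 := mul_le_mul_of_nonneg_left h2 (sq_nonneg M.distortion)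
  nlinarith

theorem ae_path_add (u v : M.Graph) :
    ∀ᵐ t ∂M.timeMeasure, M.path (u + v) t = M.path u t + M.path v t := by
  have h1 := M.quasiMeasurePreserving_traj.ae (Lp.coeFn_add u.fst v.fst)
  have h2 := M.quasiMeasurePreserving_traj.ae (Lp.coeFn_add u.snd v.snd)
  filter_upwards [Measure.ae_ae_of_ae_prod h1, Measure.ae_ae_of_ae_prod h2,
    (memLp_fst_traj u).ae_memLp_slice, (memLp_fst_traj v).ae_memLp_slice,
    (M.memLp_gradLift u).ae_memLp_slice, (M.memLp_gradLift v).ae_memLp_slice] with t h1 h2 a b c e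
  have e1 : lpSlice M.refMeasure (fun q => (u + v).fst (M.traj q)) t =
      lpSlice M.refMeasure (fun q => u.fst (M.traj q)) t +
      lpSlice M.refMeasure (fun q => v.fst (M.traj q)) t := by
    rw [lpSlice_congr (g' := fun q => u.fst (M.traj q) + v.fst (M.traj q)) (by simpa using h1)]
    exact lpSlice_add a b
  have e2 : lpSlice M.refMeasure (M.gradLift (u + v)) t =
      lpSlice M.refMeasure (M.gradLift u) t + lpSlice M.refMeasure (M.gradLift v) t := by
    rw [lpSlice_congr (g' := fun q => M.gradLift u q + M.gradLift v q) (by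
      filter_upwards [h2] with y hy
      unfold gradLift
      rw [WithLp.add_snd, hy, Pi.add_apply, map_add])]
    exact lpSlice_add c e
  unfold path
  rw [e1, e2]
  rfl

theorem ae_path_smul (r : ℝ) (u : M.Graph) :
    ∀ᵐ t ∂M.timeMeasure, M.path (r • u) t = r • M.path u t := by
  have h1 := M.quasiMeasurePreserving_traj.ae (Lp.coeFn_smul r u.fst)
  have h2 := M.quasiMeasurePreserving_traj.ae (Lp.coeFn_smul r u.snd)
  filter_upwards [Measure.ae_ae_of_ae_prod h1, Measure.ae_ae_of_ae_prod h2,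
    (memLp_fst_traj u).ae_memLp_slice, (M.memLp_gradLift u).ae_memLp_slice] with t h1 h2 a c
  have e1 : lpSlice M.refMeasure (fun q => (r • u).fst (M.traj q)) t =
      r • lpSlice M.refMeasure (fun q => u.fst (M.traj q)) t := by
    rw [lpSlice_congr (g' := fun q => r • u.fst (M.traj q)) (by simpa using h1)]
    exact lpSlice_smul r a
  have e2 : lpSlice M.refMeasure (M.gradLift (r • u)) t =
      r • lpSlice M.refMeasure (M.gradLift u) t := by
    rw [lpSlice_congr (g' := fun q => r • M.gradLift u q) (by
      filter_upwards [h2] with y hy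
      unfold gradLift
      rw [WithLp.smul_snd, hy, Pi.smul_apply, map_smul])]
    exact lpSlice_smul r c
  unfold path
  rw [e1, e2]
  rfl

theorem norm_sq_toLp_path (u : M.Graph) :
    ‖(M.memLp_path u).toLp‖ ^ 2 = ∫ t, ‖M.path u t‖ ^ 2 ∂M.timeMeasure := by
  rw [Lp.norm_sq_eq_integral]
  refine integral_congr_ae ?_
  filter_upwards [(M.memLp_path u).coeFn_toLp] with t ht
  rw [ht]

/-- The pull-back of the graph space as a continuous linear map. -/
noncomputable def pathL : M.Graph →L[ℝ] Lp M.InitGraph 2 M.timeMeasure :=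
  LinearMap.mkContinuous
    { toFun := fun u => (M.memLp_path u).toLp
      map_add' := fun u v => by
        rw [← MemLp.toLp_add, MemLp.toLp_eq_toLp_iff]
        exact M.ae_path_add u v
      map_smul' := fun r u => by
        rw [RingHom.id_apply, ← MemLp.toLp_const_smul, MemLp.toLp_eq_toLp_iff]
        exact M.ae_path_smul r u }
    √M.pathBound fun u => by
      change ‖(M.memLp_path u).toLp‖ ≤ _
      refine abs_le_of_sq_le_sq' ?_ (by positivity) |>.2
      rw [norm_sq_toLp_path, mul_pow, Real.sq_sqrt M.pathBound_pos.le]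
      exact M.integral_norm_sq_path_le u

theorem coeFn_pathL (u : M.Graph) : M.pathL u =ᵐ[M.timeMeasure] M.path u :=
  (M.memLp_path u).coeFn_toLp

theorem norm_sq_pathL (u : M.Graph) :
    ‖M.pathL u‖ ^ 2 = ∫ t, ‖M.path u t‖ ^ 2 ∂M.timeMeasure := M.norm_sq_toLp_path u

/-! ### Tangentiality of the gradients and lower bounds -/

/-- Obvious for test functions and closed under limits. It is needed because the pull-back of
gradients is bounded below only on tangential vectors. -/
theorem ae_inner_normal_eq_zero {u : M.Graph} (hu : u ∈ M.H) :
    ∀ᵐ p ∂M.stMeasure, inner ℝ (M.normal p) (u.snd p) = 0 := by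
  have hcl : IsClosed {f : Lp (EuclideanSpace ℝ (Fin d)) 2 M.stMeasure |
      ∀ᵐ p ∂M.stMeasure, f p ∈ {v | inner ℝ (M.normal p) v = 0}} :=
    Lp.isClosed_setOf_ae_mem fun p => isClosed_eq (by fun_prop) continuous_const
  have hcl' := hcl.preimage (f := fun u : M.Graph => u.snd) (WithLp.continuous_snd 2 _ _)
  refine closure_minimal ?_ hcl' hu
  intro v hv
  induction hv using Submodule.span_induction with
  | mem v hv =>
    obtain ⟨φ, -, hφ⟩ := hv
    filter_upwards [hφ.2, M.ae_mem_slab] with p hp hps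
    obtain ⟨t, ht, y, hy, rfl⟩ := M.mem_slab_iff.1 hps
    change inner ℝ (M.normal _) (v.snd _) = (0 : ℝ)
    rw [hp]
    exact M.inner_normal_tangProj (M.norm_normal_flow hy (Ioo_subset_Icc_self ht)) _
  | zero =>
    filter_upwards [Lp.coeFn_zero (EuclideanSpace ℝ (Fin d)) 2 M.stMeasure] with p hp
    change inner ℝ (M.normal _) (WithLp.snd (0 : M.Graph) _) = (0 : ℝ)
    rw [WithLp.zero_snd, hp]
    simp
  | add u v _ _ hu hv =>
    filter_upwards [hu, hv, Lp.coeFn_add u.snd v.snd] with p h1 h2 h3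
    change inner ℝ (M.normal _) (WithLp.snd (u + v) _) = (0 : ℝ)
    change inner ℝ (M.normal _) _ = (0 : ℝ) at h1 h2
    rw [WithLp.add_snd, h3, Pi.add_apply, inner_add_right, h1, h2, add_zero]
  | smul r u _ hu =>
    filter_upwards [hu, Lp.coeFn_smul r u.snd] with p h1 h3
    change inner ℝ (M.normal _) (WithLp.snd (r • u) _) = (0 : ℝ)
    change inner ℝ (M.normal _) _ = (0 : ℝ) at h1
    rw [WithLp.smul_snd, h3, Pi.smul_apply, real_inner_smul_right, h1, mul_zero]

/-- With tangential gradients the pull-back can be inverted pointwise at the cost of the distortion,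
and the measures are comparable. This is the coercivity behind the representation of functionals. -/
theorem norm_sq_le_norm_sq_pathL {u : M.Graph} (hu : u ∈ M.H) :
    ‖u‖ ^ 2 ≤ M.pathBound * ‖M.pathL u‖ ^ 2 := by
  have h1 := M.integral_le_integral_prod_comp_traj (integrable_norm_sq_lp u.fst)
    fun p => by positivity
  have h2 := M.integral_le_integral_prod_comp_traj (integrable_norm_sq_lp u.snd)
    fun p => by positivity
  have h3 : ∫ q, ‖u.snd (M.traj q)‖ ^ 2 ∂M.timeMeasure.prod M.refMeasure ≤
      ∫ q, M.distortion ^ 2 * ‖M.gradLift u q‖ ^ 2 ∂M.timeMeasure.prod M.refMeasure := by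
    refine integral_mono_ae (M.integrable_comp_traj (integrable_norm_sq_lp u.snd))
      (((memLp_two_iff_integrable_sq_norm (M.memLp_gradLift u).1).1
        (M.memLp_gradLift u)).const_mul _) ?_
    filter_upwards [M.ae_mem_domain,
      M.quasiMeasurePreserving_traj.ae (M.ae_inner_normal_eq_zero hu)] with q hq hn
    rw [← mul_pow]
    refine pow_le_pow_left₀ (norm_nonneg _) ?_ 2
    refine M.norm_le_norm_pullGrad_apply hq.2 hq.1 ?_
    rwa [← M.traj_of_mem (Ioo_subset_Icc_self hq.1) hq.2]
  rw [integral_const_mul] at h3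
  rw [← Lp.norm_sq_eq_integral] at h1 h2
  rw [norm_sq_pathL, integral_norm_sq_path, norm_sq_graph, pathBound]
  have h4 := M.massBound_pos
  have h5 : 0 ≤ ∫ q, ‖M.gradLift u q‖ ^ 2 ∂M.timeMeasure.prod M.refMeasure :=
    integral_nonneg fun q => by positivity
  have h6 : 0 ≤ ∫ q, ‖u.fst (M.traj q)‖ ^ 2 ∂M.timeMeasure.prod M.refMeasure :=
    integral_nonneg fun q => by positivity
  have h7 := mul_le_mul_of_nonneg_left h3 h4.le
  have h8 := mul_nonneg h4.le h5
  have h9 := mul_nonneg (mul_nonneg h4.le (sq_nonneg M.distortion)) h6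
  nlinarith

theorem Hslab_le_H (a b : ℝ) : M.Hslab a b ≤ M.H := fun _ hu => hu.1

/-- Closedness makes the slab space complete, as the Riesz and Lax–Milgram theorems require. -/
theorem isClosed_Hslab (a b : ℝ) : IsClosed (M.Hslab a b : Set M.Graph) := by
  have h1 : ∀ (F : Type) [NormedAddCommGroup F],
      IsClosed {f : Lp F 2 M.stMeasure | ∀ᵐ p ∂M.stMeasure,
        f p ∈ {v : F | p.2 ∉ Ioc a b → v = 0}} := fun F _ =>
    Lp.isClosed_setOf_ae_mem fun p => by
      by_cases hp : p.2 ∈ Ioc a b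
      · simp [hp]
      · simp [hp]
  have h2 : (M.Hslab a b : Set M.Graph) = (M.H : Set M.Graph) ∩
      ((fun u : M.Graph => u.fst) ⁻¹' {f | ∀ᵐ p ∂M.stMeasure,
        f p ∈ {v : ℝ | p.2 ∉ Ioc a b → v = 0}} ∩
      (fun u : M.Graph => u.snd) ⁻¹' {f | ∀ᵐ p ∂M.stMeasure,
        f p ∈ {v : EuclideanSpace ℝ (Fin d) | p.2 ∉ Ioc a b → v = 0}}) := by
    ext u
    constructor
    · rintro ⟨hH, hu⟩
      refine ⟨hH, ?_, ?_⟩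
      · filter_upwards [hu] with p hp hpm using (hp hpm).1
      · filter_upwards [hu] with p hp hpm using (hp hpm).2
    · rintro ⟨hH, hu1, hu2⟩
      refine ⟨hH, ?_⟩
      filter_upwards [hu1, hu2] with p h1 h2 hpm using ⟨h1 hpm, h2 hpm⟩
  rw [h2]
  exact (Submodule.isClosed_topologicalClosure _).inter
    (((h1 ℝ).preimage (WithLp.continuous_fst 2 _ _)).inter
      ((h1 (EuclideanSpace ℝ (Fin d))).preimage (WithLp.continuous_snd 2 _ _)))

instance (a b : ℝ) : CompleteSpace (M.Hslab a b) := (M.isClosed_Hslab a b).completeSpace_coe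

/-- Functionals on the slab space are represented by `L²` functions of time. -/
theorem exists_eq_inner_pathL {a b : ℝ} (F : StrongDual ℝ (M.Hslab a b)) :
    ∃ f : Lp M.InitGraph 2 M.timeMeasure, ∀ z : M.Hslab a b, F z = inner ℝ f (M.pathL z) := by
  let A : M.Hslab a b →L[ℝ] Lp M.InitGraph 2 M.timeMeasure := M.pathL ∘L (M.Hslab a b).subtypeL
  let B : M.Hslab a b →L[ℝ] M.Hslab a b →L[ℝ] ℝ :=
    (innerSL ℝ).bilinearComp A A
  have hB : ∀ x y, B x y = inner ℝ (A x) (A y) := fun x y => rfl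
  have hc : IsCoercive B := by
    refine ⟨M.pathBound⁻¹, inv_pos.2 M.pathBound_pos, fun z => ?_⟩
    rw [hB, real_inner_self_eq_norm_sq, mul_assoc, ← sq, inv_mul_le_iff₀ M.pathBound_pos]
    exact M.norm_sq_le_norm_sq_pathL (M.Hslab_le_H a b z.2)
  -- Lax–Milgram for the pulled back inner product `B`, coercive on the slab space: `F` is `B x ·`,
  -- so `A x` is the representing function.
  let x := hc.continuousLinearEquivOfBilin.symm ((InnerProductSpace.toDual ℝ _).symm F)
  refine ⟨A x, fun z => ?_⟩
  change F z = inner ℝ (A x) (A z)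
  rw [← hB, ← hc.continuousLinearEquivOfBilin_apply, ContinuousLinearEquiv.apply_symm_apply,
    InnerProductSpace.toDual_symm_apply]

end EvolvingSurface

namespace EvolvingSurface

variable {d : ℕ} (M : EvolvingSurface d)

/-! ### The mass operators -/

/-- The operator on `L²` of the initial surface that represents the inner product of `L²(Γ(t))`. -/
noncomputable def mass (t : ℝ) : M.InitL2 →L[ℝ] M.InitL2 :=
  ContinuousLinearMap.adjoint (lpInclOfLe ℝ (M.pulled_le_refMeasure t)) ∘L
    lpInclOfLe ℝ (M.pulled_le_refMeasure t)

theorem inner_mass_eq (t : ℝ) (f g : M.InitL2) : inner ℝ (M.mass t f) g =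
    inner ℝ (lpInclOfLe ℝ (M.pulled_le_refMeasure t) f)
      (lpInclOfLe ℝ (M.pulled_le_refMeasure t) g) := by
  rw [mass, ContinuousLinearMap.comp_apply, ContinuousLinearMap.adjoint_inner_left]

theorem inner_mass (t : ℝ) (f g : M.InitL2) :
    inner ℝ (M.mass t f) g = ∫ y, inner ℝ (f y) (g y) ∂M.pulled t := by
  rw [inner_mass_eq, inner_lpInclOfLe]

theorem inner_mass_self (t : ℝ) (f : M.InitL2) :
    inner ℝ (M.mass t f) f = ∫ y, ‖f y‖ ^ 2 ∂M.pulled t := by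
  rw [inner_mass_eq, real_inner_self_eq_norm_sq, norm_sq_lpInclOfLe]

theorem integrable_norm_sq_pulled (t : ℝ) (f : M.InitL2) :
    Integrable (fun y => ‖f y‖ ^ 2) (M.pulled t) :=
  ((integrable_norm_sq_lp f).smul_measure ENNReal.ofReal_ne_top).mono_measure
    (M.pulled_le_refMeasure t)

theorem integral_le_exp_mul_integral (s t : ℝ) (f : M.InitL2) :
    ∫ y, ‖f y‖ ^ 2 ∂M.pulled s ≤ Real.exp (M.massRate * |M.clamp s - M.clamp t|) *
      ∫ y, ‖f y‖ ^ 2 ∂M.pulled t := by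
  refine (integral_mono_measure (M.pulled_le_smul s t)
    (Eventually.of_forall fun y => by positivity)
    ((M.integrable_norm_sq_pulled t f).smul_measure ENNReal.ofReal_ne_top)).trans ?_
  rw [integral_smul_measure, ENNReal.toReal_ofReal (Real.exp_pos _).le, smul_eq_mul]

theorem integral_pulled_le (t : ℝ) (f : M.InitL2) :
    ∫ y, ‖f y‖ ^ 2 ∂M.pulled t ≤ M.massBound * ‖f‖ ^ 2 := by
  rw [Lp.norm_sq_eq_integral]
  refine (integral_mono_measure (M.pulled_le_refMeasure t)
    (Eventually.of_forall fun y => by positivity)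
    ((integrable_norm_sq_lp f).smul_measure ENNReal.ofReal_ne_top)).trans ?_
  rw [integral_smul_measure, ENNReal.toReal_ofReal M.massBound_pos.le, smul_eq_mul]

theorem norm_sq_le_integral_pulled (t : ℝ) (f : M.InitL2) :
    ‖f‖ ^ 2 ≤ M.massBound * ∫ y, ‖f y‖ ^ 2 ∂M.pulled t := by
  rw [Lp.norm_sq_eq_integral]
  refine (integral_mono_measure (M.refMeasure_le_pulled t)
    (Eventually.of_forall fun y => by positivity)
    ((M.integrable_norm_sq_pulled t f).smul_measure ENNReal.ofReal_ne_top)).trans ?_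
  rw [integral_smul_measure, ENNReal.toReal_ofReal M.massBound_pos.le, smul_eq_mul]

theorem mass_symm (t : ℝ) (f g : M.InitL2) :
    inner ℝ (M.mass t f) g = inner ℝ f (M.mass t g) := by
  rw [inner_mass_eq, real_inner_comm, ← inner_mass_eq, real_inner_comm]

/-- The Lipschitz constant of the mass operators. -/
noncomputable def massLip : ℝ := M.massBound * M.massBound * M.massRate

theorem massLip_nonneg : 0 ≤ M.massLip :=
  mul_nonneg (mul_nonneg M.massBound_pos.le M.massBound_pos.le) M.massRate_nonneg

/-- The operators are symmetric, so their norms can be read off from quadratic forms, here integrals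
of `‖f‖²` against the pulled back measures. The comparison of these measures then yields all the
bounds; the Lipschitz bound comes from `exp x - 1 ≤ x exp X`. -/
theorem isMassFamily_mass : IsMassFamily M.mass M.massBound⁻¹ M.massBound M.massLip where
  pos := inv_pos.2 M.massBound_pos
  lip_nonneg := M.massLip_nonneg
  lip s t := by
    have hb := M.massBound_pos
    refine ContinuousLinearMap.norm_le_of_symm_of_abs_inner_self_le _ (fun x y => ?_)
      (mul_nonneg M.massLip_nonneg (abs_nonneg _)) fun f => ?_
    · rw [sub_apply, sub_apply, inner_sub_left, inner_sub_right, mass_symm, mass_symm]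
    rw [sub_apply, inner_sub_left, inner_mass_self, inner_mass_self]
    refine (Real.abs_sub_le_of_le_exp_mul (M.integral_le_exp_mul_integral s t f) ?_
      (mul_nonneg M.massRate_nonneg (abs_nonneg _)) (M.massRate_mul_abs_clamp_sub_le s t)
      (integral_nonneg fun y => by positivity) (integral_nonneg fun y => by positivity)
      (M.integral_pulled_le s f) (M.integral_pulled_le t f)).trans ?_
    · rw [abs_sub_comm]
      exact M.integral_le_exp_mul_integral t s f
    · have h1 := mul_le_mul_of_nonneg_left (M.abs_clamp_sub_le s t) M.massRate_nonneg
      have h2 : 0 ≤ M.massBound * (M.massBound * ‖f‖ ^ 2) := by positivity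
      have h3 := mul_le_mul_of_nonneg_left h1 h2
      rw [massLip]
      change M.massBound * (M.massBound * ‖f‖ ^ 2) * (M.massRate * |M.clamp s - M.clamp t|) ≤ _
      linarith
  bound t := by
    refine ContinuousLinearMap.norm_le_of_symm_of_abs_inner_self_le _ (M.mass_symm t)
      M.massBound_pos.le fun f => ?_
    rw [inner_mass_self, abs_of_nonneg (integral_nonneg fun y => by positivity)]
    exact M.integral_pulled_le t f
  symm := M.mass_symm
  coercive t f := by
    rw [inner_mass_self, inv_mul_le_iff₀ M.massBound_pos]
    exact M.norm_sq_le_integral_pulled t f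

/-! ### The energy space of the initial surface -/

/-- The energy space of the initial surface: the closure of the `C¹` functions together with
their tangential gradients. -/
noncomputable def InitH : Submodule ℝ M.InitGraph :=
  (Submodule.span ℝ {w | ∃ ζ : EuclideanSpace ℝ (Fin d) → ℝ, (∀ y ∈ M.Γ₀, ContDiffAt ℝ 1 ζ y) ∧
    w.fst =ᵐ[M.refMeasure] ζ ∧
    w.snd =ᵐ[M.refMeasure] fun y => M.tangProj (y, 0) (gradient ζ y)}).topologicalClosure

instance : CompleteSpace M.InitH := (Submodule.isClosed_topologicalClosure _).completeSpace_coe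

/-- The embedding of the energy space in `L²`. -/
noncomputable def initFst : M.InitH →L[ℝ] M.InitL2 :=
  WithLp.fstL 2 ℝ _ _ ∘L M.InitH.subtypeL

theorem initFst_apply (w : M.InitH) : M.initFst w = (w : M.InitGraph).fst := rfl

/-- For a test function `φ` the path at time `t` is the graph element of `y ↦ φ (Φ t y, t)`, which
is `C¹` near `Γ₀`. The rest is closure, since membership at almost every time is a closed condition.
-/
theorem ae_path_mem_initH {u : M.Graph} (hu : u ∈ M.H) :
    ∀ᵐ t ∂M.timeMeasure, M.path u t ∈ M.InitH := by
  have hiff : ∀ u, (∀ᵐ t ∂M.timeMeasure, M.path u t ∈ M.InitH) ↔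
      M.pathL u ∈ {f : Lp M.InitGraph 2 M.timeMeasure |
        ∀ᵐ t ∂M.timeMeasure, f t ∈ (M.InitH : Set M.InitGraph)} := fun u =>
    eventually_congr (by filter_upwards [M.coeFn_pathL u] with t ht; rw [ht]; rfl)
  have hcl := (Lp.isClosed_setOf_ae_mem (μ := M.timeMeasure)
    (S := fun _ => (M.InitH : Set M.InitGraph))
    fun _ => Submodule.isClosed_topologicalClosure _).preimage M.pathL.continuous
  rw [hiff]
  refine closure_minimal ?_ hcl hu
  intro v hv
  change M.pathL v ∈ {f : Lp M.InitGraph 2 M.timeMeasure |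
        ∀ᵐ t ∂M.timeMeasure, f t ∈ (M.InitH : Set M.InitGraph)}
  rw [← hiff]
  induction hv using Submodule.span_induction with
  | mem v hv =>
    obtain ⟨φ, hφ, hrep⟩ := hv
    have h1 := M.quasiMeasurePreserving_traj.ae hrep.1
    have h2 := M.quasiMeasurePreserving_traj.ae hrep.2
    have h3 : ∀ᵐ t ∂M.timeMeasure, t ∈ Ioo 0 M.T := ae_restrict_mem measurableSet_Ioo
    filter_upwards [Measure.ae_ae_of_ae_prod h1, Measure.ae_ae_of_ae_prod h2, h3,
      (memLp_fst_traj v).ae_memLp_slice, (M.memLp_gradLift v).ae_memLp_slice] with t h1 h2 ht a c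
    have ht' := Ioo_subset_Icc_self ht
    refine Submodule.le_topologicalClosure _ (Submodule.subset_span
      ⟨fun y => φ (M.Φ t y, t), fun y hy => ?_, ?_, ?_⟩)
    · exact (hφ.1 _ (M.flow_mem_slab ht hy)).comp y
        ((((M.contDiffAt_flow_slice (M.Γ₀_subset_V hy) ht).of_le
          (by exact_mod_cast le_top)).prodMk contDiffAt_const))
    · filter_upwards [h1, coeFn_lpSlice (g := fun q => v.fst (M.traj q)) a, M.ae_mem_Γ₀] with y h1 h4 hy
      change lpSlice M.refMeasure (fun q => v.fst (M.traj q)) t y = _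
      rw [h4, h1, M.traj_of_mem ht' hy]
    · filter_upwards [h2, coeFn_lpSlice (g := M.gradLift v) c, M.ae_mem_Γ₀] with y h2 h4 hy
      change lpSlice M.refMeasure (M.gradLift v) t y = _
      rw [h4, gradLift, h2, M.traj_of_mem ht' hy, tangGrad]
      refine M.pullGrad_tangProj_gradient (φ := fun x => φ (x, t)) hy ht ?_
      exact ((hφ.1 _ (M.flow_mem_slab ht hy)).differentiableAt one_ne_zero).comp
        (f := fun x => (x, t)) (M.Φ t y) (by fun_prop)
  | zero =>
    filter_upwards [M.ae_path_smul 0 0] with t ht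
    rw [smul_zero, zero_smul] at ht
    rw [ht]
    exact M.InitH.zero_mem
  | add u v _ _ hu hv =>
    filter_upwards [hu, hv, M.ae_path_add u v] with t h1 h2 h3
    rw [h3]
    exact M.InitH.add_mem h1 h2
  | smul r u _ hu =>
    filter_upwards [hu, M.ae_path_smul r u] with t h1 h3
    rw [h3]
    exact M.InitH.smul_mem r h1

theorem ae_path_eq_zero {a b : ℝ} (z : M.Hslab a b) :
    ∀ᵐ t ∂M.timeMeasure, t ∉ Ioo a b → M.path z t = 0 := by
  -- The slab space allows nonzero values at the right end time `b`; that single time is a null set.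
  have hb : ∀ᵐ t ∂M.timeMeasure, t ≠ b :=
    ae_restrict_of_ae (compl_mem_ae_iff.2 (measure_singleton b))
  have h0 : ∀ (F : Type) [NormedAddCommGroup F] (g : ℝ × EuclideanSpace ℝ (Fin d) → F) (t : ℝ),
      (∀ᵐ y ∂M.refMeasure, g (t, y) = 0) → lpSlice M.refMeasure g t = 0 := fun F _ g t h => by
    rw [lpSlice_congr (g' := fun _ => 0) h, lpSlice, dif_pos MemLp.zero']
    exact MemLp.toLp_zero _
  filter_upwards [hb, Measure.ae_ae_of_ae_prod (M.quasiMeasurePreserving_traj.ae z.2.2)]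
    with t htb h1 ht
  have ht' : t ∉ Ioc a b := fun h => ht ⟨h.1, lt_of_le_of_ne h.2 htb⟩
  unfold path
  rw [h0 _ _ t (by filter_upwards [h1] with y hy using (hy ht').1), h0 _ _ t (by
    filter_upwards [h1] with y hy
    rw [gradLift, (hy ht').2, map_zero])]
  rfl

/-- An element of the graph space as a function of time with values in the energy space of the
initial surface. -/
noncomputable def initPath (a b : ℝ) (u : M.Graph) : ℝ → M.InitH :=
  (Ioo a b).indicator fun t => M.InitH.orthogonalProjectionOnto (M.path u t)

/-- The projection and the cut-off change the path only at a null set of times. They make it a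
globally defined measurable function with values in `InitH`, the form required by `IsEnergyPath`. -/
theorem ae_initPath {a b : ℝ} (u : M.Hslab a b) :
    ∀ᵐ t ∂M.timeMeasure, (M.initPath a b u t : M.InitGraph) = M.path u t := by
  filter_upwards [M.ae_path_mem_initH (M.Hslab_le_H a b u.2), M.ae_path_eq_zero u] with t h1 h2
  by_cases ht : t ∈ Ioo a b
  · rw [initPath, indicator_of_mem ht]
    exact congrArg Subtype.val
      (M.InitH.orthogonalProjectionOnto_mem_subspace_eq_self ⟨M.path u t, h1⟩)
  · rw [initPath, indicator_of_notMem ht, h2 ht]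
    rfl

theorem timeMeasure_restrict {a b : ℝ} (h0 : 0 ≤ a) (hT : b ≤ M.T) :
    M.timeMeasure.restrict (Ioo a b) = volume.restrict (Ioo a b) := by
  rw [timeMeasure, Measure.restrict_restrict measurableSet_Ioo,
    inter_eq_left.2 (Ioo_subset_Ioo h0 hT)]

theorem memLp_indicator_projection {a b : ℝ} (h0 : 0 ≤ a) (hT : b ≤ M.T)
    {f : ℝ → M.InitGraph} (hf : MemLp f 2 M.timeMeasure) :
    MemLp ((Ioo a b).indicator fun t => M.InitH.orthogonalProjectionOnto (f t)) 2 volume := by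
  rw [memLp_indicator_iff_restrict measurableSet_Ioo, ← M.timeMeasure_restrict h0 hT]
  exact (hf.clm_comp M.InitH.orthogonalProjectionOnto).restrict _

theorem memLp_initPath {a b : ℝ} (h0 : 0 ≤ a) (hT : b ≤ M.T) (u : M.Graph) :
    MemLp (M.initPath a b u) 2 volume :=
  M.memLp_indicator_projection h0 hT (M.memLp_path u)

/-! ### Multiplication with the divergence -/

theorem memLp_divw_mul (u : Lp ℝ 2 M.stMeasure) :
    MemLp (fun p => M.divw p * u p) 2 M.stMeasure := by
  refine (Lp.memLp u).of_le_mul (c := M.divBound)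
    (M.aestronglyMeasurable_divw.mul (Lp.aestronglyMeasurable u)) ?_
  filter_upwards [M.ae_abs_divw_le] with p hp
  rw [norm_mul]
  exact mul_le_mul_of_nonneg_right hp (norm_nonneg _)

/-- The product with the divergence of the velocity. -/
noncomputable def divMul (u : Lp ℝ 2 M.stMeasure) : Lp ℝ 2 M.stMeasure := (M.memLp_divw_mul u).toLp

theorem inner_divMul (u v : Lp ℝ 2 M.stMeasure) :
    inner ℝ (M.divMul u) v = ∫ p, M.divw p * u p * v p ∂M.stMeasure := by
  rw [L2.inner_def]
  refine integral_congr_ae ?_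
  filter_upwards [(M.memLp_divw_mul u).coeFn_toLp] with p hp
  change inner ℝ ((M.memLp_divw_mul u).toLp _ p) (v p) = _
  rw [hp]
  simp only [RCLike.inner_apply, conj_trivial]
  ring

theorem norm_divMul_le (u : Lp ℝ 2 M.stMeasure) : ‖M.divMul u‖ ≤ M.divBound * ‖u‖ := by
  refine Lp.norm_le_mul_norm_of_ae_le_mul ?_
  filter_upwards [M.ae_abs_divw_le, (M.memLp_divw_mul u).coeFn_toLp] with p hp h1
  change ‖(M.memLp_divw_mul u).toLp _ p‖ ≤ _
  rw [h1, norm_mul]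
  exact mul_le_mul_of_nonneg_right hp (norm_nonneg _)

end EvolvingSurface

/-! ### From the material derivative to an energy path -/

namespace EvolvingSurface

variable {d : ℕ} (M : EvolvingSurface d)

/-- The path of a test function `η(t) ζ(y)` is `η` times the graph element of `ζ`. -/
theorem ae_path_productTest {η : ℝ → ℝ} (hη : ContDiff ℝ ∞ η)
    {ζ : EuclideanSpace ℝ (Fin d) → ℝ} (hζ : ∀ y ∈ M.Γ₀, ContDiffAt ℝ 1 ζ y) {w : M.InitGraph}
    (hw1 : w.fst =ᵐ[M.refMeasure] ζ)
    (hw2 : w.snd =ᵐ[M.refMeasure] fun y => M.tangProj (y, 0) (gradient ζ y)) {z : M.Graph}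
    (hz : M.Represents z (M.productTest η ζ)) :
    ∀ᵐ t ∂M.timeMeasure, M.path z t = η t • w := by
  have h3 : ∀ᵐ t ∂M.timeMeasure, t ∈ Ioo 0 M.T := ae_restrict_mem measurableSet_Ioo
  filter_upwards [Measure.ae_ae_of_ae_prod (M.quasiMeasurePreserving_traj.ae hz.1),
    Measure.ae_ae_of_ae_prod (M.quasiMeasurePreserving_traj.ae hz.2), h3,
    (memLp_fst_traj z).ae_memLp_slice, (M.memLp_gradLift z).ae_memLp_slice] with t h1 h2 ht a c
  have ht' := Ioo_subset_Icc_self ht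
  have e1 : lpSlice M.refMeasure (fun q => z.fst (M.traj q)) t = η t • w.fst := by
    refine Lp.ext ?_
    filter_upwards [coeFn_lpSlice (g := fun q => z.fst (M.traj q)) a, h1, M.ae_mem_Γ₀, hw1,
      Lp.coeFn_smul (η t) w.fst] with y h4 h1 hy hw1 h5
    rw [h4, h1, h5, Pi.smul_apply, hw1, M.traj_of_mem ht' hy,
      M.productTest_flow (M.Γ₀_subset_collar hy) ht', smul_eq_mul]
  have e2 : lpSlice M.refMeasure (M.gradLift z) t = η t • w.snd := by
    refine Lp.ext ?_
    filter_upwards [coeFn_lpSlice (g := M.gradLift z) c, h2, M.ae_mem_Γ₀, hw2,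
      Lp.coeFn_smul (η t) w.snd] with y h4 h2 hy hw2 h5
    rw [h4, gradLift, h2, h5, Pi.smul_apply, hw2, M.traj_of_mem ht' hy,
      M.pullGrad_tangGrad_productTest hη hζ hy ht]
  unfold path
  rw [e1, e2]
  rfl

theorem ae_matDeriv_productTest {η : ℝ → ℝ} (hη : ContDiff ℝ ∞ η)
    {ζ : EuclideanSpace ℝ (Fin d) → ℝ} (hζ : ∀ y ∈ M.Γ₀, ContDiffAt ℝ 1 ζ y) :
    ∀ᵐ p ∂M.stMeasure, M.matDeriv (M.productTest η ζ) p = M.productTest (deriv η) ζ p := by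
  filter_upwards [M.ae_mem_slab] with p hp
  obtain ⟨t, ht, y, hy, rfl⟩ := M.mem_slab_iff.1 hp
  rw [M.matDeriv_productTest hη hζ hy ht,
    M.productTest_flow (M.Γ₀_subset_collar hy) (Ioo_subset_Icc_self ht)]

/-- Slicing in time turns the integral over `Γ(t)` into one against the pulled back measure, which
is what the mass operator represents. -/
theorem integral_mul_productTest {u : M.Graph} {θ : ℝ → ℝ}
    {ζ : EuclideanSpace ℝ (Fin d) → ℝ} {w : M.InitGraph}
    (hw1 : w.fst =ᵐ[M.refMeasure] ζ) (hm : MemLp (M.productTest θ ζ) 2 M.stMeasure) :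
    ∫ p, u.fst p * M.productTest θ ζ p ∂M.stMeasure =
      ∫ t, θ t * inner ℝ (M.mass t (M.path u t).fst) w.fst ∂M.timeMeasure := by
  rw [M.integral_stMeasure (f := fun p => u.fst p * M.productTest θ ζ p)
    ((Lp.memLp u.fst).integrable_mul hm)]
  have h3 : ∀ᵐ t ∂M.timeMeasure, t ∈ Ioo 0 M.T := ae_restrict_mem measurableSet_Ioo
  refine integral_congr_ae ?_
  filter_upwards [M.ae_coeFn_path_fst u, h3] with t h1 ht
  rw [inner_mass, ← integral_const_mul]
  refine integral_congr_ae ((M.pulled_absolutelyContinuous t).ae_le ?_)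
  filter_upwards [h1, hw1, M.ae_mem_Γ₀] with y h1 h2 hy
  have ht' := Ioo_subset_Icc_self ht
  rw [h2, h1, M.traj_of_mem ht' hy, M.productTest_flow (M.Γ₀_subset_collar hy) ht']
  simp only [RCLike.inner_apply, conj_trivial]
  ring

theorem integral_timeMeasure_eq {a b : ℝ} (h0 : 0 ≤ a) (hT : b ≤ M.T) {g : ℝ → ℝ}
    (hg : ∀ t ∉ Ioo a b, g t = 0) : ∫ t, g t ∂M.timeMeasure = ∫ t in Ioo a b, g t :=
  setIntegral_eq_of_subset_of_forall_sdiff_eq_zero measurableSet_Ioo (Ioo_subset_Ioo h0 hT)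
    fun t ht => hg t ht.2

theorem memLp_productTest_deriv {η : ℝ → ℝ} (hη : ContDiff ℝ ∞ η) (hc : HasCompactSupport η)
    (hs : tsupport η ⊆ Ioo 0 M.T) {ζ : EuclideanSpace ℝ (Fin d) → ℝ}
    (hζ : ∀ y ∈ M.Γ₀, ContDiffAt ℝ 1 ζ y) : MemLp (M.productTest (deriv η) ζ) 2 M.stMeasure := by
  have hη' : ContDiff ℝ ∞ (deriv η) := (contDiff_infty_iff_deriv.1 hη).2
  refine M.memLp_of_continuousOn
    (fun p hp => (M.contDiffAt_productTest hη' hζ hp).continuousAt.continuousWithinAt)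
    hc.deriv ((tsupport_deriv_subset (𝕜 := ℝ) (f := η)).trans hs) fun p _ hp => ?_
  rw [productTest, image_eq_zero_of_notMem_tsupport hp, zero_mul]

/-- Adding the divergence functional cancels the term `φ div_Γ w` of the definition, and a pure time
derivative of the test function remains. -/
theorem IsMatDeriv.apply_productTest {M : EvolvingSurface d} {a b : ℝ} (h0 : 0 ≤ a) (hT : b ≤ M.T)
    {u : M.Hslab a b} {ℓ : StrongDual ℝ (M.Hslab a b)} (hℓ : M.IsMatDeriv u ℓ)
    {η : ℝ → ℝ} (hη : ContDiff ℝ ∞ η) (hc : HasCompactSupport η) (hs : tsupport η ⊆ Ioo a b)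
    {ζ : EuclideanSpace ℝ (Fin d) → ℝ} (hζ : ∀ y ∈ M.Γ₀, ContDiffAt ℝ 1 ζ y) {z : M.Hslab a b}
    (hz : M.Represents z (M.productTest η ζ)) :
    ℓ z + inner ℝ (M.divMul (u : M.Graph).fst) (z : M.Graph).fst =
      -∫ p, (u : M.Graph).fst p * M.productTest (deriv η) ζ p ∂M.stMeasure := by
  have hm := M.memLp_productTest_deriv hη hc (hs.trans (Ioo_subset_Ioo h0 hT)) hζ
  have i1 : Integrable (fun p => (u : M.Graph).fst p * M.productTest (deriv η) ζ p) M.stMeasure :=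
    (Lp.memLp (u : M.Graph).fst).integrable_mul hm
  have i2 : Integrable (fun p => M.divw p * (u : M.Graph).fst p * (z : M.Graph).fst p)
      M.stMeasure := (M.memLp_divw_mul (u : M.Graph).fst).integrable_mul (Lp.memLp (z : M.Graph).fst)
  rw [hℓ _ z (M.isTest_productTest hη hc h0 hT hs hζ) hz, inner_divMul, neg_add_eq_iff_eq_add,
    ← sub_eq_add_neg, eq_sub_iff_add_eq, add_comm, ← integral_add i1 i2]
  refine integral_congr_ae ?_
  filter_upwards [hz.1, M.ae_matDeriv_productTest hη hζ] with p h1 h2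
  rw [h1, h2]
  ring

/-- Functionals on the slab space, in terms of paths in the energy space. -/
theorem exists_eq_integral_inner_initPath {a b : ℝ} (h0 : 0 ≤ a) (hT : b ≤ M.T)
    (F : StrongDual ℝ (M.Hslab a b)) : ∃ f : ℝ → M.InitH, MemLp f 2 volume ∧
      ∀ z : M.Hslab a b, F z = ∫ t in Ioo a b, inner ℝ (f t) (M.initPath a b z t) := by
  obtain ⟨g, hg⟩ := M.exists_eq_inner_pathL F
  refine ⟨(Ioo a b).indicator fun t => M.InitH.orthogonalProjectionOnto (g t),
    M.memLp_indicator_projection h0 hT (Lp.memLp g), fun z => ?_⟩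
  rw [hg, L2.inner_def, ← M.integral_timeMeasure_eq h0 hT fun t ht => by
    rw [indicator_of_notMem ht, inner_zero_left]]
  refine integral_congr_ae ?_
  filter_upwards [M.coeFn_pathL z, M.ae_path_eq_zero z, M.ae_initPath z] with t h1 h2 h3
  rw [h1]
  by_cases ht : t ∈ Ioo a b
  · rw [indicator_of_mem ht, ← h3]
    exact (M.InitH.inner_orthogonalProjectionOnto_eq_of_mem_right _ _).symm
  · rw [h2 ht, inner_zero_right, indicator_of_notMem ht, inner_zero_left]

variable {M} in
-- `InitH` is by definition the closed span of these elements, so a vector orthogonal to all of them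
-- is orthogonal to itself.
theorem eq_zero_of_forall_inner_eq_zero {X : M.InitH}
    (h : ∀ (w : M.InitH) (ζ : EuclideanSpace ℝ (Fin d) → ℝ), (∀ y ∈ M.Γ₀, ContDiffAt ℝ 1 ζ y) →
      (w : M.InitGraph).fst =ᵐ[M.refMeasure] ζ →
      (w : M.InitGraph).snd =ᵐ[M.refMeasure] (fun y => M.tangProj (y, 0) (gradient ζ y)) →
      inner ℝ w X = 0) : X = 0 := by
  have key : ∀ w ∈ M.InitH, inner ℝ w (X : M.InitGraph) = (0 : ℝ) := by
    have hcl : IsClosed {w : M.InitGraph | inner ℝ w (X : M.InitGraph) = (0 : ℝ)} :=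
      isClosed_eq (by fun_prop) continuous_const
    refine fun w hw => closure_minimal ?_ hcl hw
    intro w hw
    induction hw using Submodule.span_induction with
    | mem w hw =>
      have hwm : w ∈ M.InitH := Submodule.le_topologicalClosure _ (Submodule.subset_span hw)
      obtain ⟨ζ, hζ, hw1, hw2⟩ := hw
      exact h ⟨w, hwm⟩ ζ hζ hw1 hw2
    | zero => exact inner_zero_left _
    | add v w _ _ hv hw =>
      simp only [mem_ofPred_eq] at hv hw ⊢
      rw [inner_add_left, hv, hw, add_zero]
    | smul r w _ hw =>
      simp only [mem_ofPred_eq] at hw ⊢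
      rw [real_inner_smul_left, hw, mul_zero]
  exact Subtype.ext (inner_self_eq_zero.1 (key X X.2))

/-- Paths in the energy space, mapped to its dual by the mass operators. -/
noncomputable def momentum (a b : ℝ) (u : M.Graph) (t : ℝ) : M.InitH :=
  ContinuousLinearMap.adjoint M.initFst (M.mass t (M.initFst (M.initPath a b u t)))

theorem memLp_momentum {a b : ℝ} (h0 : 0 ≤ a) (hT : b ≤ M.T) (u : M.Graph) :
    MemLp (M.momentum a b u) 2 volume :=
  (M.isMassFamily_mass.memLp ((M.memLp_initPath h0 hT u).clm_comp M.initFst)).clm_comp _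

/-- The representation of the corrected functional is evaluated at the product test function, whose
path is `η(t) w`. The result is the weak form of `(P† J P u)' = f`, tested with a fixed spatial
element. -/
theorem integral_inner_momentum {a b : ℝ} (h0 : 0 ≤ a) (hT : b ≤ M.T)
    {u : M.Hslab a b} {ℓ : StrongDual ℝ (M.Hslab a b)} (hℓ : M.IsMatDeriv u ℓ) {f : ℝ → M.InitH}
    (hf : ∀ z : M.Hslab a b, ℓ z + inner ℝ (M.divMul (u : M.Graph).fst) (z : M.Graph).fst =
      ∫ t in Ioo a b, inner ℝ (f t) (M.initPath a b z t))
    {η : ℝ → ℝ} (hη : ContDiff ℝ ∞ η) (hc : HasCompactSupport η) (hs : tsupport η ⊆ Ioo a b)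
    {ζ : EuclideanSpace ℝ (Fin d) → ℝ} (hζ : ∀ y ∈ M.Γ₀, ContDiffAt ℝ 1 ζ y) {w : M.InitH}
    (hw1 : (w : M.InitGraph).fst =ᵐ[M.refMeasure] ζ)
    (hw2 : (w : M.InitGraph).snd =ᵐ[M.refMeasure] fun y => M.tangProj (y, 0) (gradient ζ y)) :
    ∫ t in Ioo a b, η t * inner ℝ w (f t) =
      -∫ t in Ioo a b, deriv η t * inner ℝ w (M.momentum a b u t) := by
  have hη0 : ∀ t ∉ Ioo a b, η t = 0 := fun t ht =>
    image_eq_zero_of_notMem_tsupport fun h => ht (hs h)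
  have hη0' : ∀ t ∉ Ioo a b, deriv η t = 0 := fun t ht =>
    image_eq_zero_of_notMem_tsupport fun h =>
      ht (hs (tsupport_deriv_subset (𝕜 := ℝ) (f := η) h))
  obtain ⟨z, hz⟩ := M.exists_represents_productTest hη hc h0 hT hs hζ
  have hpath := M.ae_path_productTest hη hζ hw1 hw2 hz
  have hm := M.memLp_productTest_deriv hη hc (hs.trans (Ioo_subset_Ioo h0 hT)) hζ
  have e1 : ∫ t in Ioo a b, inner ℝ (f t) (M.initPath a b z t) =
      ∫ t in Ioo a b, η t * inner ℝ w (f t) := by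
    rw [← M.integral_timeMeasure_eq h0 hT fun t ht => by
        rw [initPath, indicator_of_notMem ht, inner_zero_right],
      ← M.integral_timeMeasure_eq h0 hT fun t ht => by rw [hη0 t ht, zero_mul]]
    refine integral_congr_ae ?_
    filter_upwards [hpath, M.ae_initPath z] with t h1 h2
    have : M.initPath a b z t = η t • w := Subtype.ext (by rw [h2, h1]; rfl)
    rw [this, real_inner_comm]
    exact real_inner_smul_left (F := M.InitH) w (f t) (η t)
  rw [← e1, ← hf, hℓ.apply_productTest h0 hT hη hc hs hζ hz, M.integral_mul_productTest hw1 hm,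
    ← M.integral_timeMeasure_eq h0 hT fun t ht => by rw [hη0' t ht, zero_mul]]
  congr 1
  refine integral_congr_ae ?_
  filter_upwards [M.ae_initPath u] with t h1
  rw [momentum, ContinuousLinearMap.adjoint_inner_right, real_inner_comm, initFst_apply,
    initFst_apply, h1]

/-- Functions with a material derivative are energy paths. -/
theorem IsMatDeriv.exists_isEnergyPath {M : EvolvingSurface d} {a b : ℝ} (h0 : 0 ≤ a) (hab : a < b)
    (hT : b ≤ M.T) {u : M.Hslab a b} {ℓ : StrongDual ℝ (M.Hslab a b)} (hℓ : M.IsMatDeriv u ℓ) :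
    ∃ f : ℝ → M.InitH, IsEnergyPath M.initFst M.mass a b (M.initPath a b u) f ∧
      ∀ z : M.Hslab a b, ℓ z + inner ℝ (M.divMul (u : M.Graph).fst) (z : M.Graph).fst =
        ∫ t in a..b, inner ℝ (f t) (M.initPath a b z t) := by
  -- The bounded functional to be represented is the material derivative plus multiplication with
  -- the divergence, so that `f` is the full time derivative of the momentum.
  let F : StrongDual ℝ (M.Hslab a b) := ℓ + (innerSL ℝ (M.divMul (u : M.Graph).fst)) ∘L
    (WithLp.fstL 2 ℝ _ _) ∘L (M.Hslab a b).subtypeL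
  obtain ⟨f, hfmem, hrep⟩ := M.exists_eq_integral_inner_initPath h0 hT F
  have hrep' : ∀ z : M.Hslab a b, ℓ z + inner ℝ (M.divMul (u : M.Graph).fst) (z : M.Graph).fst =
    ∫ t in Ioo a b, inner ℝ (f t) (M.initPath a b z t) := hrep
  refine ⟨f, ⟨M.memLp_initPath h0 hT u, hfmem, ?_⟩, fun z => ?_⟩
  swap
  · rw [hrep', intervalIntegral.integral_of_le hab.le, integral_Ioc_eq_integral_Ioo]
  have hyi : IntegrableOn (M.momentum a b u) (Ioo a b) :=
    ((M.memLp_momentum h0 hT u).restrict _).integrable (by norm_num)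
  have hfi : IntegrableOn f (Ioo a b) := (hfmem.restrict _).integrable (by norm_num)
  refine exists_ae_eq_const_add_integral (y := M.momentum a b u) hab hyi hfi fun η hη hc hs => ?_
  have hηc : Continuous (deriv η) := hη.continuous_deriv (by simp)
  obtain ⟨C, hC⟩ := hc.exists_bound_of_continuous hη.continuous
  obtain ⟨C', hC'⟩ := hc.deriv.exists_bound_of_continuous hηc
  have hi1 : Integrable (fun t => deriv η t • M.momentum a b u t) (volume.restrict (Ioo a b)) :=
    hyi.bdd_smul C' hηc.aestronglyMeasurable (Eventually.of_forall hC')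
  have hi2 : Integrable (fun t => η t • f t) (volume.restrict (Ioo a b)) :=
    hfi.bdd_smul C hη.continuous.aestronglyMeasurable (Eventually.of_forall hC)
  rw [eq_neg_iff_add_eq_zero]
  -- The identity of vectors in `InitH` follows from scalar identities, one for each spatial test
  -- function.
  refine eq_zero_of_forall_inner_eq_zero fun w ζ hζ hw1 hw2 => ?_
  rw [inner_add_right, ← integral_inner hi1, ← integral_inner hi2]
  have e1 : ∀ (r : ℝ) (x : M.InitH), inner ℝ w (r • x) = r * inner ℝ w x :=
    fun r x => real_inner_smul_right (F := M.InitH) w x r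
  simp only [e1]
  rw [M.integral_inner_momentum h0 hT hℓ hrep' hη hc hs hζ hw1 hw2]
  ring

end EvolvingSurface

/-! ### Two auxiliary inequalities for the slab estimates -/

theorem MeasureTheory.MemLp.integral_norm_mul_norm_le {α V W : Type*} {m : MeasurableSpace α}
    {μ : Measure α} [NormedAddCommGroup V] [NormedAddCommGroup W] {f : α → V} {g : α → W}
    (hf : MemLp f 2 μ) (hg : MemLp g 2 μ) :
    ∫ t, ‖f t‖ * ‖g t‖ ∂μ ≤ √(∫ t, ‖f t‖ ^ 2 ∂μ) * √(∫ t, ‖g t‖ ^ 2 ∂μ) := by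
  have h := integral_mul_le_Lp_mul_Lq_of_nonneg (p := 2) (q := 2) (μ := μ)
    (f := fun t => ‖f t‖) (g := fun t => ‖g t‖) ⟨by norm_num, by norm_num, by norm_num⟩
    (Eventually.of_forall fun t => norm_nonneg _) (Eventually.of_forall fun t => norm_nonneg _)
    (by simpa using hf.norm) (by simpa using hg.norm)
  simpa only [Real.rpow_two, ← Real.sqrt_eq_rpow] using h

/-- `i₁` and `i₂` will be the two divergence terms contained in the energy balance; they are moved
to the error, which explains the summand `2 * D`. -/
theorem abs_sub_le_of_balance {p q i₁ i₂ I g₁ g₂ Λ K D x y : ℝ} (e : I = (p + i₁) + (q + i₂))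
    (h : |g₁ - g₂ - I| ≤ Λ * (K * (x * y))) (h₁ : |i₁| ≤ D * (x * y)) (h₂ : |i₂| ≤ D * (y * x)) :
    |p + q - (g₁ - g₂)| ≤ (Λ * K + 2 * D) * (x * y) := by
  subst e
  have := abs_le.1 h
  have := abs_le.1 h₁
  have := abs_le.1 h₂
  rw [abs_le]
  constructor <;> linarith

namespace EvolvingSurface

variable {d : ℕ} (M : EvolvingSurface d)

/-! ### Traces -/

variable {M} in
theorem memLp_surface_lift {s : ℝ} (hs : s ∈ Icc 0 M.T) (g : Lp ℝ 2 (M.surfaceMeasure s)) :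
    MemLp (fun y => g (M.Φ s y)) 2 M.refMeasure := by
  have h1 : MemLp g 2 ((M.pulled s).map (M.Φ s)) := by
    rw [← M.surfaceMeasure_eq_map hs]
    exact Lp.memLp g
  have h2 : MemLp (g ∘ M.Φ s) 2 (M.pulled s) :=
    (memLp_map_measure_iff h1.1 ((M.aemeasurable_flow hs).mono_ac
      (M.pulled_absolutelyContinuous s))).1 h1
  exact h2.of_measure_le_smul ENNReal.ofReal_ne_top (M.refMeasure_le_pulled s)

theorem integral_surfaceMeasure {s : ℝ} (hs : s ∈ Icc 0 M.T) {f : EuclideanSpace ℝ (Fin d) → ℝ}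
    (hf : AEStronglyMeasurable f (M.surfaceMeasure s)) :
    ∫ x, f x ∂M.surfaceMeasure s = ∫ y, f (M.Φ s y) ∂M.pulled s := by
  rw [M.surfaceMeasure_eq_map hs] at hf ⊢
  exact integral_map ((M.aemeasurable_flow hs).mono_ac (M.pulled_absolutelyContinuous s)) hf

theorem ae_refMeasure_of_ae_surfaceMeasure {s : ℝ} (hs : s ∈ Icc 0 M.T)
    {p : EuclideanSpace ℝ (Fin d) → Prop} (h : ∀ᵐ x ∂M.surfaceMeasure s, p x) :
    ∀ᵐ y ∂M.refMeasure, p (M.Φ s y) := by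
  rw [M.surfaceMeasure_eq_map hs] at h
  exact (M.refMeasure_absolutelyContinuous s).ae_le
    (ae_of_ae_map ((M.aemeasurable_flow hs).mono_ac (M.pulled_absolutelyContinuous s)) h)

/-- Functions on `Γ(s)` as functions on the initial surface. -/
noncomputable def surfaceLift {s : ℝ} (hs : s ∈ Icc 0 M.T) (g : Lp ℝ 2 (M.surfaceMeasure s)) :
    M.InitL2 := (memLp_surface_lift hs g).toLp

theorem coeFn_surfaceLift {s : ℝ} (hs : s ∈ Icc 0 M.T) (g : Lp ℝ 2 (M.surfaceMeasure s)) :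
    M.surfaceLift hs g =ᵐ[M.refMeasure] fun y => g (M.Φ s y) :=
  (memLp_surface_lift hs g).coeFn_toLp

theorem inner_eq_inner_mass {s : ℝ} (hs : s ∈ Icc 0 M.T) (g h : Lp ℝ 2 (M.surfaceMeasure s)) :
    inner ℝ g h = inner ℝ (M.mass s (M.surfaceLift hs g)) (M.surfaceLift hs h) := by
  have hm : AEStronglyMeasurable (fun x => inner ℝ (g x) (h x)) (M.surfaceMeasure s) :=
    (Lp.aestronglyMeasurable g).inner (Lp.aestronglyMeasurable h)
  rw [L2.inner_def, inner_mass, M.integral_surfaceMeasure hs hm]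
  refine integral_congr_ae ((M.pulled_absolutelyContinuous s).ae_le ?_)
  filter_upwards [M.coeFn_surfaceLift hs g, M.coeFn_surfaceLift hs h] with y h1 h2
  rw [h1, h2]

/-- Limits of paths are found in `L²(Γ₀)`; surjectivity produces from them the element of `L²(Γ(s))`
that the definition of the trace asks for. -/
theorem surjective_surfaceLift {s : ℝ} (hs : s ∈ Icc 0 M.T) :
    Function.Surjective (M.surfaceLift hs) := by
  intro U
  have h1 : MemLp U 2 ((M.surfaceMeasure s).map fun x => M.back (x, s)) := by
    rw [← M.pulled_of_mem hs]
    exact (Lp.memLp U).of_measure_le_smul ENNReal.ofReal_ne_top (M.pulled_le_refMeasure s)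
  have h2 : MemLp (fun x => U (M.back (x, s))) 2 (M.surfaceMeasure s) :=
    (memLp_map_measure_iff h1.1 (M.aemeasurable_back hs)).1 h1
  refine ⟨h2.toLp, Lp.ext ?_⟩
  have h3 := M.ae_refMeasure_of_ae_surfaceMeasure hs h2.coeFn_toLp
  filter_upwards [M.coeFn_surfaceLift hs h2.toLp, h3, M.ae_mem_Γ₀] with y h4 h5 hy
  rw [h4, h5, M.back_flow (M.Γ₀_subset_collar hy) hs]

/-- At almost every time the integral defining the trace is the squared distance of the path to the
lifted function in `L²(Γ₀)`. -/
theorem isTrace_iff_tendsto (u : M.Graph) {s : ℝ} (hs : s ∈ Icc 0 M.T) {l : Filter ℝ}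
    (hl : Ioo 0 M.T ∈ l) (g : Lp ℝ 2 (M.surfaceMeasure s)) :
    M.IsTrace u s l g ↔
      Tendsto (fun t => (M.path u t).fst) (l ⊓ ae volume) (𝓝 (M.surfaceLift hs g)) := by
  have h1 : ∀ᶠ t in l ⊓ ae volume,
      ∫⁻ y, ‖u.fst (M.Φ t y, t) - g (M.Φ s y)‖ₑ ^ 2 ∂M.refMeasure =
        ENNReal.ofReal (‖(M.path u t).fst - M.surfaceLift hs g‖ ^ 2) := by
    have h2 := (ae_restrict_iff' measurableSet_Ioo).1 (M.ae_coeFn_path_fst u)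
    filter_upwards [mem_inf_of_left hl, mem_inf_of_right h2] with t ht h3
    have h4 := Lp.norm_sq_eq_integral ((M.path u t).fst - M.surfaceLift hs g)
    rw [h4, ofReal_integral_eq_lintegral_ofReal (integrable_norm_sq_lp _)
      (Eventually.of_forall fun y => by positivity)]
    refine lintegral_congr_ae ?_
    filter_upwards [h3 ht, M.coeFn_surfaceLift hs g, M.ae_mem_Γ₀,
      Lp.coeFn_sub (M.path u t).fst (M.surfaceLift hs g)] with y h5 h6 hy h7
    rw [h7, Pi.sub_apply, h5, h6, M.traj_of_mem (Ioo_subset_Icc_self ht) hy,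
      ENNReal.ofReal_pow (norm_nonneg _), ofReal_norm]
  have h2 : M.IsTrace u s l g ↔ Tendsto (fun t =>
      ENNReal.ofReal (‖(M.path u t).fst - M.surfaceLift hs g‖ ^ 2)) (l ⊓ ae volume) (𝓝 0) :=
    tendsto_congr' h1
  rw [h2, tendsto_iff_norm_sub_tendsto_zero]
  constructor
  · intro h
    have h3 := ((ENNReal.tendsto_toReal ENNReal.zero_ne_top).comp h).sqrt
    simp only [ENNReal.toReal_zero, Real.sqrt_zero] at h3
    refine h3.congr fun t => ?_
    simp [Real.sqrt_sq]
  · intro h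
    have h3 := ENNReal.tendsto_ofReal (h.pow 2)
    simpa using h3

/-- The trace is the limit of the paths. -/
theorem surfaceLift_trace {u : M.Graph} {s : ℝ} (hs : s ∈ Icc 0 M.T) {l : Filter ℝ}
    [(l ⊓ ae (volume : Measure ℝ)).NeBot] (hl : Ioo 0 M.T ∈ l) {U : M.InitL2}
    (hU : Tendsto (fun t => (M.path u t).fst) (l ⊓ ae volume) (𝓝 U)) :
    M.surfaceLift hs (M.trace u s l) = U := by
  have h : ∃ g, M.IsTrace u s l g := by
    obtain ⟨g, hg⟩ := M.surjective_surfaceLift hs U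
    exact ⟨g, (M.isTrace_iff_tendsto u hs hl g).2 (hg ▸ hU)⟩
  rw [trace, dif_pos h]
  exact tendsto_nhds_unique ((M.isTrace_iff_tendsto u hs hl _).1 h.choose_spec) hU

/-! ### Estimates for the time integrals -/

theorem integral_norm_path_mul_norm_path_le (u v : M.Graph) :
    ∫ t, ‖M.path u t‖ * ‖M.path v t‖ ∂M.timeMeasure ≤ M.pathBound * (‖u‖ * ‖v‖) := by
  refine ((M.memLp_path u).integral_norm_mul_norm_le (M.memLp_path v)).trans ?_
  have h1 : ∀ u, √(∫ t, ‖M.path u t‖ ^ 2 ∂M.timeMeasure) ≤ √M.pathBound * ‖u‖ := fun u => by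
    refine Real.sqrt_le_iff.2 ⟨by positivity, ?_⟩
    rw [mul_pow, Real.sq_sqrt M.pathBound_pos.le]
    exact M.integral_norm_sq_path_le u
  refine (mul_le_mul (h1 u) (h1 v) (Real.sqrt_nonneg _) (by positivity)).trans (le_of_eq ?_)
  have h2 := Real.mul_self_sqrt M.pathBound_pos.le
  linear_combination ‖u‖ * ‖v‖ * h2

theorem integrable_norm_path_mul_norm_path (u v : M.Graph) :
    Integrable (fun t => ‖M.path u t‖ * ‖M.path v t‖) M.timeMeasure :=
  (M.memLp_path u).norm.integrable_mul (M.memLp_path v).norm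

/-- The constant function one on the initial surface. -/
noncomputable def initOne : M.InitL2 := (memLp_const (μ := M.refMeasure) (p := 2) (1 : ℝ)).toLp

/-- Writing the mean as an inner product with the constant function one bounds it by the norm of the
path, so that the stabilization is bounded on `L²`. -/
theorem ae_surfInt_eq (u : M.Graph) : ∀ᵐ t ∂M.timeMeasure,
    surfInt u t = inner ℝ (M.mass t (M.path u t).fst) M.initOne := by
  have h3 : ∀ᵐ t ∂M.timeMeasure, t ∈ Ioo 0 M.T := ae_restrict_mem measurableSet_Ioo
  filter_upwards [M.ae_coeFn_path_fst u, h3] with t h1 ht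
  have ht' := Ioo_subset_Icc_self ht
  have hm : StronglyMeasurable fun x => u.fst (x, t) :=
    (Lp.stronglyMeasurable u.fst).comp_measurable measurable_prodMk_right
  rw [surfInt, M.integral_surfaceMeasure ht' hm.aestronglyMeasurable, inner_mass]
  refine integral_congr_ae ((M.pulled_absolutelyContinuous t).ae_le ?_)
  filter_upwards [h1, M.ae_mem_Γ₀,
    (memLp_const (μ := M.refMeasure) (p := 2) (1 : ℝ)).coeFn_toLp] with y h1 hy h2
  change _ = inner ℝ _ ((memLp_const (μ := M.refMeasure) (p := 2) (1 : ℝ)).toLp _ y)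
  rw [h1, h2, M.traj_of_mem ht' hy]
  simp

theorem norm_path_fst_le (u : M.Graph) (t : ℝ) : ‖(M.path u t).fst‖ ≤ ‖M.path u t‖ := by
  refine abs_le_of_sq_le_sq' ?_ (norm_nonneg _) |>.2
  rw [WithLp.prod_norm_sq_eq_of_L2]
  have := sq_nonneg ‖(M.path u t).snd‖
  linarith

theorem ae_abs_surfInt_le (u : M.Graph) : ∀ᵐ t ∂M.timeMeasure,
    |surfInt u t| ≤ M.massBound * ‖M.initOne‖ * ‖M.path u t‖ := by
  filter_upwards [M.ae_surfInt_eq u] with t ht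
  rw [ht]
  refine (abs_real_inner_le_norm _ _).trans ?_
  have h1 := (M.mass t).le_of_opNorm_le (M.isMassFamily_mass.bound t) (M.path u t).fst
  have h2 := mul_le_mul_of_nonneg_left (M.norm_path_fst_le u t) M.massBound_pos.le
  have h3 := mul_le_mul_of_nonneg_right (h1.trans h2) (norm_nonneg M.initOne)
  linarith

/-- The bound for the stabilization term. -/
noncomputable def stabBound : ℝ := (M.massBound * ‖M.initOne‖) ^ 2 * M.pathBound

theorem stabBound_nonneg : 0 ≤ M.stabBound := mul_nonneg (sq_nonneg _) M.pathBound_pos.le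

theorem abs_integral_surfInt_mul_le (u v : M.Graph) :
    |∫ t in Ioo 0 M.T, surfInt u t * surfInt v t| ≤ M.stabBound * (‖u‖ * ‖v‖) := by
  have h1 := norm_integral_le_of_norm_le (μ := M.timeMeasure)
    (f := fun t => surfInt u t * surfInt v t)
    ((M.integrable_norm_path_mul_norm_path u v).const_mul ((M.massBound * ‖M.initOne‖) ^ 2)) (by
      filter_upwards [M.ae_abs_surfInt_le u, M.ae_abs_surfInt_le v] with t h1 h2
      rw [norm_mul]
      refine (mul_le_mul h1 h2 (abs_nonneg _) ((abs_nonneg _).trans h1)).trans (le_of_eq ?_)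
      ring)
  refine h1.trans ?_
  rw [integral_const_mul, stabBound, mul_assoc]
  exact mul_le_mul_of_nonneg_left (M.integral_norm_path_mul_norm_path_le u v) (sq_nonneg _)

theorem norm_fst_le (u : M.Graph) : ‖u.fst‖ ≤ ‖u‖ := by
  refine abs_le_of_sq_le_sq' ?_ (norm_nonneg _) |>.2
  rw [M.norm_sq_graph]
  have := sq_nonneg ‖u.snd‖
  linarith

theorem norm_snd_le (u : M.Graph) : ‖u.snd‖ ≤ ‖u‖ := by
  refine abs_le_of_sq_le_sq' ?_ (norm_nonneg _) |>.2
  rw [M.norm_sq_graph]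
  have := sq_nonneg ‖u.fst‖
  linarith

theorem abs_inner_divMul_le (u v : M.Graph) :
    |inner ℝ (M.divMul u.fst) v.fst| ≤ M.divBound * (‖u‖ * ‖v‖) := by
  refine (abs_real_inner_le_norm _ _).trans ?_
  have h1 := (M.norm_divMul_le u.fst).trans
    (mul_le_mul_of_nonneg_left (M.norm_fst_le u) M.divBound_nonneg)
  have h2 := mul_le_mul h1 (M.norm_fst_le v) (norm_nonneg _) ((norm_nonneg _).trans h1)
  linarith

theorem exists_abs_aStab_le (ν σ : ℝ) :
    ∃ C : ℝ, 0 ≤ C ∧ ∀ u v : M.Graph, |aStab ν σ u v| ≤ C * (‖u‖ * ‖v‖) := by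
  refine ⟨|ν| + M.divBound + |σ| * M.stabBound, ?_, fun u v => ?_⟩
  · have := M.divBound_nonneg
    have := M.stabBound_nonneg
    positivity
  have h1 : |inner ℝ u.snd v.snd| ≤ ‖u‖ * ‖v‖ := (abs_real_inner_le_norm _ _).trans
    (mul_le_mul (M.norm_snd_le u) (M.norm_snd_le v) (norm_nonneg _) (norm_nonneg _))
  rw [aStab, aForm, ← M.inner_divMul]
  refine (abs_add_three _ _ _).trans ?_
  rw [abs_mul, abs_mul]
  have h2 := mul_le_mul_of_nonneg_left h1 (abs_nonneg ν)
  have h3 := M.abs_inner_divMul_le u v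
  have h4 := mul_le_mul_of_nonneg_left (M.abs_integral_surfInt_mul_le u v) (abs_nonneg σ)
  linarith

/-! ### Integration by parts on a time slab -/

section Slab

variable {M} {a b : ℝ}

theorem eventually_initPath (h0 : 0 ≤ a) (hT : b ≤ M.T) (u : M.Hslab a b) {l : Filter ℝ}
    (hl : Ioo a b ∈ l) :
    ∀ᶠ t in l ⊓ ae volume, M.initFst (M.initPath a b u t) = (M.path u t).fst := by
  have h1 := (ae_restrict_iff' measurableSet_Ioo).1 (M.ae_initPath u)
  filter_upwards [mem_inf_of_left hl, mem_inf_of_right h1] with t ht h2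
  rw [initFst_apply, h2 (Ioo_subset_Ioo h0 hT ht)]

theorem Wslab.isMatDeriv_dot (u : M.Wslab a b) : M.IsMatDeriv u.1 u.dot := u.2.choose_spec

theorem Wslab.exists_tendsto_left (h0 : 0 ≤ a) (hab : a < b) (hT : b ≤ M.T) (u : M.Wslab a b) :
    ∃ U, Tendsto (fun t => (M.path u.1 t).fst) (𝓝[>] a ⊓ ae volume) (𝓝 U) := by
  obtain ⟨f, hf, -⟩ := u.isMatDeriv_dot.exists_isEnergyPath h0 hab hT
  obtain ⟨U, hU⟩ := hf.exists_tendsto_left M.isMassFamily_mass hab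
  exact ⟨U, hU.congr' (eventually_initPath h0 hT u.1 (Ioo_mem_nhdsGT hab))⟩

theorem Wslab.exists_tendsto_right (h0 : 0 ≤ a) (hab : a < b) (hT : b ≤ M.T) (u : M.Wslab a b) :
    ∃ U, Tendsto (fun t => (M.path u.1 t).fst) (𝓝[<] b ⊓ ae volume) (𝓝 U) := by
  obtain ⟨f, hf, -⟩ := u.isMatDeriv_dot.exists_isEnergyPath h0 hab hT
  obtain ⟨U, hU⟩ := hf.exists_tendsto_right M.isMassFamily_mass hab
  exact ⟨U, hU.congr' (eventually_initPath h0 hT u.1 (Ioo_mem_nhdsLT hab))⟩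

variable (M) in
/-- The constant in the integration by parts. -/
noncomputable def partsBound : ℝ := M.massLip * M.pathBound + 2 * M.divBound

variable (M) in
theorem partsBound_nonneg : 0 ≤ M.partsBound := by
  have := M.divBound_nonneg
  have := M.massLip_nonneg
  have := M.pathBound_pos
  unfold partsBound
  positivity

theorem integral_norm_initPath_le (h0 : 0 ≤ a) (hab : a < b) (hT : b ≤ M.T) (u v : M.Hslab a b) :
    ∫ t in a..b, ‖M.initFst (M.initPath a b u t)‖ * ‖M.initFst (M.initPath a b v t)‖ ≤
      M.pathBound * (‖u‖ * ‖v‖) := by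
  rw [intervalIntegral.integral_of_le hab.le, integral_Ioc_eq_integral_Ioo,
    ← M.integral_timeMeasure_eq h0 hT fun t ht => by
      rw [initPath, indicator_of_notMem ht, map_zero, norm_zero, zero_mul]]
  refine le_trans (integral_mono_of_nonneg (Eventually.of_forall fun t => by positivity)
    (M.integrable_norm_path_mul_norm_path u v) ?_) (M.integral_norm_path_mul_norm_path_le u v)
  filter_upwards [M.ae_initPath u, M.ae_initPath v] with t h1 h2
  rw [initFst_apply, initFst_apply, h1, h2]
  exact mul_le_mul (M.norm_path_fst_le _ t) (M.norm_path_fst_le _ t) (norm_nonneg _)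
    (norm_nonneg _)

/-- Integration by parts, up to a term of lower order. -/
theorem Wslab.abs_dot_add_dot_sub_le (h0 : 0 ≤ a) (hab : a < b) (hT : b ≤ M.T) (u v : M.Wslab a b)
    {Ua Ub Va Vb : M.InitL2}
    (hUa : Tendsto (fun t => (M.path u.1 t).fst) (𝓝[>] a ⊓ ae volume) (𝓝 Ua))
    (hUb : Tendsto (fun t => (M.path u.1 t).fst) (𝓝[<] b ⊓ ae volume) (𝓝 Ub))
    (hVa : Tendsto (fun t => (M.path v.1 t).fst) (𝓝[>] a ⊓ ae volume) (𝓝 Va))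
    (hVb : Tendsto (fun t => (M.path v.1 t).fst) (𝓝[<] b ⊓ ae volume) (𝓝 Vb)) :
    |u.dot v.1 + v.dot u.1 - (inner ℝ (M.mass b Ub) Vb - inner ℝ (M.mass a Ua) Va)| ≤
      M.partsBound * (‖u.1‖ * ‖v.1‖) := by
  obtain ⟨f, hf, hfi⟩ := u.isMatDeriv_dot.exists_isEnergyPath h0 hab hT
  obtain ⟨k, hk, hki⟩ := v.isMatDeriv_dot.exists_isEnergyPath h0 hab hT
  have hb := energy_balance M.isMassFamily_mass hf hk hab
    (hUa.congr' (EventuallyEq.symm (eventually_initPath h0 hT u.1 (Ioo_mem_nhdsGT hab))))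
    (hUb.congr' (EventuallyEq.symm (eventually_initPath h0 hT u.1 (Ioo_mem_nhdsLT hab))))
    (hVa.congr' (EventuallyEq.symm (eventually_initPath h0 hT v.1 (Ioo_mem_nhdsGT hab))))
    (hVb.congr' (EventuallyEq.symm (eventually_initPath h0 hT v.1 (Ioo_mem_nhdsLT hab))))
  have hi1 : IntervalIntegrable (fun t => inner ℝ (f t) (M.initPath a b v.1 t)) volume a b :=
    (hf.memLp_deriv.integrable_inner_of_two hk.memLp).intervalIntegrable
  have hi2 : IntervalIntegrable (fun t => inner ℝ (k t) (M.initPath a b u.1 t)) volume a b :=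
    (hk.memLp_deriv.integrable_inner_of_two hf.memLp).intervalIntegrable
  -- The densities of the balance integrate to the two derivative pairings, each with its divergence
  -- correction, because `f` and `k` represent the corrected functionals.
  have e1 : ∫ t in a..b, (inner ℝ (f t) (M.initPath a b v.1 t) +
      inner ℝ (k t) (M.initPath a b u.1 t)) =
      (u.dot v.1 + inner ℝ (M.divMul (u.1 : M.Graph).fst) (v.1 : M.Graph).fst) +
      (v.dot u.1 + inner ℝ (M.divMul (v.1 : M.Graph).fst) (u.1 : M.Graph).fst) :=
    (intervalIntegral.integral_add hi1 hi2).trans (congrArg₂ _ (hfi v.1).symm (hki u.1).symm)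
  have h1 := mul_le_mul_of_nonneg_left (integral_norm_initPath_le h0 hab hT u.1 v.1)
    M.massLip_nonneg
  have h2 : |inner ℝ (M.divMul (u.1 : M.Graph).fst) (v.1 : M.Graph).fst| ≤
    M.divBound * (‖u.1‖ * ‖v.1‖) := M.abs_inner_divMul_le (u.1 : M.Graph) v.1
  have h3 : |inner ℝ (M.divMul (v.1 : M.Graph).fst) (u.1 : M.Graph).fst| ≤
    M.divBound * (‖v.1‖ * ‖u.1‖) := M.abs_inner_divMul_le (v.1 : M.Graph) u.1
  exact abs_sub_le_of_balance e1 (hb.trans h1) h2 h3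

end Slab

end EvolvingSurface

/-- Summation by parts for the node terms. -/
theorem sum_sub_add_sum_eq_sub_sum {m p r s D : ℕ → ℝ} (h0 : D 0 = p 0)
    (hD : ∀ n, n ≠ 0 → D n = p n - r n) (hs : ∀ n, n ≠ 0 → s n = r n - m n) {N : ℕ} (hN : 0 < N) :
    ∑ k ∈ Finset.range N, (m (k + 1) - p k) + ∑ k ∈ Finset.range N, D k =
      m N - ∑ n ∈ Finset.Ico 1 N, s n := by
  induction N, hN using Nat.le_induction with
  | base => simp [h0]
  -- The new terms `m (n+1) - p n + D n` reduce to `m (n+1) - r n`, and `r n - m n = s n` replaces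
  -- the old boundary term `m n` by the new one.
  | succ n hn ih =>
    rw [Finset.sum_range_succ, Finset.sum_range_succ, Finset.sum_Ico_succ_top hn,
      hD n (by omega), hs n (by omega)]
    linarith

namespace EvolvingSurface

variable {d : ℕ} {M : EvolvingSurface d} {N : ℕ}

/-! ### The time nodes -/

variable (M) in
theorem node_mono (N : ℕ) : Monotone (M.node N) := fun i j hij => by
  have := M.T_pos
  unfold node
  gcongr

variable (M) in
theorem node_nonneg (N k : ℕ) : 0 ≤ M.node N k := by
  have := M.T_pos
  unfold node
  positivity

variable (M) in
theorem node_lt_node_succ {N : ℕ} (hN : 0 < N) (k : ℕ) : M.node N k < M.node N (k + 1) := by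
  have := M.T_pos
  have : (0 : ℝ) < N := by exact_mod_cast hN
  unfold node
  push_cast
  gcongr
  linarith

variable (M) in
theorem node_le (hN : 0 < N) {k : ℕ} (hk : k ≤ N) : M.node N k ≤ M.T := by
  refine (M.node_mono N hk).trans (le_of_eq ?_)
  have : (N : ℝ) ≠ 0 := by exact_mod_cast hN.ne'
  unfold node
  field_simp

variable (M) in
theorem node_mem (hN : 0 < N) {k : ℕ} (hk : k ≤ N) : M.node N k ∈ Icc 0 M.T :=
  ⟨M.node_nonneg N k, M.node_le hN hk⟩

variable (M) in
theorem pairwise_disjoint_Ioc_node (N : ℕ) :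
    Pairwise (Function.onFun Disjoint fun k => Ioc (M.node N k) (M.node N (k + 1))) := by
  simpa using (M.node_mono N).pairwise_disjoint_on_Ioc_succ

/-! ### Orthogonality of the slabs -/

theorem inner_eq_zero_of_disjoint {a b a' b' : ℝ} (h : Disjoint (Ioc a b) (Ioc a' b'))
    (u : M.Hslab a b) (v : M.Hslab a' b') : inner ℝ (u : M.Graph) (v : M.Graph) = 0 := by
  have h1 : ∀ᵐ p ∂M.stMeasure, ((u : M.Graph).fst p = 0 ∧ (u : M.Graph).snd p = 0) ∨
      ((v : M.Graph).fst p = 0 ∧ (v : M.Graph).snd p = 0) := by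
    filter_upwards [u.2.2, v.2.2] with p h1 h2
    by_cases hp : p.2 ∈ Ioc a b
    · exact Or.inr (h2 (Set.disjoint_left.1 h hp))
    · exact Or.inl (h1 hp)
  rw [WithLp.prod_inner_apply, L2.inner_def, L2.inner_def, integral_eq_zero_of_ae,
    integral_eq_zero_of_ae, add_zero]
  · filter_upwards [h1] with p hp
    rcases hp with hp | hp
    · exact (congrArg (inner ℝ · _) hp.2).trans (inner_zero_left _)
    · exact (congrArg (inner ℝ _) hp.2).trans (inner_zero_right _)
  · filter_upwards [h1] with p hp
    rcases hp with hp | hp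
    · exact (congrArg (inner ℝ · _) hp.1).trans (inner_zero_left _)
    · exact (congrArg (inner ℝ _) hp.1).trans (inner_zero_right _)

namespace BrokenSpace

/-- Functions supported in different slabs are orthogonal, so Pythagoras applies. Cauchy–Schwarz
over the slabs then costs no factor depending on their number. -/
theorem norm_sq_toH (v : M.BrokenSpace N) : ‖v.toH‖ ^ 2 = ∑ k, ‖(v k).1‖ ^ 2 := by
  rw [← real_inner_self_eq_norm_sq, toH, sum_inner]
  refine Finset.sum_congr rfl fun k _ => ?_
  rw [inner_sum, Finset.sum_eq_single k, real_inner_self_eq_norm_sq]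
  · rfl
  · intro j _ hj
    exact inner_eq_zero_of_disjoint
      (M.pairwise_disjoint_Ioc_node N fun h => hj (Fin.ext h.symm)) _ _
  · simp

theorem norm_toH (v : M.BrokenSpace N) : ‖v.toH‖ = √(∑ k, ‖(v k).1‖ ^ 2) := by
  rw [← norm_sq_toH, Real.sqrt_sq (norm_nonneg _)]

theorem sum_norm_mul_norm_le (e v : M.BrokenSpace N) :
    ∑ k, ‖(e k).1‖ * ‖(v k).1‖ ≤ ‖e.toH‖ * ‖v.toH‖ := by
  rw [norm_toH, norm_toH]
  exact Real.sum_mul_le_sqrt_mul_sqrt _ _ _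

theorem wNorm_nonneg (v : M.BrokenSpace N) : 0 ≤ v.wNorm := Real.sqrt_nonneg _

theorem norm_toH_le_wNorm (v : M.BrokenSpace N) : ‖v.toH‖ ≤ v.wNorm := by
  rw [norm_toH]
  refine Real.sqrt_le_sqrt (Finset.sum_le_sum fun k _ => ?_)
  have := sq_nonneg ‖(v k).dot‖
  linarith

theorem iSup_norm_traceMinus_nonneg (v : M.BrokenSpace N) :
    0 ≤ ⨆ k : Fin N, ‖v.traceMinus (k + 1)‖ ^ 2 :=
  Real.iSup_nonneg fun _ => sq_nonneg _

theorem sum_norm_jump_nonneg (v : M.BrokenSpace N) :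
    0 ≤ ∑ k ∈ Finset.range N, ‖v.jump k‖ ^ 2 :=
  Finset.sum_nonneg fun _ _ => sq_nonneg _

theorem norm_toH_le_hNorm (v : M.BrokenSpace N) : ‖v.toH‖ ≤ v.hNorm := by
  refine Real.le_sqrt_of_sq_le ?_
  have := v.iSup_norm_traceMinus_nonneg
  have := v.sum_norm_jump_nonneg
  linarith

theorem norm_traceMinus_le_hNorm (v : M.BrokenSpace N) {n : ℕ} (h0 : n ≠ 0) (hn : n ≤ N) :
    ‖v.traceMinus n‖ ≤ v.hNorm := by
  obtain ⟨k, rfl⟩ := Nat.exists_eq_succ_of_ne_zero h0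
  refine Real.le_sqrt_of_sq_le ?_
  have := v.sum_norm_jump_nonneg
  have := sq_nonneg ‖v.toH‖
  have := le_ciSup (f := fun k : Fin N => ‖v.traceMinus (k + 1)‖ ^ 2) (Finite.bddAbove_range _)
    ⟨k, hn⟩
  simp only at this
  linarith

theorem norm_jump_le_hNorm (v : M.BrokenSpace N) {n : ℕ} (hn : n < N) :
    ‖v.jump n‖ ≤ v.hNorm := by
  refine Real.le_sqrt_of_sq_le ?_
  have := v.iSup_norm_traceMinus_nonneg
  have := sq_nonneg ‖v.toH‖
  have := Finset.single_le_sum (f := fun k => ‖v.jump k‖ ^ 2) (fun _ _ => sq_nonneg _)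
    (Finset.mem_range.2 hn)
  linarith

theorem hNorm_nonneg (v : M.BrokenSpace N) : 0 ≤ v.hNorm := Real.sqrt_nonneg _

/-- The right trace is the jump plus the left trace, both controlled by the norm; at the initial
node the jump is the right trace itself. -/
theorem norm_tracePlus_le_hNorm (v : M.BrokenSpace N) {n : ℕ} (hn : n < N) :
    ‖v.tracePlus n‖ ≤ 2 * v.hNorm := by
  have h1 := v.norm_jump_le_hNorm hn
  have h2 := v.hNorm_nonneg
  by_cases h : n = 0
  · rw [jump, if_pos h] at h1
    linarith
  · rw [jump, if_neg h] at h1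
    have h3 := v.norm_traceMinus_le_hNorm h hn.le
    have h4 := norm_sub_norm_le (v.tracePlus n) (v.traceMinus n)
    linarith

theorem abs_dotForm_le (e v : M.BrokenSpace N) : |e.dotForm v| ≤ e.wNorm * v.hNorm := by
  have h1 : |e.dotForm v| ≤ ∑ k, ‖(e k).dot‖ * ‖(v k).1‖ :=
    (Finset.abs_sum_le_sum_abs _ _).trans
      (Finset.sum_le_sum fun k _ => (e k).dot.le_opNorm (v k).1)
  refine h1.trans ((Real.sum_mul_le_sqrt_mul_sqrt _ _ _).trans ?_)
  rw [← norm_toH]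
  refine mul_le_mul (Real.sqrt_le_sqrt (Finset.sum_le_sum fun k _ => ?_)) v.norm_toH_le_hNorm
    (norm_nonneg _) (Real.sqrt_nonneg _)
  have := sq_nonneg ‖(e k).1‖
  linarith

/-- The norm bounds each right trace separately, so the jumps are summed without squares, as on the
right-hand side of the estimate. -/
theorem abs_dForm_le (e v : M.BrokenSpace N) :
    |e.dForm v| ≤ (∑ n ∈ Finset.range N, ‖e.jump n‖) * (2 * v.hNorm) := by
  rw [Finset.sum_mul]
  refine (Finset.abs_sum_le_sum_abs _ _).trans (Finset.sum_le_sum fun n hn => ?_)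
  exact (abs_real_inner_le_norm _ _).trans (mul_le_mul_of_nonneg_left
    (v.norm_tracePlus_le_hNorm (Finset.mem_range.1 hn)) (norm_nonneg _))

/-! ### Traces of the components -/

/-- Inside a slab all other components vanish. Hence the traces, defined through the sum of the
components, can be computed from a single component. -/
theorem ae_path_toH (v : M.BrokenSpace N) (k : Fin N) : ∀ᵐ t ∂M.timeMeasure,
    t ∈ Ioo (M.node N k) (M.node N (k + 1)) → M.path v.toH t = M.path (v k).1 t := by
  have h0 : ∀ᵐ t ∂M.timeMeasure, M.path (0 : M.Graph) t = 0 := by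
    filter_upwards [M.ae_path_smul 0 0] with t ht
    rwa [zero_smul, zero_smul] at ht
  have h1 : ∀ᵐ t ∂M.timeMeasure, t ∈ Ioo (M.node N k) (M.node N (k + 1)) →
      M.path (∑ j ∈ Finset.univ.erase k, ((v j).1 : M.Graph)) t = 0 := by
    refine Finset.sum_induction _ (fun u => ∀ᵐ t ∂M.timeMeasure,
      t ∈ Ioo (M.node N k) (M.node N (k + 1)) → M.path u t = 0) ?_ ?_ ?_
    · intro u w hu hw
      filter_upwards [hu, hw, M.ae_path_add u w] with t h1 h2 h3 ht
      rw [h3, h1 ht, h2 ht, add_zero]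
    · filter_upwards [h0] with t ht _ using ht
    · intro j hj
      filter_upwards [M.ae_path_eq_zero (v j).1] with t h1 ht
      exact h1 fun hjt => Set.disjoint_left.1
        (M.pairwise_disjoint_Ioc_node N fun h => Finset.ne_of_mem_erase hj (Fin.ext h))
        (Ioo_subset_Ioc_self hjt) (Ioo_subset_Ioc_self ht)
  have h2 : v.toH = ((v k).1 : M.Graph) + ∑ j ∈ Finset.univ.erase k, ((v j).1 : M.Graph) :=
    (Finset.add_sum_erase _ _ (Finset.mem_univ k)).symm
  filter_upwards [h1, M.ae_path_add ((v k).1 : M.Graph)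
    (∑ j ∈ Finset.univ.erase k, ((v j).1 : M.Graph))] with t h3 h4 ht
  rw [h2, h4, h3 ht, add_zero]

theorem eventually_path_toH (hN : 0 < N) (v : M.BrokenSpace N) (k : Fin N) {l : Filter ℝ}
    (hl : Ioo (M.node N k) (M.node N (k + 1)) ∈ l) : ∀ᶠ t in l ⊓ ae volume,
      (M.path (v k).1 t).fst = (M.path v.toH t).fst := by
  have h1 := (ae_restrict_iff' measurableSet_Ioo).1 (v.ae_path_toH k)
  filter_upwards [mem_inf_of_left hl, mem_inf_of_right h1] with t ht h2
  rw [h2 (Ioo_subset_Ioo (M.node_nonneg N k) (M.node_le hN k.2) ht) ht]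

/-- As the limit exists, the trace is not the default value zero and really is the limit that enters
the integration by parts. -/
theorem tendsto_path_tracePlus (hN : 0 < N) (v : M.BrokenSpace N) (k : Fin N) :
    Tendsto (fun t => (M.path (v k).1 t).fst) (𝓝[>] (M.node N k) ⊓ ae volume)
      (𝓝 (M.surfaceLift (M.node_mem hN k.2.le) (v.tracePlus k))) := by
  have h1 := M.node_lt_node_succ hN k
  obtain ⟨U, hU⟩ := (v k).exists_tendsto_left (M.node_nonneg N k) h1 (M.node_le hN k.2)
  have h2 := hU.congr' (eventually_path_toH hN v k (Ioo_mem_nhdsGT h1))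
  have h3 := M.surfaceLift_trace (M.node_mem hN k.2.le) (mem_of_superset (Ioo_mem_nhdsGT h1)
    (Ioo_subset_Ioo (M.node_nonneg N k) (M.node_le hN k.2))) h2
  rw [tracePlus, h3]
  exact hU

theorem tendsto_path_traceMinus (hN : 0 < N) (v : M.BrokenSpace N) (k : Fin N) :
    Tendsto (fun t => (M.path (v k).1 t).fst) (𝓝[<] (M.node N (k + 1)) ⊓ ae volume)
      (𝓝 (M.surfaceLift (M.node_mem hN k.2) (v.traceMinus (k + 1)))) := by
  have h1 := M.node_lt_node_succ hN k
  obtain ⟨U, hU⟩ := (v k).exists_tendsto_right (M.node_nonneg N k) h1 (M.node_le hN k.2)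
  have h2 := hU.congr' (eventually_path_toH hN v k (Ioo_mem_nhdsLT h1))
  have h3 := M.surfaceLift_trace (M.node_mem hN k.2) (mem_of_superset (Ioo_mem_nhdsLT h1)
    (Ioo_subset_Ioo (M.node_nonneg N k) (M.node_le hN k.2))) h2
  rw [traceMinus, h3]
  exact hU

/-! ### Integration by parts -/

theorem abs_dot_add_dot_sub_le (hN : 0 < N) (e v : M.BrokenSpace N) (k : Fin N) :
    |(e k).dot (v k).1 + (v k).dot (e k).1 -
      (inner ℝ (e.traceMinus (k + 1)) (v.traceMinus (k + 1)) -
        inner ℝ (e.tracePlus k) (v.tracePlus k))| ≤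
      M.partsBound * (‖(e k).1‖ * ‖(v k).1‖) := by
  rw [M.inner_eq_inner_mass (M.node_mem hN k.2), M.inner_eq_inner_mass (M.node_mem hN k.2.le)]
  exact (e k).abs_dot_add_dot_sub_le (M.node_nonneg N k) (M.node_lt_node_succ hN k)
    (M.node_le hN k.2) (v k) (tendsto_path_tracePlus hN e k) (tendsto_path_traceMinus hN e k)
    (tendsto_path_tracePlus hN v k) (tendsto_path_traceMinus hN v k)

theorem abs_dotForm_add_dotForm_sub_le (hN : 0 < N) (e v : M.BrokenSpace N) :
    |e.dotForm v + v.dotForm e - ∑ k ∈ Finset.range N,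
      (inner ℝ (e.traceMinus (k + 1)) (v.traceMinus (k + 1)) -
        inner ℝ (e.tracePlus k) (v.tracePlus k))| ≤
      M.partsBound * (‖e.toH‖ * ‖v.toH‖) := by
  rw [dotForm, dotForm, Finset.sum_range, ← Finset.sum_add_distrib, ← Finset.sum_sub_distrib]
  refine (Finset.abs_sum_le_sum_abs _ _).trans
    ((Finset.sum_le_sum fun k _ => abs_dot_add_dot_sub_le hN e v k).trans ?_)
  rw [← Finset.mul_sum]
  exact mul_le_mul_of_nonneg_left (e.sum_norm_mul_norm_le v) M.partsBound_nonneg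

/-- At an inner node the `(e_+, v_+)` terms cancel against the jump form, leaving `(e_-, v_-) -
(e_-, v_+)`, which is minus `(e_-, [v])`. At the initial node everything cancels, because there the
jump is `e_+`. -/
theorem sum_inner_add_dForm (hN : 0 < N) (e v : M.BrokenSpace N) :
    ∑ k ∈ Finset.range N, (inner ℝ (e.traceMinus (k + 1)) (v.traceMinus (k + 1)) -
        inner ℝ (e.tracePlus k) (v.tracePlus k)) + e.dForm v =
      inner ℝ (e.traceMinus N) (v.traceMinus N) -
        ∑ n ∈ Finset.Ico 1 N, inner ℝ (e.traceMinus n) (v.jump n) := by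
  refine sum_sub_add_sum_eq_sub_sum (m := fun n => inner ℝ (e.traceMinus n) (v.traceMinus n))
    (p := fun n => inner ℝ (e.tracePlus n) (v.tracePlus n))
    (r := fun n => inner ℝ (e.traceMinus n) (v.tracePlus n)) ?_ ?_ ?_ hN
  · rw [jump, if_pos rfl]
  · intro n hn
    rw [jump, if_neg hn, inner_sub_left]
  · intro n hn
    rw [jump, if_neg hn, inner_sub_right]

theorem abs_sum_inner_add_dForm_le (hN : 0 < N) (e v : M.BrokenSpace N) :
    |∑ k ∈ Finset.range N, (inner ℝ (e.traceMinus (k + 1)) (v.traceMinus (k + 1)) -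
        inner ℝ (e.tracePlus k) (v.tracePlus k)) + e.dForm v| ≤
      e.hNorm * (∑ n ∈ Finset.Ico 1 N, ‖v.jump n‖ + ‖v.traceMinus N‖) := by
  rw [sum_inner_add_dForm hN, mul_add, Finset.mul_sum, add_comm]
  refine (abs_sub _ _).trans (add_le_add ?_ ((Finset.abs_sum_le_sum_abs _ _).trans
    (Finset.sum_le_sum fun n hn => ?_)))
  · exact (abs_real_inner_le_norm _ _).trans (mul_le_mul_of_nonneg_right
      (e.norm_traceMinus_le_hNorm hN.ne' le_rfl) (norm_nonneg _))
  · obtain ⟨h1, h2⟩ := Finset.mem_Ico.1 hn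
    exact (abs_real_inner_le_norm _ _).trans (mul_le_mul_of_nonneg_right
      (e.norm_traceMinus_le_hNorm (by omega) h2.le) (norm_nonneg _))

theorem abs_form_le_left {ν σ C : ℝ} (hC : 0 ≤ C)
    (h : ∀ u v : M.Graph, |aStab ν σ u v| ≤ C * (‖u‖ * ‖v‖)) (e v : M.BrokenSpace N) :
    |e.form ν σ v| ≤
      (C + 2) * v.hNorm * (e.wNorm + ∑ n ∈ Finset.range N, ‖e.jump n‖) := by
  have h1 := e.abs_dotForm_le v
  have h2 := e.abs_dForm_le v
  have h3 := (h e.toH v.toH).trans (mul_le_mul_of_nonneg_left (mul_le_mul e.norm_toH_le_wNorm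
    v.norm_toH_le_hNorm (norm_nonneg _) (Real.sqrt_nonneg _)) hC)
  have h4 : 0 ≤ ∑ n ∈ Finset.range N, ‖e.jump n‖ := Finset.sum_nonneg fun _ _ => norm_nonneg _
  have h5 := mul_nonneg e.wNorm_nonneg v.hNorm_nonneg
  have h6 := mul_nonneg hC (mul_nonneg v.hNorm_nonneg h4)
  refine (abs_add_three _ _ _).trans ?_
  linarith

/-- The pairing `⟨ė,v⟩` is replaced by `-⟨v̇,e⟩`, the node terms and an error bounded by `‖e‖_H
‖v‖_H`. The node terms are combined with the jump form before any absolute value is taken, since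
separately they would involve right traces of `v`. -/
theorem abs_form_le_right (hN : 0 < N) {ν σ C : ℝ} (hC : 0 ≤ C)
    (h : ∀ u v : M.Graph, |aStab ν σ u v| ≤ C * (‖u‖ * ‖v‖)) (e v : M.BrokenSpace N) :
    |e.form ν σ v| ≤ (C + M.partsBound + 1) * e.hNorm *
      (v.wNorm + ∑ n ∈ Finset.Ico 1 N, ‖v.jump n‖ + ‖v.traceMinus N‖) := by
  have hm : ‖e.toH‖ * ‖v.toH‖ ≤ e.hNorm * v.wNorm := mul_le_mul e.norm_toH_le_hNorm
    v.norm_toH_le_wNorm (norm_nonneg _) e.hNorm_nonneg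
  have h1 := abs_le.1 (v.abs_dotForm_le e)
  have h2 := abs_le.1 (abs_sum_inner_add_dForm_le hN e v)
  have h3 := abs_le.1 ((h e.toH v.toH).trans (mul_le_mul_of_nonneg_left hm hC))
  have h4 := abs_le.1 ((abs_dotForm_add_dotForm_sub_le hN e v).trans
    (mul_le_mul_of_nonneg_left hm M.partsBound_nonneg))
  have h5 : 0 ≤ ∑ n ∈ Finset.Ico 1 N, ‖v.jump n‖ + ‖v.traceMinus N‖ :=
    add_nonneg (Finset.sum_nonneg fun _ _ => norm_nonneg _) (norm_nonneg _)
  have h6 := mul_nonneg (add_nonneg hC M.partsBound_nonneg) (mul_nonneg e.hNorm_nonneg h5)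
  rw [form, abs_le]
  constructor <;> linarith

end BrokenSpace

end EvolvingSurface

theorem lemma5p1 {d : ℕ} (hd : d = 2 ∨ d = 3) (M : EvolvingSurface d) (ν σ : ℝ)
    (hν : 0 < ν) (hσ : 0 ≤ σ) :
    ∃ c : ℝ, ∀ N : ℕ, 0 < N → ∀ e v : M.BrokenSpace N,
      |e.form ν σ v| ≤
        c * v.hNorm * (e.wNorm + ∑ n ∈ Finset.range N, ‖e.jump n‖) ∧
      |e.form ν σ v| ≤
        c * e.hNorm * (v.wNorm + ∑ n ∈ Finset.Ico 1 N, ‖v.jump n‖ + ‖v.traceMinus N‖) := by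
  obtain ⟨C, hC, h⟩ := M.exists_abs_aStab_le ν σ
  have hP := M.partsBound_nonneg
  -- One constant dominating both `C + 2` and `C + M.partsBound + 1`; it depends only on the
  -- surface, the field and the parameters.
  refine ⟨C + M.partsBound + 2, fun N hN e v => ⟨?_, ?_⟩⟩
  · refine (e.abs_form_le_left hC h v).trans ?_
    have := e.wNorm_nonneg
    have := v.hNorm_nonneg
    gcongr
    linarith
  · refine (e.abs_form_le_right hN hC h v).trans ?_
    have := v.wNorm_nonneg
    have := e.hNorm_nonneg
    gcongr
    linarith
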